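/- Let $n\ge 1$ and $\sigma\ge 0$. A holomorphic curve $f:\mathbf C\to\mathbf P^n$ is given by a homogeneous representation $f=[f_0:\dots:f_n]$, where the $f_j$ are entire functions without common zeros. Put $\|f\|^2=\sum_j|f_j|^2$. The Fubini–Study derivative and the Nevanlinna–Cartan characteristic of $f$ are $$\|f'\|^2=\|f\|^{-4}\sum_{i<j}|f_i'f_j-f_if_j'|^2,\qquad T(r,f)=\int_0^r\frac{dt}{t}\left(\frac1\pi\int_{|z|\le t}\|f'\|^2(z)\,dm(z)\right),$$ where $dm$ is the area element in $\mathbf C$. For a real number $K$ consider the condition $$\limsup_{z\to\infty}|z|^{-\sigma}\|f'(z)\|\le K.\tag{1}$$ (a) There is a constant $C(n,\sigma)>0$, depending only on $n$ and $\sigma$, such that for every holomorphic curve $f:\mathbf C\to\mathbf P^n$ omitting $n$ hyperplanes in general position and every $K$, condition (1) implies $$\limsup_{r\to\infty}\frac{T(r,f)}{r^{\sigma+1}}\le K\,C(n,\sigma).$$ (b) If the omitted hyperplanes are the coordinate hyperplanes $\{w_j=0\}$, $1\le j\le n$, then condition (1) implies the same inequality with the explicit constant $$C(n,\sigma)=2^{\sigma+1}(n+1)+6\cdot4^{\sigma}\,\frac{n(n+1)^2}{\sigma+1}.$$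 (c) For every holomorphic curve $f:\mathbf C\to\mathbf P^n$, without any assumption on omitted hyperplanes, condition (1) implies $\limsup_{r\to\infty}T(r,f)/r^{2\sigma+2}<\infty$. -/

import Mathlib

namespace HolCurve

/-- Complex projective space `P^n`. -/
abbrev PSpace (n : ℕ) : Type := Projectivization ℂ (Fin (n + 1) → ℂ)

/-- `(F 0, …, F n)` is a homogeneous representation of the map `f : ℂ → P^n`: the `F j` are
entire functions which never vanish simultaneously, and `f z = [F 0 z : … : F n z]`. -/
def IsHomogeneousRepresentation {n : ℕ} (f : ℂ → PSpace n) (F : Fin (n + 1) → ℂ → ℂ) : Prop :=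
  (∀ j, Differentiable ℂ (F j)) ∧
    ∀ z, ∃ h : (fun j => F j z) ≠ 0, f z = Projectivization.mk ℂ (fun j => F j z) h

/-- The Fubini–Study derivative `‖f'‖(z)` of the curve with homogeneous representation `F`:
`‖f'‖² = ‖f‖⁻⁴ ∑_{i<j} |f_i' f_j - f_i f_j'|²`, where `‖f‖² = ∑ |f_j|²`. -/
noncomputable def fsDeriv {n : ℕ} (F : Fin (n + 1) → ℂ → ℂ) (z : ℂ) : ℝ :=
  Real.sqrt (∑ i, ∑ j ∈ Finset.Ioi i, ‖deriv (F i) z * F j z - F i z * deriv (F j) z‖ ^ 2) /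
    ∑ j, ‖F j z‖ ^ 2

/-- The Nevanlinna–Cartan characteristic
`T(r,f) = ∫₀^r (1/t) ((1/π) ∫_{|z| ≤ t} ‖f'‖² dm) dt`. -/
noncomputable def characteristic {n : ℕ} (F : Fin (n + 1) → ℂ → ℂ) (r : ℝ) : ℝ :=
  ∫ t in (0 : ℝ)..r,
    (1 / t) * ((1 / Real.pi) * ∫ z in Metric.closedBall (0 : ℂ) t, fsDeriv F z ^ 2)

/-- The hyperplane of `P^n` given by the equation `l(w) = 0`. -/
def hyperplane {n : ℕ} (l : Module.Dual ℂ (Fin (n + 1) → ℂ)) : Set (PSpace n) :=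
  {p | p.submodule ≤ LinearMap.ker l}

/-- The hyperplanes `l i = 0` in `P^n` are in general position: any at most `n + 1` of the
linear forms are linearly independent. -/
def InGeneralPosition {n q : ℕ} (l : Fin q → Module.Dual ℂ (Fin (n + 1) → ℂ)) : Prop :=
  ∀ s : Finset (Fin q), s.card ≤ n + 1 → LinearIndependent ℂ (fun i : s => l i)

/-- The curve `f` omits the hyperplane `l = 0`. -/
def Omits {n : ℕ} (f : ℂ → PSpace n) (l : Module.Dual ℂ (Fin (n + 1) → ℂ)) : Prop :=
  ∀ z, f z ∉ hyperplane l

/-- The growth condition `limsup_{z → ∞} |z|^{-σ} ‖f'(z)‖ ≤ K`, the upper limit being taken in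
the extended reals. -/
def FSGrowth {n : ℕ} (F : Fin (n + 1) → ℂ → ℂ) (σ K : ℝ) : Prop :=
  Filter.limsup (fun z : ℂ => ((‖z‖ ^ (-σ) * fsDeriv F z : ℝ) : EReal)) (Filter.cocompact ℂ)
    ≤ (K : EReal)

/-- `limsup_{r → ∞} T(r,f) / r^ρ`, in the extended reals. -/
noncomputable def upperGrowth {n : ℕ} (F : Fin (n + 1) → ℂ → ℂ) (ρ : ℝ) : EReal :=
  Filter.limsup (fun r : ℝ => ((characteristic F r / r ^ ρ : ℝ) : EReal)) Filter.atTop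

/-- The explicit constant `2^{σ+1} (n+1) + 6 · 4^σ n (n+1)² / (σ+1)`. -/
noncomputable def explicitConstant (n : ℕ) (σ : ℝ) : ℝ :=
  2 ^ (σ + 1) * (n + 1) + 6 * 4 ^ σ * (n * (n + 1) ^ 2 / (σ + 1))

end HolCurve

/-!
Let `Φ : ℂ → ℂ^(n+1)` represent the curve, and let `γ = ⟪Φ, Φ'⟫ / ‖Φ‖²` be its logarithmic gradient
(`logGrad`). Since `∂̄γ = ‖f'‖²`, Stokes' theorem identifies the integrand of the characteristic with
the mean over a circle of the radial part of `γ` (`integral_logGrad_circle_eq`,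
`integral_sphDeriv_sq_eq_radialMean`), and integration along radii gives Jensen's formula
(`integral_radialMean`). The bound `T(r, f) = O(r ^ (2σ + 2))` for arbitrary curves is immediate from
the area integral.

Suppose now that `n` linear coordinates of `Φ` have no zeros, and normalise one of them to `1`. The
others are exponentials of entire functions `h k`, and the `h k` are polynomials since `T` has finite
order (`exists_polynomial_of_order`). The core of the argument is the claim that at each point `z`
far from the origin `γ` is within a constant times `K |z| ^ σ` of one of the derivatives `h k'`. Given
this claim, continuity of `γ` on the circle `|z| = r` and the fact that `|h k' - h l'|` is almost
constant there show that `γ` is close to a single polynomial on the whole circle, up to a factor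
`2n - 1` (`exists_forall_norm_sub_le_of_circle`); by Cauchy's theorem that polynomial does not
contribute to the mean of `γ`, whence the bound for `T` (`eventually_characteristic_le_of_logGrad`).

For the claim, `γ` is close to the logarithmic derivative of every coordinate that is not small
compared with `‖Φ‖`. If one of the zero-free coordinates is such, nothing remains to be proved.
Otherwise `z` lies in the open set where the remaining coordinate `f₀` dominates. Either a disc that
contains `z` well inside touches the complement of this set at a moderate distance, or the set
contains a region slightly larger than a half-plane; in the latter case positive harmonic functions
grow sublinearly and all gradients tend to zero (`exists_touching_ball_or_sector`,
`norm_logDeriv_le_of_sector`). In the former case, for coordinate hyperplanes, `-log |f k / f₀|` is a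
positive harmonic function on the disc, vanishing at the point of contact with a slope bounded by the
Fubini–Study derivative; Hopf's lemma and the gradient estimate bound the difference of the
logarithmic derivatives of `f k` and `f₀` (`exists_logGrad_close_coordinate`).

For hyperplanes in general position the constant must not depend on the hyperplanes, while the angles
between them do. Write `Φ = f₀ e + H`, with `e` a unit vector spanning the common kernel of the forms
and `H` a combination of the exponentials, orthogonal to `e`. First the case of coordinate
hyperplanes, after a linear change of coordinates, shows that the degrees of the `h k` are at most
`σ + 1`. Therefore `H` is close to an exponential sum with frequencies `h k' (z)` on discs of radius
comparable to `|z| ^ (-σ)` (`exists_norm_expSum_sub_le`). A zero-free function that dominates an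
exponential sum on a disc, without being much larger than it everywhere inside, has a logarithmic
derivative close to one of the frequencies, with a bound independent of the coefficients
(`exists_norm_logDeriv_sub_le`). This is applied to a component of `H`, where `H` is not small, and to
`f₀` on small discs; on discs that are large compared with the constants depending on the hyperplanes,
Harnack's inequality for the single exponentials is good enough (`exists_logGrad_close_uniform`).
-/

namespace HolCurve

open Complex Metric Set Filter Topology
open scoped ComplexConjugate

/-! ### Zero-free functions on a disc: logarithms, Harnack's inequality, Hopf's lemma -/

section

/-- A zero-free holomorphic function has a holomorphic logarithm as soon as its logarithmic
derivative has a primitive. -/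
theorem exists_log_of_isExactOn {f : ℂ → ℂ} {U : Set ℂ} (hU : IsOpen U) (hc : IsPreconnected U)
    (hd : DifferentiableOn ℂ f U) (h0 : ∀ z ∈ U, f z ≠ 0)
    (hex : IsExactOn (fun z => deriv f z / f z) U) :
    ∃ g : ℂ → ℂ, (∀ z ∈ U, HasDerivAt g (deriv f z / f z) z) ∧ ∀ z ∈ U, f z = exp (g z) := by
  obtain ⟨g, hg⟩ := hex
  rcases U.eq_empty_or_nonempty with rfl | ⟨c, hcU⟩
  · exact ⟨g, by simp, by simp⟩
  have hder : ∀ z ∈ U, HasDerivAt (fun z => f z * exp (-g z)) 0 z := by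
    intro z hz
    have h1 := (hd.differentiableAt (hU.mem_nhds hz)).hasDerivAt
    have := h1.mul ((hg z hz).neg.cexp)
    refine this.congr_deriv ?_
    have := h0 z hz
    field_simp
    ring
  have hconst : ∀ z ∈ U, f z * exp (-g z) = f c * exp (-g c) := by
    intro z hz
    refine hU.is_const_of_deriv_eq_zero (𝕜 := ℂ) (f := fun z => f z * exp (-g z))
      hc ?_ ?_ hz hcU
    · exact fun w hw => (hder w hw).differentiableAt.differentiableWithinAt
    · exact fun w hw => (hder w hw).deriv
  have hk : f c * exp (-g c) ≠ 0 := mul_ne_zero (h0 c hcU) (exp_ne_zero _)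
  refine ⟨fun z => g z + log (f c * exp (-g c)), fun z hz => (hg z hz).add_const _, fun z hz => ?_⟩
  rw [exp_add, exp_log hk, ← hconst z hz, mul_comm, mul_assoc, ← exp_add]
  simp

theorem exists_log_on_ball {f : ℂ → ℂ} {c : ℂ} {R : ℝ} (hd : DifferentiableOn ℂ f (ball c R))
    (h0 : ∀ z ∈ ball c R, f z ≠ 0) :
    ∃ g : ℂ → ℂ, (∀ z ∈ ball c R, HasDerivAt g (deriv f z / f z) z) ∧
      ∀ z ∈ ball c R, f z = exp (g z) :=
  exists_log_of_isExactOn isOpen_ball (convex_ball c R).isPreconnected hd h0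
    (((hd.deriv isOpen_ball).div hd h0).isExactOn_ball)

theorem exists_entire_log {f : ℂ → ℂ} (hd : Differentiable ℂ f) (h0 : ∀ z, f z ≠ 0) :
    ∃ g : ℂ → ℂ, Differentiable ℂ g ∧ ∀ z, f z = exp (g z) := by
  have hex : IsExactOn (fun z => deriv f z / f z) univ :=
    Differentiable.isExactOn_univ ((fun z => ((hd.differentiableOn (s := univ)).deriv isOpen_univ
      |>.differentiableAt univ_mem).div (hd z) (h0 z)))
  obtain ⟨g, hg, hfg⟩ := exists_log_of_isExactOn isOpen_univ isPreconnected_univ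
    hd.differentiableOn (fun z _ => h0 z) hex
  exact ⟨g, fun z => (hg z (mem_univ z)).differentiableAt, fun z => hfg z (mem_univ z)⟩

/-- The Schwarz lemma for maps into the right half-plane, through the Cayley transform. -/
theorem norm_sub_le_of_re_pos {q : ℂ → ℂ} {c : ℂ} {R : ℝ} (hd : DifferentiableOn ℂ q (ball c R))
    (hpos : ∀ z ∈ ball c R, 0 < (q z).re) {z : ℂ} (hz : z ∈ ball c R) :
    ‖q z - q c‖ * R ≤ dist z c * ‖q z + conj (q c)‖ := by
  have hR : 0 < R := pos_of_mem_ball hz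
  have hcb : c ∈ ball c R := mem_ball_self hR
  have hne : ∀ w ∈ ball c R, q w + conj (q c) ≠ 0 := by
    intro w hw h
    have := congrArg Complex.re h
    simp at this
    linarith [hpos w hw, hpos c hcb]
  have hkey : ∀ w ∈ ball c R, ‖q w - q c‖ ≤ ‖q w + conj (q c)‖ := by
    intro w hw
    rw [← sq_le_sq₀ (norm_nonneg _) (norm_nonneg _), Complex.sq_norm, Complex.sq_norm,
      normSq_apply, normSq_apply]
    simp
    nlinarith [hpos w hw, hpos c hcb, mul_pos (hpos w hw) (hpos c hcb)]
  have hs := dist_le_div_mul_dist_of_mapsTo_ball (R₂ := 1)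
    (f := fun w => (q w - q c) / (q w + conj (q c))) ((hd.sub_const _).div (hd.add_const _) hne)
    (fun w hw => by
      simp only [mem_closedBall, sub_self, zero_div, dist_zero_right, norm_div]
      exact div_le_one_of_le₀ (hkey w hw) (norm_nonneg _)) hz
  simp only [sub_self, zero_div, dist_zero_right, norm_div] at hs
  have hpos' : 0 < ‖q z + conj (q c)‖ := norm_pos_iff.2 (hne z hz)
  rw [div_le_iff₀ hpos', div_mul_eq_mul_div, one_mul, div_mul_eq_mul_div, le_div_iff₀ hR] at hs
  exact hs

/-- Points of the right half-plane at pseudo-hyperbolic distance at most `x` have comparable real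
parts. -/
theorem re_harnack_of_norm_sub_le {a b : ℂ} {x : ℝ} (ha : 0 < a.re) (hb : 0 < b.re) (hx0 : 0 ≤ x)
    (hx1 : x < 1) (h : ‖a - b‖ ≤ x * ‖a + conj b‖) :
    a.re * (1 - x) ≤ b.re * (1 + x) ∧ b.re * (1 - x) ≤ a.re * (1 + x) := by
  have h2 : ‖a - b‖ ^ 2 ≤ x ^ 2 * ‖a + conj b‖ ^ 2 := by
    rw [← mul_pow]; exact pow_le_pow_left₀ (norm_nonneg _) h 2
  rw [Complex.sq_norm, Complex.sq_norm, normSq_apply, normSq_apply] at h2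
  simp at h2
  have h3 : (a.re - b.re) ^ 2 ≤ x ^ 2 * (a.re + b.re) ^ 2 := by
    nlinarith [mul_nonneg (sub_nonneg.2 (show x ^ 2 ≤ 1 by nlinarith)) (sq_nonneg (a.im - b.im))]
  rw [← mul_pow] at h3
  have h4 := abs_le_of_sq_le_sq h3 (by positivity)
  rw [abs_le] at h4
  constructor <;> nlinarith [h4.1, h4.2]

/-- Harnack's inequality for `-log |φ|`, where `φ` has no zeros and takes values in the
unit disc. -/
theorem neg_log_norm_harnack {φ : ℂ → ℂ} {c : ℂ} {R : ℝ} (hd : DifferentiableOn ℂ φ (ball c R))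
    (h0 : ∀ z ∈ ball c R, φ z ≠ 0) (h1 : ∀ z ∈ ball c R, ‖φ z‖ < 1) {z : ℂ}
    (hz : z ∈ ball c R) :
    -Real.log ‖φ z‖ * (R - dist z c) ≤ -Real.log ‖φ c‖ * (R + dist z c) ∧
      -Real.log ‖φ c‖ * (R - dist z c) ≤ -Real.log ‖φ z‖ * (R + dist z c) := by
  have hR : 0 < R := pos_of_mem_ball hz
  obtain ⟨g, hg, hfg⟩ := exists_log_on_ball hd h0
  have hre : ∀ w ∈ ball c R, (-g w).re = -Real.log ‖φ w‖ := by
    intro w hw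
    rw [hfg w hw, norm_exp, Real.log_exp, neg_re]
  have hpos : ∀ w ∈ ball c R, 0 < (-g w).re := by
    intro w hw
    rw [hre w hw]
    linarith [Real.log_neg (norm_pos_iff.2 (h0 w hw)) (h1 w hw)]
  have hs := norm_sub_le_of_re_pos (q := fun w => -g w)
    (fun w hw => (hg w hw).differentiableAt.neg.differentiableWithinAt) hpos hz
  have hcb : c ∈ ball c R := mem_ball_self hR
  have := re_harnack_of_norm_sub_le (x := dist z c / R) (hpos z hz) (hpos c hcb) (by positivity)
    ((div_lt_one hR).2 hz) (by rw [div_mul_eq_mul_div, le_div_iff₀ hR]; exact hs)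
  rw [hre z hz, hre c hcb] at this
  have e1 : 1 - dist z c / R = (R - dist z c) / R := by field_simp
  have e2 : 1 + dist z c / R = (R + dist z c) / R := by field_simp
  rw [e1, e2] at this
  simp only [mul_div_assoc'] at this
  exact ⟨(div_le_div_iff_of_pos_right hR).1 this.1, (div_le_div_iff_of_pos_right hR).1 this.2⟩

/-- The gradient estimate for the positive harmonic function `-log |φ|`. -/
theorem norm_logDeriv_le {φ : ℂ → ℂ} {c : ℂ} {R : ℝ} (hR : 0 < R)
    (hd : DifferentiableOn ℂ φ (ball c R))
    (h0 : ∀ z ∈ ball c R, φ z ≠ 0) (h1 : ∀ z ∈ ball c R, ‖φ z‖ < 1) :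
    ‖deriv φ c / φ c‖ ≤ 2 * -Real.log ‖φ c‖ / R := by
  obtain ⟨g, hg, hfg⟩ := exists_log_on_ball hd h0
  have hre : ∀ w ∈ ball c R, (-g w).re = -Real.log ‖φ w‖ := by
    intro w hw
    rw [hfg w hw, norm_exp, Real.log_exp, neg_re]
  have hpos : ∀ w ∈ ball c R, 0 < (-g w).re := by
    intro w hw
    rw [hre w hw]
    linarith [Real.log_neg (norm_pos_iff.2 (h0 w hw)) (h1 w hw)]
  have hcb : c ∈ ball c R := mem_ball_self hR
  have hdq : DifferentiableOn ℂ (fun w => -g w) (ball c R) :=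
    fun w hw => (hg w hw).differentiableAt.neg.differentiableWithinAt
  have hder : HasDerivAt (fun w => -g w) (-(deriv φ c / φ c)) c := (hg c hcb).neg
  rw [← norm_neg, ← hre c hcb]
  -- the difference quotients of `-g` at `c` are bounded by `‖-g w + conj (-g c)‖ / R`
  have htend : Tendsto (fun w => ‖-g w + conj (-g c)‖ / R) (𝓝[≠] c)
      (𝓝 (‖-g c + conj (-g c)‖ / R)) := by
    have : ContinuousAt (fun w => ‖-g w + conj (-g c)‖ / R) c :=
      ((hder.continuousAt.add continuousAt_const).norm).div_const R
    exact this.tendsto.mono_left nhdsWithin_le_nhds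
  have hle := le_of_tendsto_of_tendsto hder.tendsto_slope.norm htend (by
    filter_upwards [self_mem_nhdsWithin, nhdsWithin_le_nhds (ball_mem_nhds c hR)] with w hw hwb
    have hs := norm_sub_le_of_re_pos hdq hpos hwb
    rw [slope_def_field, norm_div]
    have hwc : 0 < ‖w - c‖ := norm_pos_iff.2 (sub_ne_zero.2 hw)
    rw [div_le_div_iff₀ hwc hR]
    rw [dist_eq_norm] at hs
    linarith [hs])
  refine hle.trans (le_of_eq ?_)
  congr 1
  have : -g c + conj (-g c) = ((2 * (-g c).re : ℝ) : ℂ) := by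
    rw [add_conj]
  rw [this, Complex.norm_real, Real.norm_eq_abs, abs_of_pos]
  linarith [hpos c hcb]

/-- If `|φ|` grows to `1` at a boundary point at least linearly along the radius, its derivative
there is at least the corresponding rate. -/
theorem le_norm_deriv_of_radial {φ : ℂ → ℂ} {c w : ℂ} {A : ℝ} (hd : DifferentiableAt ℂ φ w)
    (hw : ‖φ w‖ = 1)
    (h : ∃ ω : ℝ → ℝ, Tendsto ω (𝓝[<] 1) (𝓝 A) ∧
      ∀ᶠ t in 𝓝[<] (1 : ℝ), ω t * (1 - t) ≤ 1 - ‖φ (c + t * (w - c))‖) :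
    A ≤ dist w c * ‖deriv φ w‖ := by
  obtain ⟨ω, hω, hev⟩ := h
  have hder : HasDerivAt (fun t : ℝ => φ (c + t * (w - c))) ((w - c) * deriv φ w) 1 := by
    have h1 : HasDerivAt (fun t : ℝ => c + (t : ℂ) * (w - c)) (w - c) 1 := by
      simpa using ((Complex.ofRealCLM.hasDerivAt (x := (1 : ℝ))).mul_const (w - c)).const_add c
    have h2 : HasDerivAt φ (deriv φ w) (c + ((1 : ℝ) : ℂ) * (w - c)) := by
      simpa using hd.hasDerivAt
    have := h2.scomp (1 : ℝ) h1
    simpa [Function.comp_def] using this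
  have hsl := (hder.tendsto_slope.mono_left
    (nhdsWithin_mono (1 : ℝ) (show Iio (1 : ℝ) ⊆ {1}ᶜ from fun x hx => ne_of_lt hx))).norm
  have := le_of_tendsto_of_tendsto hω hsl (by
    filter_upwards [hev, self_mem_nhdsWithin] with t ht ht1
    have ht1' : 0 < 1 - t := sub_pos.2 ht1
    rw [slope_def_module, norm_smul, norm_inv, Real.norm_eq_abs, abs_of_neg (by linarith)]
    rw [show -(t - 1) = 1 - t by ring, inv_mul_eq_div, le_div_iff₀ ht1']
    refine ht.trans ?_
    have := norm_sub_norm_le (φ w) (φ (c + t * (w - c)))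
    rw [hw] at this
    refine this.trans (le_of_eq ?_)
    rw [norm_sub_rev]
    simp)
  rwa [norm_mul, ← dist_eq_norm] at this

/-- Hopf's boundary lemma for `-log |φ|`: its value at the centre is controlled by the slope of `φ`
at a single boundary point where `|φ| = 1`. -/
theorem neg_log_norm_center_le {φ : ℂ → ℂ} {c w : ℂ} {R : ℝ} (hR : 0 < R)
    (hd : DifferentiableOn ℂ φ (ball c R))
    (h0 : ∀ z ∈ ball c R, φ z ≠ 0) (h1 : ∀ z ∈ ball c R, ‖φ z‖ < 1)
    (hw : dist w c = R) (hdw : DifferentiableAt ℂ φ w) (hφw : ‖φ w‖ = 1) :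
    -Real.log ‖φ c‖ ≤ 2 * R * ‖deriv φ w‖ := by
  have hcb : c ∈ ball c R := mem_ball_self hR
  set L := -Real.log ‖φ c‖ with hL
  have hLpos : 0 < L := by
    have := Real.log_neg (norm_pos_iff.2 (h0 c hcb)) (h1 c hcb)
    linarith
  -- Harnack bounds `-log |φ|` from below on the radius; convert it to a bound for `1 - |φ|`
  have key : ∀ t : ℝ, 0 < t → t < 1 →
      (L / (1 + t + L * (1 - t))) * (1 - t) ≤ 1 - ‖φ (c + t * (w - c))‖ := by
    intro t ht0 ht1
    have hdist : dist (c + t * (w - c)) c = t * R := by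
      rw [dist_eq_norm, add_sub_cancel_left, norm_mul, ← dist_eq_norm, hw, Complex.norm_real,
        Real.norm_eq_abs, abs_of_pos ht0]
    have hzb : c + t * (w - c) ∈ ball c R := by
      rw [mem_ball, hdist]; nlinarith
    have hH := (neg_log_norm_harnack hd h0 h1 hzb).2
    rw [hdist, ← hL] at hH
    set y := ‖φ (c + t * (w - c))‖ with hy
    have hypos : 0 < y := norm_pos_iff.2 (h0 _ hzb)
    have h2 : L * (1 - t) / (1 + t) ≤ -Real.log y := by
      rw [div_le_iff₀ (by linarith)]
      have : R * (L * (1 - t)) ≤ R * (-Real.log y * (1 + t)) := by nlinarith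
      exact le_of_mul_le_mul_left this hR
    -- `y = exp (log y) ≤ 1 / (1 + u)` for `u ≤ - log y`
    have h3 : y ≤ 1 / (1 + L * (1 - t) / (1 + t)) := by
      have hu : 0 ≤ L * (1 - t) / (1 + t) := by
        have : 0 < 1 - t := by linarith
        positivity
      have h4 : 1 + L * (1 - t) / (1 + t) ≤ y⁻¹ := by
        have := Real.add_one_le_exp (-Real.log y)
        rw [Real.exp_neg, Real.exp_log hypos] at this
        linarith
      rw [one_div]
      exact (le_inv_comm₀ hypos (by linarith)).2 h4
    have hp : 0 < 1 + t + L * (1 - t) := by nlinarith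
    have h5 : 1 / (1 + L * (1 - t) / (1 + t)) = 1 - L / (1 + t + L * (1 - t)) * (1 - t) := by
      have : (1 + t) ≠ 0 := by linarith
      field_simp
      ring
    linarith
  have hA := le_norm_deriv_of_radial (c := c) (A := L / 2) hdw hφw
    ⟨fun t => L / (1 + t + L * (1 - t)), by
      have : ContinuousAt (fun t : ℝ => L / (1 + t + L * (1 - t))) 1 :=
        continuousAt_const.div (by fun_prop) (by norm_num)
      have h := this.tendsto
      norm_num at h
      exact h.mono_left nhdsWithin_le_nhds, by
      filter_upwards [self_mem_nhdsWithin, nhdsWithin_le_nhds (lt_mem_nhds (zero_lt_one))]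
        with t ht ht0
      exact key t ht0 ht⟩
  rw [hw] at hA
  linarith

end

/-! ### Three circles, exponential sums with large frequencies, coverings -/

section

variable {E : Type*} [NormedAddCommGroup E] [NormedSpace ℂ E]

/-- The three circles theorem, for a comparison with an integral power of the radius. -/
theorem norm_le_mul_pow_on_annulus {Q : ℂ → E} {c : ℂ} {r₁ r₂ B : ℝ} (j : ℕ) (h0 : 0 < r₁)
    (hd : DiffContOnCl ℂ Q (ball c r₂))
    (h1 : ∀ z, dist z c = r₁ → ‖Q z‖ ≤ B * r₁ ^ j) (h2 : ∀ z, dist z c = r₂ → ‖Q z‖ ≤ B * r₂ ^ j)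
    {z : ℂ} (hz1 : r₁ ≤ dist z c) (hz2 : dist z c ≤ r₂) : ‖Q z‖ ≤ B * dist z c ^ j := by
  rcases hz1.eq_or_lt with e | hz1
  · rw [← e]; exact h1 z e.symm
  rcases hz2.eq_or_lt with e | hz2
  · rw [e]; exact h2 z e
  have hr2 : 0 < r₂ := h0.trans (hz1.trans hz2)
  set U := ball c r₂ \ closedBall c r₁ with hU
  have hUo : IsOpen U := isOpen_ball.sdiff isClosed_closedBall
  have hzU : z ∈ U := ⟨hz2, by simpa using hz1⟩
  have hclU : closure U ⊆ closedBall c r₂ \ ball c r₁ := by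
    refine closure_minimal ?_ (isClosed_closedBall.sdiff isOpen_ball)
    exact sdiff_subset_sdiff ball_subset_closedBall ball_subset_closedBall
  have hne : ∀ w ∈ closure U, (w - c) ^ j ≠ 0 := by
    intro w hw
    have := (hclU hw).2
    refine pow_ne_zero _ (sub_ne_zero.2 ?_)
    rintro rfl
    exact this (mem_ball_self h0)
  have hdU : DiffContOnCl ℂ (fun w => ((w - c) ^ j)⁻¹ • Q w) U := by
    refine ⟨fun w hw => ?_, fun w hw => ?_⟩
    · have hQ := (hd.1.differentiableAt (isOpen_ball.mem_nhds hw.1))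
      have : DifferentiableAt ℂ (fun w : ℂ => ((w - c) ^ j)⁻¹) w :=
        (by fun_prop : DifferentiableAt ℂ (fun w : ℂ => (w - c) ^ j) w).inv
          (hne w (subset_closure hw))
      exact (this.smul hQ).differentiableWithinAt
    · have hQ : ContinuousWithinAt Q (closure U) w := by
        refine (hd.2 w ?_).mono ?_
        · rw [closure_ball c hr2.ne']; exact (hclU hw).1
        · rw [closure_ball c hr2.ne']; exact fun x hx => (hclU hx).1
      have : ContinuousAt (fun w : ℂ => ((w - c) ^ j)⁻¹) w :=
        (by fun_prop : ContinuousAt (fun w : ℂ => (w - c) ^ j) w).inv₀ (hne w hw)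
      exact this.continuousWithinAt.smul hQ
  have hmax := Complex.norm_le_of_forall_mem_frontier_norm_le
    ((isBounded_ball (x := c) (r := r₂)).subset sdiff_subset) hdU (C := B) (fun w hw => by
      have hwcl := hclU (frontier_subset_closure hw)
      have hwU : w ∉ U := by
        rw [hUo.frontier_eq] at hw; exact hw.2
      have hw1 : r₁ ≤ dist w c := by simpa using hwcl.2
      have hw2 : dist w c ≤ r₂ := hwcl.1
      have hpos : 0 < dist w c := h0.trans_le hw1
      have hcase : dist w c = r₁ ∨ dist w c = r₂ := by
        by_contra hcon
        push Not at hcon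
        exact hwU ⟨lt_of_le_of_ne hw2 hcon.2, by simpa using lt_of_le_of_ne hw1 hcon.1.symm⟩
      have hb : ‖Q w‖ ≤ B * dist w c ^ j := by
        rcases hcase with h | h
        · rw [h]; exact h1 w h
        · rw [h]; exact h2 w h
      rw [norm_smul, norm_inv, norm_pow, ← dist_eq_norm, inv_mul_le_iff₀ (pow_pos hpos j)]
      linarith) (subset_closure hzU)
  have hpos : 0 < dist z c := h0.trans hz1
  rw [norm_smul, norm_inv, norm_pow, ← dist_eq_norm, inv_mul_le_iff₀ (pow_pos hpos j)] at hmax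
  linarith

/-- Hopf's boundary lemma for functions that may have zeros: if the derivative at a boundary point
where `|φ| = 1` is small, then `|φ|` cannot be very small on the whole inner disc. -/
theorem exists_lt_norm_of_boundary_deriv_lt {φ : ℂ → ℂ} {c w : ℂ} {R : ℝ} (hR : 0 < R)
    (hd : DiffContOnCl ℂ φ (ball c R)) (h1 : ∀ z, dist z c = R → ‖φ z‖ ≤ 1)
    (hw : dist w c = R) (hdw : DifferentiableAt ℂ φ w) (hφw : ‖φ w‖ = 1) {N : ℕ}
    (hN : R * ‖deriv φ w‖ < N) : ∃ ζ, dist ζ c ≤ R / 4 ∧ (1 / 4 : ℝ) ^ N < ‖φ ζ‖ := by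
  by_contra! hcon
  have hann : ∀ z, R / 4 ≤ dist z c → dist z c ≤ R → ‖φ z‖ ≤ (R ^ N)⁻¹ * dist z c ^ N := by
    intro z hz1 hz2
    refine norm_le_mul_pow_on_annulus N (by positivity) hd (fun y hy => ?_) (fun y hy => ?_) hz1 hz2
    · refine (hcon y hy.le).trans (le_of_eq ?_)
      rw [div_pow, div_pow, one_pow]
      field_simp
    · refine (h1 y hy).trans (le_of_eq ?_)
      rw [inv_mul_cancel₀ (by positivity)]
  have hA := le_norm_deriv_of_radial (c := c) (A := N) hdw hφw
    ⟨fun t => N * t ^ N, by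
      have : ContinuousAt (fun t : ℝ => (N : ℝ) * t ^ N) 1 := by fun_prop
      have h := this.tendsto
      norm_num at h
      exact h.mono_left nhdsWithin_le_nhds, by
      filter_upwards [self_mem_nhdsWithin,
        nhdsWithin_le_nhds (lt_mem_nhds (show (1 / 4 : ℝ) < 1 by norm_num))] with t ht ht0
      have ht1 : t < 1 := ht
      have htpos : 0 < t := by linarith
      have hdist : dist (c + t * (w - c)) c = t * R := by
        rw [dist_eq_norm, add_sub_cancel_left, norm_mul, ← dist_eq_norm, hw, Complex.norm_real,
          Real.norm_eq_abs, abs_of_pos htpos]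
      have hb := hann (c + t * (w - c)) (by rw [hdist]; nlinarith) (by rw [hdist]; nlinarith)
      rw [hdist, mul_pow, mul_comm (t ^ N), ← mul_assoc, inv_mul_cancel₀ (by positivity),
        one_mul] at hb
      -- Bernoulli's inequality for `t⁻¹`
      have hB := one_add_mul_le_pow (a := t⁻¹ - 1) (by
        have := one_lt_inv_iff₀.2 ⟨htpos, ht1⟩; linarith) N
      have h3 : (1 + (N : ℝ) * (t⁻¹ - 1)) * t ^ N ≤ 1 := by
        calc _ ≤ (1 + (t⁻¹ - 1)) ^ N * t ^ N := by gcongr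
          _ = 1 := by rw [← mul_pow]; simp [htpos.ne']
      have h4 : 1 - t ≤ t⁻¹ - 1 := by
        have : t⁻¹ - 1 - (1 - t) = (1 - t) ^ 2 * t⁻¹ := by field_simp
        have : 0 ≤ (1 - t) ^ 2 * t⁻¹ := by positivity
        linarith
      have h5 : (N : ℝ) * t ^ N * (1 - t) ≤ N * t ^ N * (t⁻¹ - 1) := by gcongr
      nlinarith⟩
  rw [hw] at hA
  linarith

/-- An exponential sum whose frequencies are all large is much smaller at the centre of a disc
than its supremum over the disc. By induction on the number of terms: the operator `1 - μ⁻¹ d/dζ`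
removes the term of frequency `μ`, and by Cauchy's estimate it changes the sum by a factor of at most
`1 + 1 / x`, at the cost of a layer of width `t`. -/
theorem norm_expSum_center_le {δ t x : ℝ} (ht : 0 < t) (hx : 0 < x) (hxt : x ≤ δ * t) :
    ∀ (n : ℕ) (μ : Fin n → ℂ) (v : Fin n → E) (M : ℝ), (∀ k, δ ≤ ‖μ k‖) →
      (∀ ζ : ℂ, ‖ζ‖ ≤ n * t → ‖∑ k, exp (μ k * ζ) • v k‖ ≤ M) →
      ‖∑ k, v k‖ ≤ M * ((1 + 1 / x) ^ n - 1) := by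
  have hδ : 0 < δ := by
    by_contra h
    push Not at h
    nlinarith
  intro n
  induction n with
  | zero => intro μ v M _ _; simp
  | succ n ih =>
    intro μ v M hμ hM
    set H : ℂ → E := fun ζ => ∑ k, exp (μ k * ζ) • v k with hHdef
    have hder : ∀ ζ, HasDerivAt H (∑ k, (exp (μ k * ζ) * μ k) • v k) ζ := by
      intro ζ
      refine HasDerivAt.fun_sum fun k _ => HasDerivAt.smul_const ?_ _
      simpa using (((hasDerivAt_id ζ).const_mul (μ k)).cexp)
    have hM0 : 0 ≤ M := (norm_nonneg _).trans (hM 0 (by simp; positivity))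
    have hlast : μ (Fin.last n) ≠ 0 := norm_pos_iff.1 (hδ.trans_le (hμ _))
    have hcauchy : ∀ ζ : ℂ, ‖ζ‖ ≤ n * t → ‖(μ (Fin.last n))⁻¹ • deriv H ζ‖ ≤ M / x := by
      intro ζ hζ
      have := Complex.norm_deriv_le_of_forall_mem_sphere_norm_le (c := ζ) (f := H) (C := M) ht
        (Differentiable.diffContOnCl fun w => (hder w).differentiableAt) (fun w hw => hM w (by
          have h1 : ‖w‖ ≤ ‖w - ζ‖ + ‖ζ‖ := by simpa using norm_add_le (w - ζ) ζ
          rw [mem_sphere, dist_eq_norm] at hw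
          push_cast
          linarith))
      rw [norm_smul, norm_inv]
      calc ‖μ (Fin.last n)‖⁻¹ * ‖deriv H ζ‖ ≤ δ⁻¹ * (M / t) := by
            gcongr
            exact hμ _
        _ = M / (δ * t) := by field_simp
        _ ≤ M / x := by gcongr
    have hA : ∀ ζ, H ζ - (μ (Fin.last n))⁻¹ • deriv H ζ =
        ∑ k : Fin n, exp (μ k.castSucc * ζ) •
          ((1 - (μ (Fin.last n))⁻¹ * μ k.castSucc) • v k.castSucc) := by
      intro ζ
      rw [(hder ζ).deriv, hHdef]
      simp only
      rw [Finset.smul_sum, ← Finset.sum_sub_distrib, Fin.sum_univ_castSucc]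
      have : exp (μ (Fin.last n) * ζ) • v (Fin.last n) - (μ (Fin.last n))⁻¹ •
          (exp (μ (Fin.last n) * ζ) * μ (Fin.last n)) • v (Fin.last n) = 0 := by
        rw [smul_smul, ← sub_smul, mul_comm (exp _), inv_mul_cancel_left₀ hlast, sub_self,
          zero_smul]
      rw [this, add_zero]
      refine Finset.sum_congr rfl fun k _ => ?_
      rw [smul_smul, smul_smul, ← sub_smul]
      congr 1
      ring
    have hih := ih (fun k => μ k.castSucc)
      (fun k => (1 - (μ (Fin.last n))⁻¹ * μ k.castSucc) • v k.castSucc) (M * (1 + 1 / x))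
      (fun k => hμ _) (fun ζ hζ => by
        rw [← hA ζ]
        refine (norm_sub_le _ _).trans ?_
        have h1 := hM ζ (hζ.trans (by push_cast; nlinarith))
        have h2 := hcauchy ζ hζ
        have : M * (1 + 1 / x) = M + M / x := by ring
        rw [this]
        exact add_le_add h1 h2)
    have h0 : ∑ k, v k = H 0 := by simp [hHdef]
    have hA0 := hA 0
    simp only [mul_zero, exp_zero, one_smul] at hA0
    rw [← hA0] at hih
    have h2 := hcauchy 0 (by simp; positivity)
    have h3 : ‖H 0‖ ≤ ‖H 0 - (μ (Fin.last n))⁻¹ • deriv H 0‖ +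
        ‖(μ (Fin.last n))⁻¹ • deriv H 0‖ := by
      simpa using norm_add_le (H 0 - (μ (Fin.last n))⁻¹ • deriv H 0)
        ((μ (Fin.last n))⁻¹ • deriv H 0)
    rw [h0]
    refine h3.trans ((add_le_add hih h2).trans (le_of_eq ?_))
    ring

/-- An interval covered by finitely many intervals is no longer than their total length. -/
theorem sub_le_sum_of_Icc_subset {ι : Type*} (s : Finset ι) {u v : ℝ} (a b : ι → ℝ)
    (hab : ∀ k ∈ s, a k ≤ b k) (h : Icc u v ⊆ ⋃ k ∈ s, Icc (a k) (b k)) :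
    v - u ≤ ∑ k ∈ s, (b k - a k) := by
  have h1 := (MeasureTheory.measure_mono h).trans
    (MeasureTheory.measure_biUnion_finset_le (μ := MeasureTheory.volume) s
      (fun k => Icc (a k) (b k)))
  simp only [Real.volume_Icc] at h1
  rw [← ENNReal.ofReal_sum_of_nonneg (fun k hk => sub_nonneg.2 (hab k hk))] at h1
  exact (ENNReal.ofReal_le_ofReal_iff
    (Finset.sum_nonneg fun k hk => sub_nonneg.2 (hab k hk))).1 h1

/-- A connected plane set covered by `n` discs of radius `a` has diameter at most `2 n a`. -/
theorem dist_le_of_isPreconnected_of_cover {n : ℕ} {S : Set ℂ} (hS : IsPreconnected S)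
    (s : Fin n → ℂ) {a : ℝ} (ha : 0 ≤ a) (hcov : ∀ z ∈ S, ∃ k, ‖z - s k‖ ≤ a) {x y : ℂ}
    (hx : x ∈ S) (hy : y ∈ S) : dist x y ≤ n * (2 * a) := by
  rcases eq_or_ne x y with rfl | hne
  · simp; positivity
  -- project onto the line through `x` and `y`
  set u : ℂ := (y - x) / ‖y - x‖ with hu
  have hyx : (‖y - x‖ : ℂ) ≠ 0 := by
    simpa [sub_eq_zero] using hne.symm
  have hunorm : ‖u‖ = 1 := by
    rw [hu, norm_div, Complex.norm_real, norm_norm, div_self]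
    exact_mod_cast hyx
  set l : ℂ → ℝ := fun z => (conj u * z).re with hl
  have hlc : Continuous l := by fun_prop
  have hlip : ∀ z w, |l z - l w| ≤ ‖z - w‖ := by
    intro z w
    have : l z - l w = (conj u * (z - w)).re := by simp only [hl, mul_sub, sub_re]
    rw [this]
    refine (abs_re_le_norm _).trans ?_
    rw [norm_mul, RCLike.norm_conj, hunorm, one_mul]
  have hlyx : l y - l x = dist x y := by
    have : l y - l x = (conj u * (y - x)).re := by simp only [hl, mul_sub, sub_re]
    rw [this, hu, map_div₀, conj_ofReal, div_mul_eq_mul_div, mul_comm, mul_conj,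
      normSq_eq_norm_sq, dist_comm, dist_eq_norm]
    rw [← ofReal_div, ofReal_re]
    have h : ‖y - x‖ ≠ 0 := by exact_mod_cast hyx
    field_simp
  have himg : IsPreconnected (l '' S) := hS.image _ hlc.continuousOn
  have hsub : Icc (l x) (l y) ⊆ l '' S :=
    himg.ordConnected.out (mem_image_of_mem _ hx) (mem_image_of_mem _ hy)
  have := sub_le_sum_of_Icc_subset (u := l x) (v := l y) Finset.univ (fun k => l (s k) - a)
    (fun k => l (s k) + a) (fun k _ => by linarith) (fun r hr => by
      obtain ⟨z, hz, rfl⟩ := hsub hr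
      obtain ⟨k, hk⟩ := hcov z hz
      have := abs_le.1 ((hlip z (s k)).trans hk)
      simp only [mem_iUnion]
      exact ⟨k, Finset.mem_univ k, by constructor <;> linarith [this.1, this.2]⟩)
  rw [hlyx] at this
  refine this.trans (le_of_eq ?_)
  simp
  ring

end

/-! ### Zero-free functions compared with exponential sums -/

section

variable {E : Type*} [NormedAddCommGroup E] [NormedSpace ℂ E]

theorem exp_one_mul_pow_sub_one_le (n : ℕ) :
    Real.exp 1 * ((1 + 1 / (8 * n : ℝ)) ^ n - 1) ≤ 1 / 2 := by
  rcases Nat.eq_zero_or_pos n with rfl | hn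
  · norm_num
  have hn' : (0 : ℝ) < n := by exact_mod_cast hn
  have h1 : (1 + 1 / (8 * n : ℝ)) ^ n ≤ Real.exp (1 / 8) := by
    calc (1 + 1 / (8 * n : ℝ)) ^ n ≤ Real.exp (1 / (8 * n)) ^ n := by
          gcongr
          linarith [Real.add_one_le_exp (1 / (8 * n : ℝ))]
      _ = Real.exp (1 / 8) := by
          rw [← Real.exp_nat_mul]
          congr 1
          field_simp
  have h2 : Real.exp (1 / 8) ≤ 8 / 7 := by
    have := Real.add_one_le_exp (-(1 / 8) : ℝ)
    rw [Real.exp_neg] at this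
    have hp := Real.exp_pos (1 / 8)
    have h3 := inv_anti₀ (by norm_num) this
    rw [inv_inv] at h3
    linarith [h3, show ((-(1 / 8) + 1 : ℝ))⁻¹ = 8 / 7 by norm_num]
  have h3 := Real.exp_one_lt_d9
  have h4 : (1 + 1 / (8 * n : ℝ)) ^ n - 1 ≤ 1 / 7 := by linarith
  have h5 : 0 ≤ (1 + 1 / (8 * n : ℝ)) ^ n - 1 := by
    have : (1 : ℝ) ≤ (1 + 1 / (8 * n : ℝ)) ^ n := one_le_pow₀ (by
      have : 0 < 1 / (8 * n : ℝ) := by positivity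
      linarith)
    linarith
  nlinarith [Real.exp_pos 1]

/-- If on a disc the logarithmic derivative of `b` is almost constant and far from all the
frequencies of an exponential sum, then the ratio of the exponential sum to `b` at the centre is at
most half of its supremum over the disc. -/
theorem norm_expSum_le_half {n : ℕ} (hn : 0 < n) {s : Fin n → ℂ} {v : Fin n → E} {b : ℂ → ℂ}
    {z : ℂ} {τ δ M : ℝ} (hτ : 0 < τ) (hd : DifferentiableOn ℂ b (ball z τ))
    (h0 : ∀ w ∈ ball z τ, b w ≠ 0)
    (hβ : ∀ w ∈ ball z τ, ‖deriv b w / b w - deriv b z / b z‖ ≤ 1 / τ)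
    (hs : ∀ k, δ ≤ ‖s k - deriv b z / b z‖) (hδ : 16 * n ^ 2 ≤ δ * τ)
    (hM : ∀ w ∈ ball z τ, ‖∑ k, exp (s k * w) • v k‖ ≤ M * ‖b w‖) :
    ‖∑ k, exp (s k * z) • v k‖ ≤ M / 2 * ‖b z‖ := by
  obtain ⟨B, hB, hbB⟩ := exists_log_on_ball hd h0
  set β := deriv b z / b z with hβdef
  have hn' : (0 : ℝ) < n := by exact_mod_cast hn
  have hzb : z ∈ ball z τ := mem_ball_self hτ
  have hbz : 0 < ‖b z‖ := norm_pos_iff.2 (h0 z hzb)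
  have hM0 : 0 ≤ M := by
    have := (norm_nonneg _).trans (hM z hzb)
    exact nonneg_of_mul_nonneg_left this hbz
  have hlin : ∀ w ∈ ball z τ, ‖B w - B z - β * (w - z)‖ ≤ 1 := by
    intro w hw
    have h := (convex_ball z τ).norm_image_sub_le_of_norm_hasDerivWithin_le
      (f := fun w => B w - β * w) (f' := fun w => deriv b w / b w - β) (C := 1 / τ)
      (fun y hy => (by simpa using (hB y hy).fun_sub ((hasDerivAt_id y).const_mul β) :
        HasDerivAt (fun w => B w - β * w) (deriv b y / b y - β) y).hasDerivWithinAt)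
      hβ hzb hw
    have e : B w - B z - β * (w - z) = B w - β * w - (B z - β * z) := by ring
    rw [e]
    refine h.trans ?_
    rw [one_div, inv_mul_le_iff₀ hτ, mul_one, ← dist_eq_norm]
    exact (mem_ball.1 hw).le
  have hcoef : ∀ (ζ : ℂ) (k : Fin n), exp ((s k - β) * ζ) • (exp (s k * z) • v k) =
      exp (-(β * ζ)) • (exp (s k * (z + ζ)) • v k) := by
    intro ζ k
    rw [smul_smul, smul_smul, ← exp_add, ← exp_add]
    congr 2
    ring
  have hT := norm_expSum_center_le (t := τ / (2 * n)) (δ := δ) (x := 8 * n) (by positivity)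
    (by positivity) (by
      rw [mul_div_assoc', le_div_iff₀ (by positivity)]
      linarith) n (fun k => s k - β) (fun k => exp (s k * z) • v k) (Real.exp 1 * M * ‖b z‖) hs
    (fun ζ hζ => by
      have hmem : z + ζ ∈ ball z τ := by
        rw [mem_ball, dist_eq_norm, add_sub_cancel_left]
        have : (n : ℝ) * (τ / (2 * n)) = τ / 2 := by field_simp
        rw [this] at hζ
        linarith
      simp_rw [hcoef ζ]
      rw [← Finset.smul_sum, norm_smul, norm_exp]
      have h1 := hM _ hmem
      have h2 := hlin _ hmem
      rw [add_sub_cancel_left] at h2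
      have h3 : ‖b (z + ζ)‖ ≤ Real.exp (1 + (β * ζ).re) * ‖b z‖ := by
        rw [hbB _ hmem, hbB _ hzb, norm_exp, norm_exp, ← Real.exp_add, Real.exp_le_exp]
        have h4 := (abs_le.1 ((abs_re_le_norm _).trans h2)).2
        simp only [sub_re] at h4
        linarith
      calc Real.exp (-(β * ζ)).re * ‖∑ k, exp (s k * (z + ζ)) • v k‖
          ≤ Real.exp (-(β * ζ)).re * (M * (Real.exp (1 + (β * ζ).re) * ‖b z‖)) := by gcongr; exact h1.trans (by gcongr)
        _ = (Real.exp (-(β * ζ)).re * Real.exp (1 + (β * ζ).re)) * M * ‖b z‖ := by ring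
        _ = Real.exp 1 * M * ‖b z‖ := by
            rw [← Real.exp_add]
            congr 3
            simp
            ring)
  refine hT.trans ?_
  have := exp_one_mul_pow_sub_one_le n
  calc Real.exp 1 * M * ‖b z‖ * ((1 + 1 / (8 * n : ℝ)) ^ n - 1)
      = M * ‖b z‖ * (Real.exp 1 * ((1 + 1 / (8 * n : ℝ)) ^ n - 1)) := by ring
    _ ≤ M * ‖b z‖ * (1 / 2) := by gcongr
    _ = M / 2 * ‖b z‖ := by ring

/-- Repeated halving: a ratio which at every point is at most half of its supremum over the disc of
radius `τ` decays geometrically away from the boundary. -/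
theorem le_pow_of_forall_half {q : ℂ → ℝ} {z : ℂ} {ρ τ M : ℝ}
    (hτ : 0 < τ) (hhalf : ∀ w, ∀ M, ball w τ ⊆ ball z ρ → (∀ y ∈ ball w τ, q y ≤ M) → q w ≤ M / 2)
    (hM : ∀ w ∈ ball z ρ, q w ≤ M) (j : ℕ) :
    ∀ w ∈ ball z (ρ - j * τ), q w ≤ M / 2 ^ j := by
  induction j with
  | zero => simpa using hM
  | succ j ih =>
    intro w hw
    rw [mem_ball] at hw
    push_cast at hw
    have hsub : ball w τ ⊆ ball z (ρ - j * τ) := ball_subset_ball' (by linarith)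
    have := hhalf w (M / 2 ^ j) (hsub.trans (ball_subset_ball (by
      have : 0 ≤ (j : ℝ) * τ := by positivity
      linarith))) (fun y hy => ih y (hsub hy))
    rw [pow_succ, ← div_div]
    exact this

/-- Three circles: smallness on a tiny disc relative to a slightly larger disc forces smallness on
all of a large disc. -/
theorem norm_le_of_small_on_inner {Q : ℂ → E} {c : ℂ} {r R A M : ℝ} (i : ℕ) (hr : 0 < r)
    (hrR : 2 * r ≤ R) (hA : 0 < A) (hd : DiffContOnCl ℂ Q (ball c R))
    (hR : ∀ z ∈ closedBall c R, ‖Q z‖ ≤ A) (hM : ∀ z, dist z c = 2 * r → ‖Q z‖ ≤ M)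
    (hattain : ∃ z, dist z c = 2 * r ∧ ‖Q z‖ = M)
    (hin : ∀ z ∈ closedBall c r, ‖Q z‖ ≤ M / 2 ^ (i + 1)) {z : ℂ} (hz : dist z c ≤ R / 2) :
    ‖Q z‖ ≤ A / 2 ^ i := by
  have hRpos : 0 < R := by linarith
  have hMA : M ≤ A := by
    obtain ⟨w, hw, rfl⟩ := hattain
    exact hR w (by rw [mem_closedBall, hw]; exact hrR)
  have hM0 : 0 ≤ M := by
    obtain ⟨w, hw, rfl⟩ := hattain
    exact norm_nonneg _
  rcases le_or_gt (dist z c) r with hzr | hzr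
  · refine (hin z hzr).trans ?_
    have : (2 : ℝ) ^ i ≤ 2 ^ (i + 1) := pow_le_pow_right₀ (by norm_num) (Nat.le_succ i)
    gcongr
  have key : M / 2 ^ (i + 1) / r ^ i ≤ A / R ^ i := by
    by_contra! hlt
    have hMpos : 0 < M := by
      by_contra hM'
      have : M = 0 := le_antisymm (not_lt.1 hM') hM0
      rw [this] at hlt
      simp only [zero_div] at hlt
      exact absurd hlt (not_lt.2 (by positivity))
    obtain ⟨w, hw, hwM⟩ := hattain
    have := norm_le_mul_pow_on_annulus (B := M / 2 ^ (i + 1) / r ^ i) i hr hd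
      (fun y hy => by
        rw [div_mul_cancel₀ _ (by positivity)]
        exact hin y hy.le)
      (fun y hy => (hR y hy.le).trans (by
        rw [div_lt_iff₀ (by positivity)] at hlt
        exact hlt.le)) (z := w) (by linarith) (by linarith)
    rw [hw, hwM] at this
    have e : M / 2 ^ (i + 1) / r ^ i * (2 * r) ^ i = M / 2 := by
      rw [mul_pow, pow_succ]; field_simp
    rw [e] at this
    linarith
  have := norm_le_mul_pow_on_annulus (B := A / R ^ i) i hr hd
      (fun y hy => (hin y hy.le).trans (by
        rwa [div_le_iff₀ (by positivity)] at key))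
      (fun y hy => (hR y hy.le).trans (by
        rw [div_mul_cancel₀ _ (by positivity)])) (z := z) hzr.le (by linarith)
  refine this.trans ?_
  calc A / R ^ i * dist z c ^ i ≤ A / R ^ i * (R / 2) ^ i := by gcongr
    _ = A / 2 ^ i := by rw [div_pow]; field_simp

/-- Point picking: a continuous function on a disc has, at suitable scale `ρ` around some point
`w`, its values nearly maximal at `w`, with no loss in scale-invariant size. -/
theorem exists_point_picking {ψ : ℂ → ℝ} {c : ℂ} {R : ℝ} (hR : 0 < R)
    (hψ : ContinuousOn ψ (closedBall c R)) (hc : 0 < ψ c) :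
    ∃ w ρ, 0 < ρ ∧ dist w c + 2 * ρ = R ∧ 0 < ψ w ∧ ψ c * R ≤ 2 * (ψ w * ρ) ∧
      ∀ z ∈ ball w ρ, ψ z ≤ 2 * ψ w := by
  obtain ⟨w, hw, hmax⟩ := (isCompact_closedBall c R).exists_isMaxOn
    ⟨c, mem_closedBall_self hR.le⟩ (f := fun z => ψ z * (R - dist z c))
    (hψ.mul (by fun_prop))
  have hwR : dist w c ≤ R := hw
  have h1 := hmax (mem_closedBall_self hR.le)
  simp only [mem_ofPred_eq, dist_self, sub_zero] at h1
  have hpos : 0 < ψ w * (R - dist w c) := lt_of_lt_of_le (by positivity) h1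
  have hρ : 0 < R - dist w c := by
    rcases hwR.eq_or_lt with e | h
    · rw [e] at hpos; simp at hpos
    · linarith
  have hψw : 0 < ψ w := pos_of_mul_pos_left hpos hρ.le
  refine ⟨w, (R - dist w c) / 2, by positivity, by ring, hψw, by linarith, fun z hz => ?_⟩
  rw [mem_ball] at hz
  have hzc := dist_triangle z w c
  have h2 := hmax (show z ∈ closedBall c R by rw [mem_closedBall]; linarith)
  simp only [mem_ofPred_eq] at h2
  by_contra! hlt
  have : 2 * ψ w * ((R - dist w c) / 2) < ψ z * (R - dist z c) :=
    mul_lt_mul'' hlt (by linarith) (by positivity) (by positivity)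
  linarith

/-- If a zero-free function `b` dominates an exponential sum on a disc, and is not much larger than
it at some point, then its logarithmic derivative at the centre is close to one of the
frequencies. The bound does not depend on the coefficients of the exponential sum.

Suppose that the logarithmic derivative `β` of `b` is far from all frequencies at the centre. Near a
suitable point it is then almost constant at the scale given by its distance to the frequencies, so
that the ratio of the exponential sum to `b` is halved each time one moves away from the boundary by
a distance `τ`. The three circles theorem spreads the smallness obtained in this way over the whole
disc, and contradicts the lower bound. -/
theorem exists_norm_logDeriv_sub_le {n : ℕ} (hn : 0 < n) {s : Fin n → ℂ} {v : Fin n → E}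
    {b : ℂ → ℂ} {c : ℂ} {R : ℝ} (hR : 0 < R) (hd : DifferentiableOn ℂ b (ball c R))
    (h0 : ∀ w ∈ ball c R, b w ≠ 0) {p N : ℕ}
    (hub : ∀ w ∈ ball c R, ‖∑ k, exp (s k * w) • v k‖ ≤ 2 ^ p * ‖b w‖)
    (hlb : ∃ w, dist w c ≤ R / 4 ∧ ‖b w‖ ≤ 2 ^ N * ‖∑ k, exp (s k * w) • v k‖) :
    ∃ k, ‖deriv b c / b c - s k‖ ≤ 131072 * n ^ 5 * (N + p + 2) / R := by
  have hn' : (1 : ℝ) ≤ n := by exact_mod_cast hn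
  have : Nonempty (Fin n) := ⟨⟨0, hn⟩⟩
  by_contra! hcon
  set H : ℂ → E := fun w => ∑ k, exp (s k * w) • v k with hH
  set β : ℂ → ℂ := fun w => deriv b w / b w with hβ
  have hβd : DifferentiableOn ℂ β (ball c R) := (hd.deriv isOpen_ball).div hd h0
  set ψ : ℂ → ℝ := fun w => Finset.univ.inf' Finset.univ_nonempty fun k => ‖β w - s k‖ with hψdef
  have hψ : ContinuousOn ψ (closedBall c (R / 8)) := by
    refine ContinuousOn.finset_inf'_apply _ fun k _ => ?_
    exact ((hβd.continuousOn.mono (closedBall_subset_ball (by linarith))).sub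
      continuousOn_const).norm
  have hψle : ∀ w k, ψ w ≤ ‖β w - s k‖ := fun w k => Finset.inf'_le _ (Finset.mem_univ k)
  have hψex : ∀ w, ∃ k, ‖β w - s k‖ = ψ w := fun w => by
    obtain ⟨k, -, hk⟩ := Finset.exists_mem_eq_inf' Finset.univ_nonempty fun k => ‖β w - s k‖
    exact ⟨k, hk.symm⟩
  obtain ⟨k₀, hk₀⟩ := hψex c
  have hψc : 131072 * n ^ 5 * (N + p + 2) / R < ψ c := hk₀ ▸ hcon k₀
  have hψc0 : 0 < ψ c := lt_trans (by positivity) hψc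
  rw [div_lt_iff₀ hR] at hψc
  obtain ⟨w, ρ, hρ, hwρ, hψw, hsc, hnear⟩ := exists_point_picking (by positivity) hψ hψc0
  set δ := ψ w with hδ
  have hδρ : 8192 * n ^ 5 * (N + p + 2) < δ * ρ := by nlinarith
  have hwR : dist w c < R / 8 := by linarith
  have hρR : ρ ≤ R / 16 := by linarith [dist_nonneg (x := w) (y := c)]
  have hsubρ : ball w ρ ⊆ ball c R := ball_subset_ball' (by linarith)
  -- the frequencies are at distance at least `δ` from `β w`, and by definition of `ψ` the values of
  -- `β` near `w` lie in `n` discs of radius `2 * δ` centred at the frequencies;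
  -- by connectedness `β` is confined to a disc of radius comparable to `δ`
  have hconf : ∀ x ∈ ball w ρ, ∀ y ∈ ball w ρ, dist (β x) (β y) ≤ n * (2 * (2 * δ)) := by
    intro x hx y hy
    refine dist_le_of_isPreconnected_of_cover (S := β '' ball w ρ)
      ((convex_ball w ρ).isPreconnected.image _ (hβd.continuousOn.mono hsubρ)) s
      (by positivity) ?_ (mem_image_of_mem _ hx) (mem_image_of_mem _ hy)
    rintro _ ⟨z, hz, rfl⟩
    obtain ⟨k, hk⟩ := hψex z
    exact ⟨k, hk ▸ hnear z hz⟩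
  have hlip : ∀ x, dist x w ≤ ρ / 2 → ∀ y ∈ ball x (ρ / 2),
      ‖β y - β x‖ ≤ 8 * n * δ / ρ * dist y x := by
    intro x hx y hy
    have hsub : ball x (ρ / 2) ⊆ ball w ρ := ball_subset_ball' (by linarith)
    have := dist_le_div_mul_dist_of_mapsTo_ball (R₂ := n * (2 * (2 * δ)))
      (hβd.mono (hsub.trans hsubρ)) (fun z hz => hconf z (hsub hz) x (hsub (mem_ball_self (by
        positivity)))) hy
    rw [dist_eq_norm] at this
    refine this.trans (le_of_eq ?_)
    field_simp
    ring
  have hNp : (1 : ℝ) ≤ N + p + 2 := by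
    have : (0 : ℝ) ≤ N + p := by positivity
    linarith
  have hn5 : (1 : ℝ) ≤ (n : ℝ) ^ 5 := one_le_pow₀ hn'
  -- within `2 * r` of `w` the values of `β` stay at distance `δ / 2` from the frequencies; `β` is
  -- constant up to `1 / τ` on discs of radius `τ`; and there is room for `N + p + 2` layers of width
  -- `τ` between the circles of radius `r` and `2 * r`
  set r := ρ / (32 * n) with hr
  have hrpos : 0 < r := by positivity
  have h2r : 2 * r ≤ ρ / 2 := by
    have : 2 * r = ρ / (16 * n) := by rw [hr]; field_simp; ring
    rw [this]
    gcongr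
    linarith
  set τ := 32 * n ^ 2 / δ with hτ
  have hτpos : 0 < τ := by positivity
  have hτδ : τ * δ = 32 * n ^ 2 := by rw [hτ]; field_simp
  have hτ2 : 8 * n * δ / ρ * τ ≤ 1 / τ := by
    rw [hτ]
    have h5 : 8192 * (n : ℝ) ^ 5 ≤ δ * ρ := by nlinarith
    rw [one_div_div, div_mul_div_comm, div_le_div_iff₀ (by positivity) (by positivity)]
    nlinarith
  have hτr : (N + p + 2 : ℕ) * τ < r := by
    have h35 : (n : ℝ) ^ 3 ≤ n ^ 5 := pow_le_pow_right₀ hn' (by norm_num)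
    rw [hτ, hr, mul_div_assoc', div_lt_div_iff₀ hψw (by positivity)]
    push_cast
    have : 1024 * (n : ℝ) ^ 3 * (N + p + 2) ≤ 8192 * n ^ 5 * (N + p + 2) := by
      gcongr
      norm_num
    nlinarith
  have hτle : τ ≤ r := by
    have : (1 : ℝ) * τ ≤ (N + p + 2 : ℕ) * τ := by
      gcongr
      push_cast
      exact hNp
    linarith
  set Q : ℂ → E := fun z => (b z)⁻¹ • H z with hQ
  have hQn : ∀ z, ‖Q z‖ = ‖b z‖⁻¹ * ‖H z‖ := fun z => by rw [hQ]; simp only [norm_smul, norm_inv]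
  have hQle : ∀ z ∈ ball c R, ∀ M, ‖Q z‖ ≤ M ↔ ‖H z‖ ≤ M * ‖b z‖ := by
    intro z hz M
    rw [hQn, inv_mul_le_iff₀ (norm_pos_iff.2 (h0 z hz)), mul_comm]
  have hHd : Differentiable ℂ H := by
    rw [hH]; fun_prop
  have hQd : DifferentiableOn ℂ Q (ball c R) := (hd.inv h0).smul hHd.differentiableOn
  have hbig : closedBall w (3 * R / 4) ⊆ ball c R := by
    intro z hz
    rw [mem_closedBall] at hz
    rw [mem_ball]
    linarith [dist_triangle z w c]
  -- the supremum of the ratio over the disc of radius `2 * r` is attained on the circle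
  obtain ⟨z₂, hz₂, hz₂M⟩ : ∃ z₂, dist z₂ w = 2 * r ∧
      ∀ z ∈ closedBall w (2 * r), ‖Q z‖ ≤ ‖Q z₂‖ := by
    have hb : Bornology.IsBounded (ball w (2 * r)) := isBounded_ball
    have hdc : DiffContOnCl ℂ Q (ball w (2 * r)) := by
      refine (hQd.mono ?_).diffContOnCl
      rw [closure_ball _ (by positivity)]
      exact (closedBall_subset_closedBall (by linarith)).trans hbig
    obtain ⟨z₂, hz₂, hm⟩ := Complex.exists_mem_frontier_isMaxOn_norm hb
      ⟨w, mem_ball_self (by positivity)⟩ hdc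
    rw [frontier_ball _ (by positivity)] at hz₂
    rw [closure_ball _ (by positivity)] at hm
    exact ⟨z₂, hz₂, fun z hz => hm hz⟩
  have hdecay := le_pow_of_forall_half (q := fun z => ‖Q z‖) (z := w) (ρ := 2 * r) (τ := τ)
    (M := ‖Q z₂‖) hτpos (fun x M hsub hM => by
      have hx : x ∈ ball w (2 * r) := hsub (mem_ball_self hτpos)
      have hsub2 : ball w (2 * r) ⊆ ball c R :=
        ball_subset_closedBall.trans ((closedBall_subset_closedBall (by linarith)).trans hbig)
      rw [mem_ball] at hx
      have hxc : x ∈ ball c R := hsub2 hx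
      refine (hQle x hxc _).2 ?_
      refine norm_expSum_le_half (δ := δ / 2) hn hτpos (hd.mono (hsub.trans hsub2))
        (fun y hy => h0 y (hsub2 (hsub hy))) (fun y hy => ?_) (fun k => ?_) ?_
        (fun y hy => (hQle y (hsub2 (hsub hy)) _).1 (hM y hy))
      · refine (hlip x (by linarith) y (ball_subset_ball (by linarith) hy)).trans
          (le_trans ?_ hτ2)
        gcongr
        exact (mem_ball.1 hy).le
      · have h1 := hψle w k
        have h2 : ‖β x - β w‖ ≤ δ / 2 := by
          refine (hlip w (by simp; positivity) x (by rw [mem_ball]; linarith)).trans ?_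
          calc 8 * n * δ / ρ * dist x w ≤ 8 * n * δ / ρ * (2 * r) := by gcongr
            _ = δ / 2 := by rw [hr]; field_simp; ring
        have h3 : ‖β w - s k‖ ≤ ‖β x - β w‖ + ‖s k - β x‖ := by
          rw [norm_sub_rev (s k), norm_sub_rev (β x) (β w)]
          simpa using norm_add_le (β w - β x) (β x - s k)
        change δ / 2 ≤ ‖s k - β x‖
        linarith
      · linarith)
    (fun z hz => hz₂M z (ball_subset_closedBall hz)) (N + p + 2)
  -- halving `N + p + 2` times and interpolating gives `|Q ζ| ≤ 2 ^ (-N - 1)`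
  obtain ⟨ζ, hζ, hζb⟩ := hlb
  have hζc : ζ ∈ ball c R := by rw [mem_ball]; linarith
  have hfin := norm_le_of_small_on_inner (Q := Q) (c := w) (r := r) (R := 3 * R / 4)
    (A := 2 ^ p) (M := ‖Q z₂‖) (N + p + 1) hrpos (by linarith) (by positivity)
    ((hQd.mono (by rw [closure_ball _ (by positivity)]; exact hbig)).diffContOnCl)
    (fun z hz => (hQle z (hbig hz) _).2 (hub z (hbig hz)))
    (fun z hz => hz₂M z hz.le) ⟨z₂, hz₂, rfl⟩
    (fun z hz => hdecay z (by
      rw [mem_closedBall] at hz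
      rw [mem_ball]
      linarith)) (z := ζ) (by linarith [dist_triangle ζ c w, dist_comm c w])
  rw [hQle ζ hζc] at hfin
  have hbpos : 0 < ‖b ζ‖ := norm_pos_iff.2 (h0 ζ hζc)
  have : ‖b ζ‖ ≤ 2 ^ N * (2 ^ p / 2 ^ (N + p + 1) * ‖b ζ‖) := hζb.trans (by gcongr)
  have e : (2 : ℝ) ^ N * (2 ^ p / 2 ^ (N + p + 1) * ‖b ζ‖) = ‖b ζ‖ / 2 := by
    rw [pow_succ, pow_add]; field_simp
  rw [e] at this
  linarith

end

/-! ### Discs touching a closed set, and sectors -/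

section

/-- A point `z` outside a closed set `S` either lies well inside a disc disjoint from `S` which
touches `S` at a point that is neither too close to the origin nor too far away, or is contained in
a union of large discs disjoint from `S`, which almost reach the origin and fill a region that is
slightly larger, near the origin, than a half-plane. -/
theorem exists_touching_ball_or_sector {S : Set ℂ} (hS : IsClosed S) {r₀ : ℝ} (hr₀ : 0 < r₀) {z : ℂ}
    (hz : z ∉ S) (hzr : 7 * r₀ ≤ ‖z‖) :
    (∃ c R w, 0 < R ∧ Disjoint (ball c R) S ∧ w ∈ S ∧ dist w c = R ∧ r₀ ≤ ‖w‖ ∧ ‖w‖ ≤ 2 * ‖z‖ ∧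
      dist z c ≤ R / 5 ∧ ‖c‖ = ‖z‖ ∧ R ≤ ‖z‖ ∧ (c = z ∨ 6 / 7 * ‖z‖ ≤ R)) ∨
    ∀ θ : ℝ, |θ| ≤ 1 / 7 → Disjoint (ball (exp (θ * I) * z) (‖z‖ - r₀)) S := by
  rcases S.eq_empty_or_nonempty with rfl | hne
  · exact Or.inr fun θ _ => disjoint_empty _
  have hball : ∀ c, Disjoint (ball c (infDist c S)) S := fun c => disjoint_ball_infDist
  have hrz : 0 < ‖z‖ - r₀ := by linarith
  have hnorm : ∀ θ : ℝ, ‖exp (θ * I) * z‖ = ‖z‖ := fun θ => by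
    rw [norm_mul, norm_exp_ofReal_mul_I, one_mul]
  -- a point of `S` nearest to a point of modulus `‖z‖`
  have htouch : ∀ c, ‖c‖ = ‖z‖ → infDist c S ≤ ‖z‖ - r₀ →
      ∃ w ∈ S, dist w c = infDist c S ∧ r₀ ≤ ‖w‖ ∧ ‖w‖ ≤ 2 * ‖z‖ := by
    intro c hc hle
    obtain ⟨w, hw, hwd⟩ := hS.exists_infDist_eq_dist hne c
    rw [dist_comm] at hwd
    refine ⟨w, hw, hwd.symm, ?_, ?_⟩
    · have := norm_sub_norm_le c w
      rw [← dist_eq_norm, dist_comm] at this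
      linarith
    · have := norm_sub_norm_le w c
      rw [← dist_eq_norm] at this
      linarith
  rcases le_or_gt (infDist z S) (‖z‖ - r₀) with hle | hlt
  · obtain ⟨w, hw, hwd, hw1, hw2⟩ := htouch z rfl hle
    have hpos : 0 < infDist z S := (hS.notMem_iff_infDist_pos hne).1 hz
    exact Or.inl ⟨z, infDist z S, w, hpos, hball z, hw, hwd, hw1, hw2, by simp; positivity, rfl,
      by linarith, Or.inl rfl⟩
  by_cases hall : ∀ θ : ℝ, |θ| ≤ 1 / 7 → ‖z‖ - r₀ ≤ infDist (exp (θ * I) * z) S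
  · exact Or.inr fun θ hθ => (hball _).mono_left (ball_subset_ball (hall θ hθ))
  push Not at hall
  obtain ⟨θ₁, hθ₁, hlt₁⟩ := hall
  -- rotate the disc until it touches `S`
  have hcont : Continuous fun θ : ℝ => infDist (exp (θ * I) * z) S :=
    (continuous_infDist_pt S).comp (by fun_prop)
  have hiv := intermediate_value_uIcc (a := θ₁) (b := 0) hcont.continuousOn
  obtain ⟨θ, hθ, hθe⟩ := hiv (show ‖z‖ - r₀ ∈ _ by
    rw [mem_uIcc]; left
    simp only [ofReal_zero, zero_mul, exp_zero, one_mul]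
    exact ⟨hlt₁.le, hlt.le⟩)
  simp only at hθe
  have hθ7 : |θ| ≤ 1 / 7 := by
    rw [abs_le] at hθ₁ ⊢
    rcases mem_uIcc.1 hθ with h | h <;> constructor <;> linarith [h.1, h.2]
  obtain ⟨w, hw, hwd, hw1, hw2⟩ := htouch _ (hnorm θ) hθe.le
  refine Or.inl ⟨exp (θ * I) * z, ‖z‖ - r₀, w, hrz, ?_, hw, hwd.trans hθe, hw1, hw2, ?_, hnorm θ,
    by linarith, Or.inr (by linarith)⟩
  · rw [← hθe]; exact hball _
  · have h1 : dist z (exp (θ * I) * z) = ‖exp (I * θ) - 1‖ * ‖z‖ := by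
      rw [dist_comm, dist_eq_norm, ← norm_mul, mul_comm I]
      congr 1
      ring
    rw [h1]
    have h2 : ‖exp (I * θ) - 1‖ ≤ 1 / 7 :=
      (Real.norm_exp_I_mul_ofReal_sub_one_le (x := θ)).trans (by rwa [Real.norm_eq_abs])
    nlinarith [norm_nonneg z]

/-- The power map of exponent `13 / 12` sends a disc contained in the right half-plane and tangent
to its boundary, up to a small margin, into a rotated family of discs. -/
theorem cpow_mem_ball {r r₀ δ : ℝ} (hδ1 : 1 ≤ δ) (hδ : 2 * r₀ ≤ δ)
    (hr : r₀ < r) {c : ℝ} (hc : (2 * c) ^ (13 / 12 : ℝ) = r) (hcpos : 0 < c) {η : ℂ}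
    (hη : η ∈ ball (c : ℂ) (c - δ)) :
    0 < η.re ∧ ∃ θ : ℝ, |θ| ≤ 1 / 7 ∧ η ^ (13 / 12 : ℂ) ∈ ball (exp (θ * I) * r) (r - r₀) := by
  rw [mem_ball, dist_eq_norm] at hη
  have hre : δ < η.re := by
    have := (abs_le.1 ((abs_re_le_norm _).trans hη.le)).1
    have h2 := abs_re_le_norm (η - c)
    simp only [sub_re, ofReal_re] at this h2
    have h3 := (abs_lt.1 (h2.trans_lt hη)).1
    linarith
  have hη0 : η ≠ 0 := by
    rintro rfl
    simp at hre
    linarith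
  set ρ := ‖η‖ with hρ
  set α := arg η with hα
  have hρpos : 0 < ρ := norm_pos_iff.2 hη0
  have hαlt : |α| < Real.pi / 2 := abs_arg_lt_pi_div_two_iff.2 (Or.inl (by linarith))
  have hρcos : ρ * Real.cos α = η.re := norm_mul_cos_arg η
  have hcospos : 0 < Real.cos α := Real.cos_pos_of_mem_Ioo (abs_lt.1 hαlt)
  have hcosle : Real.cos α ≤ 1 := Real.cos_le_one α
  have hρδ : δ < ρ := lt_of_lt_of_le hre (by rw [← hρcos]; nlinarith)
  have hρc : ρ < 2 * c * Real.cos α := by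
    have h1 : ‖η - c‖ ^ 2 < c ^ 2 := by
      refine pow_lt_pow_left₀ (by linarith) (norm_nonneg _) (by norm_num)
    rw [Complex.sq_norm, normSq_apply] at h1
    simp at h1
    have h2 : ρ ^ 2 = η.re * η.re + η.im * η.im := by rw [hρ, Complex.sq_norm, normSq_apply]
    have h3 : ρ ^ 2 < 2 * c * (ρ * Real.cos α) := by rw [hρcos]; nlinarith
    have h4 : ρ * ρ < ρ * (2 * c * Real.cos α) := by nlinarith
    exact lt_of_mul_lt_mul_left h4 hρpos.le
  -- `η ^ q = ρ ^ q * exp (q α I)` is the rotation by `(q - 1) α` of `ρ ^ q * exp (α I)`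
  have hpow : η ^ (13 / 12 : ℂ) = exp ((1 / 12 * α : ℝ) * I) * ((ρ ^ (13 / 12 : ℝ) : ℝ) *
      exp (α * I)) := by
    rw [cpow_def_of_ne_zero hη0, Complex.log, ← hα, ← hρ]
    have : ((ρ ^ (13 / 12 : ℝ) : ℝ) : ℂ) = exp (Real.log ρ * (13 / 12)) := by
      rw [Real.rpow_def_of_pos hρpos]
      push_cast
      ring_nf
    rw [this, ← exp_add, ← exp_add]
    congr 1
    push_cast
    ring
  set x := ρ ^ (13 / 12 : ℝ) with hx
  have hx1 : ρ ≤ x := by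
    simpa using Real.rpow_le_rpow_of_exponent_le (show (1 : ℝ) ≤ ρ by linarith)
      (show (1 : ℝ) ≤ 13 / 12 by norm_num)
  have hx2 : x ≤ r * Real.cos α := by
    calc x ≤ (2 * c * Real.cos α) ^ (13 / 12 : ℝ) := by
          rw [hx]; exact Real.rpow_le_rpow hρpos.le hρc.le (by norm_num)
      _ = r * Real.cos α ^ (13 / 12 : ℝ) := by
          rw [Real.mul_rpow (by positivity) hcospos.le, hc]
      _ ≤ r * Real.cos α := by
          have h1 : Real.cos α ^ (13 / 12 : ℝ) ≤ Real.cos α ^ (1 : ℝ) :=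
            Real.rpow_le_rpow_of_exponent_ge hcospos hcosle (by norm_num)
          rw [Real.rpow_one] at h1
          have hr0 : 0 < r := by rw [← hc]; positivity
          gcongr
  refine ⟨by linarith, 1 / 12 * α, ?_, ?_⟩
  · rw [abs_mul, abs_of_pos (by norm_num)]
    have := Real.pi_lt_d2
    linarith
  · rw [hpow, mem_ball, dist_eq_norm, ← mul_sub, norm_mul, norm_exp_ofReal_mul_I, one_mul]
    have hsq : ‖(x : ℂ) * exp (α * I) - r‖ ^ 2 = x ^ 2 - 2 * x * r * Real.cos α + r ^ 2 := by
      rw [Complex.sq_norm, normSq_apply]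
      simp [exp_ofReal_mul_I_re, exp_ofReal_mul_I_im]
      nlinarith [Real.sin_sq_add_cos_sq α]
    refine lt_of_pow_lt_pow_left₀ 2 (by linarith) ?_
    rw [hsq]
    have hr0 : 0 < r := by rw [← hc]; positivity
    have hx0 : 0 < x := by linarith
    have hxc : δ < x * Real.cos α := lt_of_lt_of_le hre (by rw [← hρcos]; gcongr)
    have h1 : x ^ 2 ≤ x * (r * Real.cos α) := by rw [sq]; gcongr
    have h2 : r * (2 * r₀) ≤ r * (x * Real.cos α) :=
      mul_le_mul_of_nonneg_left (hδ.trans hxc.le) hr0.le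
    rcases eq_or_ne r₀ 0 with h | h
    · have : 0 < r * (x * Real.cos α) := by positivity
      rw [h]
      nlinarith
    · have : 0 < r₀ ^ 2 := by positivity
      nlinarith

/-- In a region slightly larger than a half-plane, a positive harmonic function grows at most like
`|z| ^ (12 / 13)`, so that its gradient tends to zero. -/
theorem norm_logDeriv_le_of_sector {r₀ : ℝ} (hr₀ : 0 < r₀) : ∃ ρ : ℝ, 0 < ρ ∧ ∀ M ε : ℝ, 0 < ε →
    ∃ r₁ : ℝ, ∀ (z : ℂ) (φ : ℂ → ℂ), r₁ ≤ ‖z‖ →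
      (∀ θ : ℝ, |θ| ≤ 1 / 7 → DifferentiableOn ℂ φ (ball (exp (θ * I) * z) (‖z‖ - r₀)) ∧
        ∀ w ∈ ball (exp (θ * I) * z) (‖z‖ - r₀), φ w ≠ 0 ∧ ‖φ w‖ < 1) →
      (∀ w, ‖w‖ = ρ → -Real.log ‖φ w‖ ≤ M) → ‖deriv φ z / φ z‖ ≤ ε := by
  set δ := max 1 (2 * r₀) with hδ
  have hδ1 : 1 ≤ δ := le_max_left _ _
  have hδ2 : 2 * r₀ ≤ δ := le_max_right _ _
  have hδpos : 0 < δ := by linarith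
  refine ⟨(2 * δ) ^ (13 / 12 : ℝ), by positivity, fun M ε hε => ?_⟩
  -- the constant collects the two applications of Harnack's inequality and the gradient estimate
  set A := 200 * max M 0 / δ with hA
  have hA0 : 0 ≤ A := by positivity
  have ht1 : Tendsto (fun r : ℝ => r ^ (12 / 13 : ℝ)) atTop atTop :=
    tendsto_rpow_atTop (by norm_num)
  have ht2 : Tendsto (fun r : ℝ => A * r ^ (-(1 / 13) : ℝ)) atTop (𝓝 0) := by
    simpa using (tendsto_rpow_neg_atTop (show (0 : ℝ) < 1 / 13 by norm_num)).const_mul A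
  obtain ⟨r₁, hr₁⟩ := eventually_atTop.1 (((ht1.eventually_ge_atTop (4 * δ)).and
    (ht2.eventually_le_const hε)).and (eventually_ge_atTop (7 * r₀)))
  refine ⟨r₁, fun z φ hz hφ hM => ?_⟩
  obtain ⟨⟨hc4, hAε⟩, h7⟩ := hr₁ ‖z‖ hz
  set r := ‖z‖ with hr
  have hrpos : 0 < r := by linarith
  refine le_trans ?_ hAε
  set c := r ^ (12 / 13 : ℝ) / 2 with hc
  have hcpos : 0 < c := by positivity
  have hcδ : 2 * δ ≤ c := by linarith
  have h2c : (2 * c) ^ (13 / 12 : ℝ) = r := by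
    rw [hc, mul_div_cancel₀ _ two_ne_zero, ← Real.rpow_mul hrpos.le]
    norm_num
  set u : ℂ := z / r with hu
  have hunorm : ‖u‖ = 1 := by
    rw [hu, norm_div, Complex.norm_real, Real.norm_eq_abs, abs_of_pos hrpos, ← hr, div_self hrpos.ne']
  have hur : u * r = z := by
    rw [hu, div_mul_cancel₀ _ (ofReal_ne_zero.2 hrpos.ne')]
  have hmem : ∀ η ∈ ball (c : ℂ) (c - δ), 0 < η.re ∧
      ∃ θ : ℝ, |θ| ≤ 1 / 7 ∧ u * η ^ (13 / 12 : ℂ) ∈ ball (exp (θ * I) * z) (r - r₀) := by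
    intro η hη
    obtain ⟨h1, θ, h2, h3⟩ := cpow_mem_ball hδ1 hδ2 (by linarith) h2c hcpos hη
    refine ⟨h1, θ, h2, ?_⟩
    rw [mem_ball, dist_eq_norm] at h3 ⊢
    have : u * η ^ (13 / 12 : ℂ) - exp (θ * I) * z = u * (η ^ (13 / 12 : ℂ) - exp (θ * I) * r) := by
      rw [← hur]; ring
    rw [this, norm_mul, hunorm, one_mul]
    exact h3
  set Ψ : ℂ → ℂ := fun η => φ (u * η ^ (13 / 12 : ℂ)) with hΨ
  have hΨd : DifferentiableOn ℂ Ψ (ball (c : ℂ) (c - δ)) := by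
    intro η hη
    obtain ⟨h1, θ, h2, h3⟩ := hmem η hη
    have hd := ((hφ θ h2).1.differentiableAt (isOpen_ball.mem_nhds h3))
    have hin : DifferentiableAt ℂ (fun η : ℂ => u * η ^ (13 / 12 : ℂ)) η :=
      (differentiableAt_id.cpow_const (Or.inl h1)).const_mul u
    exact (hd.comp η hin).differentiableWithinAt
  have hΨ0 : ∀ η ∈ ball (c : ℂ) (c - δ), Ψ η ≠ 0 ∧ ‖Ψ η‖ < 1 := by
    intro η hη
    obtain ⟨h1, θ, h2, h3⟩ := hmem η hη
    exact (hφ θ h2).2 _ h3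
  -- `Ψ` transports `φ` by the power map to a disc of radius about `r ^ (12 / 13) / 2`;
  -- comparison of the centre with the point `2 * δ` close to the boundary
  have hdist : dist ((2 * δ : ℝ) : ℂ) c = c - 2 * δ := by
    rw [dist_comm, dist_eq_norm, ← ofReal_sub, Complex.norm_real, Real.norm_eq_abs,
      abs_of_nonneg (by linarith)]
  have hmem2 : ((2 * δ : ℝ) : ℂ) ∈ ball (c : ℂ) (c - δ) := by
    rw [mem_ball, hdist]; linarith
  have hH1 := (neg_log_norm_harnack hΨd (fun η hη => (hΨ0 η hη).1) (fun η hη => (hΨ0 η hη).2)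
    hmem2).2
  rw [hdist] at hH1
  have hcast : ∀ x : ℝ, 0 ≤ x → (x : ℂ) ^ (13 / 12 : ℂ) = ((x ^ (13 / 12 : ℝ) : ℝ) : ℂ) := by
    intro x hx
    rw [ofReal_cpow hx]
    norm_num
  have href : -Real.log ‖Ψ ((2 * δ : ℝ) : ℂ)‖ ≤ M := by
    refine hM _ ?_
    rw [hcast _ (by positivity), norm_mul, hunorm, one_mul, Complex.norm_real, Real.norm_eq_abs,
      abs_of_nonneg (by positivity)]
  set L := -Real.log ‖Ψ (c : ℂ)‖ with hL
  have hLc : L ≤ 2 * max M 0 / δ * c := by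
    have h1 : L * δ ≤ M * (2 * c - 3 * δ) := by
      have : -Real.log ‖Ψ ((2 * δ : ℝ) : ℂ)‖ * (c - δ + (c - 2 * δ)) ≤ M * (c - δ + (c - 2 * δ)) := by
        gcongr
        linarith
      nlinarith
    have h2 : M * (2 * c - 3 * δ) ≤ max M 0 * (2 * c) := by
      have : M ≤ max M 0 := le_max_left _ _
      have : (0 : ℝ) ≤ max M 0 := le_max_right _ _
      nlinarith
    rw [div_mul_eq_mul_div, le_div_iff₀ hδpos]
    linarith
  -- comparison of `z` with the image of the centre
  have h00 := hφ 0 (by norm_num)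
  simp only [ofReal_zero, zero_mul, exp_zero, one_mul] at h00
  set w : ℂ := u * (c : ℂ) ^ (13 / 12 : ℂ) with hw
  have hwz : dist w z ≤ 3 / 4 * r := by
    have e1 : (2 : ℝ) ^ (13 / 12 : ℝ) ≤ 4 := by
      calc (2 : ℝ) ^ (13 / 12 : ℝ) ≤ 2 ^ (2 : ℝ) :=
            Real.rpow_le_rpow_of_exponent_le (by norm_num) (by norm_num)
        _ = 4 := by norm_num
    have e2 : 2 ^ (13 / 12 : ℝ) * c ^ (13 / 12 : ℝ) = r := by
      rw [← Real.mul_rpow (by norm_num) hcpos.le]; exact h2c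
    have e3 : 0 < c ^ (13 / 12 : ℝ) := by positivity
    have e4 : c ^ (13 / 12 : ℝ) ≤ r := by
      have : (1 : ℝ) ≤ 2 ^ (13 / 12 : ℝ) := Real.one_le_rpow (by norm_num) (by norm_num)
      nlinarith
    rw [dist_comm, dist_eq_norm, ← hur, hw, ← mul_sub, norm_mul, hunorm, one_mul, hcast _ hcpos.le,
      ← ofReal_sub, Complex.norm_real, Real.norm_eq_abs, abs_of_nonneg (by linarith)]
    nlinarith
  have hH2 := (neg_log_norm_harnack h00.1 (fun η hη => (h00.2 η hη).1) (fun η hη => (h00.2 η hη).2)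
    (show w ∈ ball z (r - r₀) by rw [mem_ball]; linarith)).2
  have hLw : -Real.log ‖φ w‖ = L := rfl
  rw [hLw] at hH2
  have hL0 : 0 ≤ L := by
    have h := hΨ0 (c : ℂ) (mem_ball_self (by linarith))
    have := Real.log_neg (norm_pos_iff.2 h.1) h.2
    linarith
  have hLz0 : 0 ≤ -Real.log ‖φ z‖ := by
    have h := h00.2 z (mem_ball_self (by linarith))
    have := Real.log_neg (norm_pos_iff.2 h.1) h.2
    linarith
  have hLz : -Real.log ‖φ z‖ ≤ 20 * L := by
    have h1 : -Real.log ‖φ z‖ * (3 / 28 * r) ≤ L * (2 * r) := by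
      calc _ ≤ -Real.log ‖φ z‖ * (r - r₀ - dist w z) := by
            gcongr; linarith
        _ ≤ _ := hH2
        _ ≤ _ := by gcongr; linarith
    have h2 : r * (-Real.log ‖φ z‖ * (3 / 28)) ≤ r * (L * 2) := by linarith
    have := le_of_mul_le_mul_left h2 hrpos
    linarith
  have hgrad := norm_logDeriv_le (by linarith) h00.1 (fun η hη => (h00.2 η hη).1)
    (fun η hη => (h00.2 η hη).2) (R := r - r₀)
  refine hgrad.trans ?_
  rw [div_le_iff₀ (by linarith)]
  have hpow : r ^ (12 / 13 : ℝ) = r ^ (-(1 / 13) : ℝ) * r := by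
    rw [← Real.rpow_add_one hrpos.ne']; norm_num
  have hX : 0 ≤ r ^ (-(1 / 13) : ℝ) := by positivity
  set X := r ^ (-(1 / 13) : ℝ) with hXdef
  have e : c = X * r / 2 := by rw [hc, hpow]
  rw [e] at hLc
  set B := max M 0 / δ with hB
  have hAB : A = 200 * B := by rw [hA, hB]; ring
  have hLc' : L ≤ B * (X * r) := by
    refine hLc.trans (le_of_eq ?_); rw [hB]; ring
  have hB0 : 0 ≤ B := by positivity
  have h67 : 6 / 7 * r ≤ r - r₀ := by linarith
  calc 2 * -Real.log ‖φ z‖ ≤ 40 * (B * (X * r)) := by linarith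
    _ ≤ A * X * (6 / 7 * r) := by
      rw [hAB]
      have : 0 ≤ B * (X * r) := by positivity
      nlinarith
    _ ≤ A * X * (r - r₀) := by gcongr

end

/-! ### The logarithmic gradient and the Fubini–Study derivative -/

section

variable {E : Type*} [NormedAddCommGroup E] [InnerProductSpace ℂ E]

/-- The logarithmic gradient `⟪Φ, Φ'⟫ / ‖Φ‖² = 2 ∂ log ‖Φ‖` of a vector-valued holomorphic
function `Φ`; it is `0` where `Φ` vanishes. -/
noncomputable def logGrad (Φ : ℂ → E) (z : ℂ) : ℂ :=
  inner ℂ (Φ z) (deriv Φ z) / ((‖Φ z‖ ^ 2 : ℝ) : ℂ)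

/-- The Fubini–Study derivative of the projective curve represented by `Φ`, as the relative size
of the component of `Φ'` orthogonal to `Φ`; it is `0` where `Φ` vanishes. -/
noncomputable def sphDeriv (Φ : ℂ → E) (z : ℂ) : ℝ :=
  ‖deriv Φ z - logGrad Φ z • Φ z‖ / ‖Φ z‖

theorem inner_self_eq_ofReal_norm_sq (x : E) : inner ℂ x x = (‖x‖ : ℂ) ^ 2 :=
  inner_self_eq_norm_sq_to_K x

theorem sphDeriv_nonneg (Φ : ℂ → E) (z : ℂ) : 0 ≤ sphDeriv Φ z := by
  unfold sphDeriv; positivity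

theorem inner_deriv_sub_logGrad_smul {Φ : ℂ → E} {z : ℂ} (h : Φ z ≠ 0) :
    inner ℂ (Φ z) (deriv Φ z - logGrad Φ z • Φ z) = 0 := by
  have hn : ((‖Φ z‖ ^ 2 : ℝ) : ℂ) ≠ 0 := by
    exact_mod_cast pow_ne_zero 2 (norm_ne_zero_iff.2 h)
  rw [inner_sub_right, inner_smul_right, inner_self_eq_ofReal_norm_sq, logGrad]
  push_cast at hn ⊢
  rw [div_mul_cancel₀ _ hn, sub_self]

theorem norm_deriv_sub_logGrad_smul {Φ : ℂ → E} {z : ℂ} (h : Φ z ≠ 0) :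
    ‖deriv Φ z - logGrad Φ z • Φ z‖ = sphDeriv Φ z * ‖Φ z‖ := by
  rw [sphDeriv, div_mul_cancel₀ _ (norm_ne_zero_iff.2 h)]

/-- The square of the Fubini–Study derivative, in terms of inner products. -/
theorem sphDeriv_sq {Φ : ℂ → E} {z : ℂ} (h : Φ z ≠ 0) :
    sphDeriv Φ z ^ 2 =
      (‖deriv Φ z‖ ^ 2 * ‖Φ z‖ ^ 2 - ‖inner ℂ (Φ z) (deriv Φ z)‖ ^ 2) / ‖Φ z‖ ^ 4 := by
  have hn : ‖Φ z‖ ≠ 0 := norm_ne_zero_iff.2 h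
  have hdec : deriv Φ z = (deriv Φ z - logGrad Φ z • Φ z) + logGrad Φ z • Φ z := by simp
  have hpyth := norm_add_sq_eq_norm_sq_add_norm_sq_of_inner_eq_zero (𝕜 := ℂ)
    (deriv Φ z - logGrad Φ z • Φ z) (logGrad Φ z • Φ z) (by
      rw [inner_smul_right, ← inner_conj_symm, inner_deriv_sub_logGrad_smul h, map_zero, mul_zero])
  rw [← hdec, norm_smul] at hpyth
  have hlg : ‖logGrad Φ z‖ = ‖inner ℂ (Φ z) (deriv Φ z)‖ / ‖Φ z‖ ^ 2 := by
    rw [logGrad, norm_div, Complex.norm_real, Real.norm_eq_abs, abs_of_nonneg (by positivity)]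
  rw [hlg] at hpyth
  rw [sphDeriv, div_pow, ← sq] at *
  field_simp at hpyth ⊢
  linarith

/-- The logarithmic derivative of a linear coordinate of a curve is close to the logarithmic
gradient wherever this coordinate is not small compared with the whole vector. This is how the
logarithmic gradient is compared with entire functions. -/
theorem norm_logDeriv_inner_sub_logGrad_le {Φ : ℂ → E} {z : ℂ} {a : E} (ha : ‖a‖ = 1)
    (hd : DifferentiableAt ℂ Φ z) (h : inner ℂ a (Φ z) ≠ 0) :
    ‖deriv (fun w => inner ℂ a (Φ w)) z / inner ℂ a (Φ z) - logGrad Φ z‖ ≤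
      sphDeriv Φ z * ‖Φ z‖ / ‖inner ℂ a (Φ z)‖ := by
  have hΦ : Φ z ≠ 0 := by
    intro h0; rw [h0, inner_zero_right] at h; exact h rfl
  have hder : deriv (fun w => inner ℂ a (Φ w)) z = inner ℂ a (deriv Φ z) :=
    (((innerSL ℂ a).hasFDerivAt.comp_hasDerivAt z hd.hasDerivAt)).deriv
  have e : inner ℂ a (deriv Φ z) / inner ℂ a (Φ z) - logGrad Φ z =
      inner ℂ a (deriv Φ z - logGrad Φ z • Φ z) / inner ℂ a (Φ z) := by
    rw [inner_sub_right, inner_smul_right]; field_simp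
  rw [hder, e, norm_div]
  gcongr
  refine (norm_inner_le_norm _ _).trans (le_of_eq ?_)
  rw [ha, one_mul, norm_deriv_sub_logGrad_smul hΦ]

theorem logGrad_smul {Φ : ℂ → E} {g : ℂ → ℂ} {z : ℂ} (hΦ : DifferentiableAt ℂ Φ z)
    (hg : DifferentiableAt ℂ g z) (h : Φ z ≠ 0) (hg0 : g z ≠ 0) :
    logGrad (fun w => g w • Φ w) z = deriv g z / g z + logGrad Φ z := by
  have hn : (‖Φ z‖ : ℂ) ≠ 0 := by exact_mod_cast norm_ne_zero_iff.2 h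
  have hgn : (‖g z‖ : ℂ) ≠ 0 := by exact_mod_cast norm_ne_zero_iff.2 hg0
  have hgg : conj (g z) * g z = (‖g z‖ : ℂ) ^ 2 := by rw [conj_mul']
  unfold logGrad
  rw [(hg.hasDerivAt.fun_smul hΦ.hasDerivAt).deriv, inner_smul_left, inner_add_right, inner_smul_right,
    inner_smul_right, inner_self_eq_ofReal_norm_sq, norm_smul]
  push_cast
  rw [mul_pow, ← hgg]
  have : conj (g z) ≠ 0 := (map_ne_zero _).2 hg0
  field_simp
  ring

/-- The Fubini–Study derivative does not depend on the choice of the representation. -/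
theorem sphDeriv_smul {Φ : ℂ → E} {g : ℂ → ℂ} {z : ℂ} (hΦ : DifferentiableAt ℂ Φ z)
    (hg : DifferentiableAt ℂ g z) (h : Φ z ≠ 0) (hg0 : g z ≠ 0) :
    sphDeriv (fun w => g w • Φ w) z = sphDeriv Φ z := by
  have e : deriv (fun w => g w • Φ w) z - (deriv g z / g z + logGrad Φ z) • g z • Φ z =
      g z • (deriv Φ z - logGrad Φ z • Φ z) := by
    rw [(hg.hasDerivAt.fun_smul hΦ.hasDerivAt).deriv, smul_sub, smul_smul, smul_smul, add_mul, add_smul,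
      div_mul_cancel₀ _ hg0, mul_comm (logGrad Φ z)]
    abel
  unfold sphDeriv
  rw [logGrad_smul hΦ hg h hg0, e, norm_smul, norm_smul,
    mul_div_mul_left _ _ (norm_ne_zero_iff.2 hg0)]

theorem hasDerivAt_log_norm_comp {Φ : ℂ → E} (hΦ : Differentiable ℂ Φ) {c : ℝ → ℂ} {c' : ℂ} {s : ℝ}
    (h0 : Φ (c s) ≠ 0) (hc : HasDerivAt c c' s) :
    HasDerivAt (fun s => Real.log ‖Φ (c s)‖) (logGrad Φ (c s) * c').re s := by
  have h1 : HasDerivAt (fun s => Φ (c s)) (c' • deriv Φ (c s)) s :=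
    (hΦ (c s)).hasDerivAt.scomp s hc
  have hn : ‖Φ (c s)‖ ≠ 0 := norm_ne_zero_iff.2 h0
  let _ : InnerProductSpace ℝ E := InnerProductSpace.rclikeToReal ℂ E
  have h2 := (h1.norm_sq.log (pow_ne_zero 2 hn)).div_const 2
  have hfun : (fun s => Real.log ‖Φ (c s)‖) = fun s => Real.log (‖Φ (c s)‖ ^ 2) / 2 := by
    funext s
    rw [Real.log_pow]; push_cast; ring
  rw [hfun]
  refine h2.congr_deriv ?_
  rw [real_inner_eq_re_inner ℂ, inner_smul_right, logGrad, div_mul_eq_mul_div, div_ofReal_re,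
    mul_comm c']
  simp only [RCLike.re_to_complex]
  field_simp

section Regularity

variable [CompleteSpace E] {Φ : ℂ → E}

theorem _root_.Differentiable.complex_deriv (hΦ : Differentiable ℂ Φ) :
    Differentiable ℂ (deriv Φ) :=
  fun _ => ((hΦ.differentiableOn (s := univ)).deriv isOpen_univ).differentiableAt univ_mem

theorem continuous_logGrad (hΦ : Differentiable ℂ Φ) (h0 : ∀ z, Φ z ≠ 0) :
    Continuous (logGrad Φ) := by
  have h1 := hΦ.continuous
  have h2 := hΦ.complex_deriv.continuous
  unfold logGrad
  refine (h1.inner h2).div (by fun_prop) fun z => ?_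
  exact_mod_cast pow_ne_zero 2 (norm_ne_zero_iff.2 (h0 z))

theorem continuous_sphDeriv (hΦ : Differentiable ℂ Φ) (h0 : ∀ z, Φ z ≠ 0) :
    Continuous (sphDeriv Φ) := by
  have h1 := hΦ.continuous
  have h2 := hΦ.complex_deriv.continuous
  have h3 := continuous_logGrad hΦ h0
  unfold sphDeriv
  exact (h2.sub (h3.smul h1)).norm.div h1.norm fun z => norm_ne_zero_iff.2 (h0 z)

/-- The holomorphic derivative `∂` of the logarithmic gradient. -/
noncomputable def logGradDeriv (Φ : ℂ → E) (z : ℂ) : ℂ :=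
  inner ℂ (Φ z) (deriv (deriv Φ) z) / ((‖Φ z‖ ^ 2 : ℝ) : ℂ) - logGrad Φ z ^ 2

theorem continuous_logGradDeriv (hΦ : Differentiable ℂ Φ) (h0 : ∀ z, Φ z ≠ 0) :
    Continuous (logGradDeriv Φ) := by
  have h1 := hΦ.continuous
  have h2 := hΦ.complex_deriv.complex_deriv.continuous
  have h3 := continuous_logGrad hΦ h0
  unfold logGradDeriv
  refine ((h1.inner h2).div (by fun_prop) fun z => ?_).sub (h3.pow 2)
  exact_mod_cast pow_ne_zero 2 (norm_ne_zero_iff.2 (h0 z))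

/-- The derivative of the logarithmic gradient along a curve: its antiholomorphic part `∂̄` is the
square of the Fubini–Study derivative. -/
theorem hasDerivAt_logGrad_comp (hΦ : Differentiable ℂ Φ) {c : ℝ → ℂ} {c' : ℂ} {s : ℝ}
    (h0 : Φ (c s) ≠ 0) (hc : HasDerivAt c c' s) :
    HasDerivAt (fun s => logGrad Φ (c s))
      (logGradDeriv Φ (c s) * c' + ((sphDeriv Φ (c s) ^ 2 : ℝ) : ℂ) * conj c') s := by
  have h1 : HasDerivAt (fun s => Φ (c s)) (c' • deriv Φ (c s)) s :=
    (hΦ (c s)).hasDerivAt.scomp s hc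
  have h2 : HasDerivAt (fun s => deriv Φ (c s)) (c' • deriv (deriv Φ) (c s)) s :=
    (hΦ.complex_deriv (c s)).hasDerivAt.scomp s hc
  have hn : (‖Φ (c s)‖ : ℂ) ≠ 0 := by exact_mod_cast norm_ne_zero_iff.2 h0
  have h3 := h1.inner ℂ h2
  have h4 := h1.inner ℂ h1
  have h5 : inner ℂ (Φ (c s)) (Φ (c s)) ≠ (0 : ℂ) := by
    rw [inner_self_ne_zero]; exact h0
  have h6 := h3.div h4 h5
  have hfun : (fun s => logGrad Φ (c s)) = fun s => inner ℂ (Φ (c s)) (deriv Φ (c s)) /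
      inner ℂ (Φ (c s)) (Φ (c s)) := by
    funext s
    rw [logGrad, inner_self_eq_ofReal_norm_sq]
    push_cast
    rfl
  rw [hfun]
  refine h6.congr_deriv ?_
  have hs : ((sphDeriv Φ (c s) ^ 2 : ℝ) : ℂ) =
      ((‖deriv Φ (c s)‖ : ℂ) ^ 2 * (‖Φ (c s)‖ : ℂ) ^ 2 -
        inner ℂ (Φ (c s)) (deriv Φ (c s)) * inner ℂ (deriv Φ (c s)) (Φ (c s))) /
        (‖Φ (c s)‖ : ℂ) ^ 4 := by
    have : inner ℂ (Φ (c s)) (deriv Φ (c s)) * inner ℂ (deriv Φ (c s)) (Φ (c s)) =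
        (‖inner ℂ (Φ (c s)) (deriv Φ (c s))‖ : ℂ) ^ 2 := by
      rw [← mul_conj', inner_conj_symm]
    rw [sphDeriv_sq h0, this]
    push_cast
    rfl
  rw [hs]
  simp only [inner_smul_left, inner_smul_right, inner_self_eq_ofReal_norm_sq, logGradDeriv, logGrad]
  push_cast
  field_simp
  ring

end Regularity

end

/-! ### Stokes' theorem and Jensen's formula -/

section

theorem circleMap_zero_eq (s θ : ℝ) : circleMap 0 s θ = s * exp (θ * I) := by
  simp [circleMap]

theorem hasDerivAt_circleMap_radius (s θ : ℝ) :
    HasDerivAt (fun s : ℝ => circleMap 0 s θ) (exp (θ * I)) s := by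
  simp_rw [circleMap_zero_eq]
  simpa using (Complex.ofRealCLM.hasDerivAt (x := s)).mul_const (exp (θ * I))

theorem continuous_circleMap_uncurry : Continuous fun p : ℝ × ℝ => circleMap 0 p.1 p.2 := by
  simp_rw [circleMap_zero_eq]
  fun_prop

/-- Integration over a disc in polar coordinates. -/
theorem integral_closedBall_eq_polar {f : ℂ → ℝ} (hf : Continuous f) {t : ℝ} (ht : 0 ≤ t) :
    ∫ z in closedBall (0 : ℂ) t, f z =
      ∫ s in (0 : ℝ)..t, s * ∫ θ in (0 : ℝ)..2 * Real.pi, f (circleMap 0 s θ) := by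
  have hcm : ∀ p : ℝ × ℝ, Complex.polarCoord.symm p = circleMap 0 p.1 p.2 := by
    intro p
    rw [Complex.polarCoord_symm_apply, circleMap_zero_eq, exp_mul_I]
    push_cast
    rfl
  have hcont : Continuous fun p : ℝ × ℝ => p.1 * f (circleMap 0 p.1 p.2) :=
    continuous_fst.mul (hf.comp continuous_circleMap_uncurry)
  have h1 : ∫ z in closedBall (0 : ℂ) t, f z =
      ∫ p in Ioc (0 : ℝ) t ×ˢ Ioo (-Real.pi) Real.pi, p.1 * f (circleMap 0 p.1 p.2) := by
    rw [← MeasureTheory.integral_indicator isClosed_closedBall.measurableSet,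
      ← Complex.integral_comp_polarCoord_symm, polarCoord_target]
    have e : ∀ p ∈ Ioi (0 : ℝ) ×ˢ Ioo (-Real.pi) Real.pi,
        p.1 • (closedBall (0 : ℂ) t).indicator f (Complex.polarCoord.symm p) =
        (Iic t ×ˢ univ).indicator (fun p : ℝ × ℝ => p.1 * f (circleMap 0 p.1 p.2)) p := by
      rintro p ⟨hp, -⟩
      have hp : 0 < p.1 := hp
      rw [hcm, smul_eq_mul]
      by_cases h : p.1 ≤ t
      · rw [indicator_of_mem, indicator_of_mem]
        · simpa using h
        · simpa [abs_of_pos hp] using h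
      · rw [indicator_of_notMem, indicator_of_notMem, mul_zero]
        · simpa using h
        · simpa [abs_of_pos hp] using h
    rw [MeasureTheory.setIntegral_congr_fun (measurableSet_Ioi.prod measurableSet_Ioo) e,
      MeasureTheory.setIntegral_indicator (measurableSet_Iic.prod MeasurableSet.univ), prod_inter_prod,
      inter_univ, Ioi_inter_Iic]
  rw [h1, MeasureTheory.Measure.volume_eq_prod, MeasureTheory.setIntegral_prod,
    ← intervalIntegral.integral_of_le ht]
  · congr 1
    funext s
    rw [MeasureTheory.integral_const_mul]
    congr 1
    rw [← MeasureTheory.integral_Ioc_eq_integral_Ioo, ← intervalIntegral.integral_of_le (by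
      linarith [Real.pi_pos])]
    have hper : Function.Periodic (fun θ : ℝ => f (circleMap 0 s θ)) (2 * Real.pi) :=
      fun θ => by simp only [periodic_circleMap 0 s θ]
    have := hper.intervalIntegral_add_eq (-Real.pi) 0
    rw [zero_add, show -Real.pi + 2 * Real.pi = Real.pi by ring] at this
    exact this
  · rw [← MeasureTheory.Measure.volume_eq_prod]
    refine (hcont.continuousOn.integrableOn_compact
      ((isCompact_Icc (a := (0 : ℝ)) (b := t)).prod
        (isCompact_Icc (a := -Real.pi) (b := Real.pi)))).mono_set ?_
    exact prod_mono Ioc_subset_Icc_self Ioo_subset_Icc_self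

variable {E : Type*} [NormedAddCommGroup E] [InnerProductSpace ℂ E] [CompleteSpace E] {Φ : ℂ → E}

/-- Stokes' theorem on a disc, for the form whose exterior derivative is the pullback of the
Fubini–Study form. In polar coordinates, the radial derivative of `logGrad Φ z * z` and its angular
derivative divided by `i s` differ by `2 s ‖f'‖²`; the angular part integrates to zero over the
circle. -/
theorem integral_logGrad_circle_eq (hΦ : Differentiable ℂ Φ) (h0 : ∀ z, Φ z ≠ 0) {t : ℝ}
    (ht : 0 ≤ t) :
    ∫ θ in (0 : ℝ)..2 * Real.pi, logGrad Φ (circleMap 0 t θ) * circleMap 0 t θ =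
      ((2 * ∫ z in closedBall (0 : ℂ) t, sphDeriv Φ z ^ 2 : ℝ) : ℂ) := by
  have hγ := continuous_logGrad hΦ h0
  have hG := continuous_logGradDeriv hΦ h0
  have hS := continuous_sphDeriv hΦ h0
  have hcm := continuous_circleMap_uncurry
  set u : ℂ → ℂ := fun z => logGrad Φ z + logGradDeriv Φ z * z with hu
  have hucont : Continuous u := by fun_prop
  -- the radial derivative of `z * logGrad Φ z`
  set D : ℝ → ℝ → ℂ := fun s θ => exp (θ * I) * u (circleMap 0 s θ) +
    s * ((sphDeriv Φ (circleMap 0 s θ) ^ 2 : ℝ) : ℂ) with hD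
  have hDcont : Continuous (Function.uncurry D) := by
    have h1 : Continuous fun p : ℝ × ℝ => exp (p.2 * I) * u (circleMap 0 p.1 p.2) :=
      (by fun_prop : Continuous fun p : ℝ × ℝ => exp (p.2 * I)).mul (hucont.comp hcm)
    have h2 : Continuous fun p : ℝ × ℝ =>
        (p.1 : ℂ) * ((sphDeriv Φ (circleMap 0 p.1 p.2) ^ 2 : ℝ) : ℂ) :=
      (by fun_prop : Continuous fun p : ℝ × ℝ => (p.1 : ℂ)).mul
        (continuous_ofReal.comp ((hS.comp hcm).pow 2))
    exact h1.add h2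
  have hDs : ∀ s θ, HasDerivAt (fun s : ℝ => logGrad Φ (circleMap 0 s θ) * circleMap 0 s θ)
      (D s θ) s := by
    intro s θ
    have h1 := hasDerivAt_circleMap_radius s θ
    refine ((hasDerivAt_logGrad_comp hΦ (h0 _) h1).fun_mul h1).congr_deriv ?_
    have h2 : conj (exp (θ * I)) * exp (θ * I) = 1 := by
      rw [conj_mul', norm_exp_ofReal_mul_I]; simp
    have h3 : circleMap 0 s θ = s * exp (θ * I) := circleMap_zero_eq s θ
    simp only [hD, hu]
    generalize ((sphDeriv Φ (circleMap 0 s θ) ^ 2 : ℝ) : ℂ) = S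
    generalize logGrad Φ (circleMap 0 s θ) = γ
    generalize logGradDeriv Φ (circleMap 0 s θ) = G
    rw [h3]
    linear_combination S * s * h2
  -- the angular derivative
  have hDθ : ∀ s θ, HasDerivAt (fun θ : ℝ => logGrad Φ (circleMap 0 s θ) * circleMap 0 s θ)
      (I * s * (D s θ - 2 * s * ((sphDeriv Φ (circleMap 0 s θ) ^ 2 : ℝ) : ℂ))) θ := by
    intro s θ
    have h1 := hasDerivAt_circleMap 0 s θ
    refine ((hasDerivAt_logGrad_comp hΦ (h0 _) h1).fun_mul h1).congr_deriv ?_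
    have h2 : conj (exp (θ * I)) * exp (θ * I) = 1 := by
      rw [conj_mul', norm_exp_ofReal_mul_I]; simp
    have h3 : circleMap 0 s θ = s * exp (θ * I) := circleMap_zero_eq s θ
    simp only [hD, hu]
    generalize ((sphDeriv Φ (circleMap 0 s θ) ^ 2 : ℝ) : ℂ) = S
    generalize logGrad Φ (circleMap 0 s θ) = γ
    generalize logGradDeriv Φ (circleMap 0 s θ) = G
    rw [h3]
    simp only [map_mul, conj_ofReal, conj_I]
    linear_combination -(S * s ^ 2 * I) * h2
  have hDc1 : ∀ θ, Continuous fun s => D s θ := fun θ =>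
    hDcont.comp (by fun_prop : Continuous fun s : ℝ => (s, θ))
  have hDc2 : ∀ s, Continuous fun θ => D s θ := fun s =>
    hDcont.comp (by fun_prop : Continuous fun θ : ℝ => (s, θ))
  have hSc : ∀ s, Continuous fun θ : ℝ => ((sphDeriv Φ (circleMap 0 s θ) ^ 2 : ℝ) : ℂ) := fun s =>
    continuous_ofReal.comp ((hS.comp (continuous_circleMap 0 s)).pow 2)
  have hang : ∀ s, s ≠ 0 → ∫ θ in (0 : ℝ)..2 * Real.pi, D s θ =
      ((2 * (s * ∫ θ in (0 : ℝ)..2 * Real.pi, sphDeriv Φ (circleMap 0 s θ) ^ 2) : ℝ) : ℂ) := by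
    intro s hs
    have h1 := intervalIntegral.integral_eq_sub_of_hasDerivAt (a := 0) (b := 2 * Real.pi)
      (fun θ _ => hDθ s θ) (by
        have := hDc2 s
        have := hSc s
        exact Continuous.intervalIntegrable (by fun_prop) _ _)
    have hper := periodic_circleMap 0 s 0
    rw [zero_add] at hper
    rw [hper, sub_self, intervalIntegral.integral_const_mul, intervalIntegral.integral_sub
      ((hDc2 s).intervalIntegrable _ _) (((hSc s).const_mul _).intervalIntegrable _ _),
      intervalIntegral.integral_const_mul, mul_eq_zero] at h1
    have h2 := h1.resolve_left (mul_ne_zero I_ne_zero (by exact_mod_cast hs))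
    rw [sub_eq_zero] at h2
    rw [h2, intervalIntegral.integral_ofReal]
    push_cast
    ring
  calc ∫ θ in (0 : ℝ)..2 * Real.pi, logGrad Φ (circleMap 0 t θ) * circleMap 0 t θ
      = ∫ θ in (0 : ℝ)..2 * Real.pi, ∫ s in (0 : ℝ)..t, D s θ := by
        refine intervalIntegral.integral_congr fun θ _ => ?_
        rw [intervalIntegral.integral_eq_sub_of_hasDerivAt (fun s _ => hDs s θ)
          ((hDc1 θ).intervalIntegrable _ _)]
        simp
    _ = ∫ s in (0 : ℝ)..t, ∫ θ in (0 : ℝ)..2 * Real.pi, D s θ := by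
        rw [← MeasureTheory.intervalIntegral_intervalIntegral_swap]
        refine (hDcont.continuousOn.integrableOn_compact
          ((isCompact_uIcc (a := (0 : ℝ)) (b := t)).prod
            (isCompact_uIcc (a := (0 : ℝ)) (b := 2 * Real.pi)))).mono_set ?_
        exact prod_mono uIoc_subset_uIcc uIoc_subset_uIcc
    _ = ∫ s in (0 : ℝ)..t,
        ((2 * (s * ∫ θ in (0 : ℝ)..2 * Real.pi, sphDeriv Φ (circleMap 0 s θ) ^ 2) : ℝ) : ℂ) := by
        refine intervalIntegral.integral_congr_ae (MeasureTheory.ae_of_all _ fun s hs => hang s ?_)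
        rw [uIoc_of_le ht] at hs
        exact hs.1.ne'
    _ = _ := by
        rw [intervalIntegral.integral_ofReal, intervalIntegral.integral_const_mul,
          integral_closedBall_eq_polar (f := fun z => sphDeriv Φ z ^ 2) (hS.pow 2) ht]

/-- The mean over the circle of radius `t` of the radial derivative of `log ‖Φ‖`. -/
noncomputable def radialMean (Φ : ℂ → E) (t : ℝ) : ℝ :=
  (2 * Real.pi)⁻¹ * ∫ θ in (0 : ℝ)..2 * Real.pi, (logGrad Φ (circleMap 0 t θ) * exp (θ * I)).re

omit [CompleteSpace E] in
theorem continuous_uncurry_radial (hγ : Continuous (logGrad Φ)) :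
    Continuous fun p : ℝ × ℝ => (logGrad Φ (circleMap 0 p.1 p.2) * exp (p.2 * I)).re :=
  continuous_re.comp ((hγ.comp continuous_circleMap_uncurry).mul (by fun_prop))

theorem continuous_radialMean (hΦ : Differentiable ℂ Φ) (h0 : ∀ z, Φ z ≠ 0) :
    Continuous (radialMean Φ) := by
  refine continuous_const.mul ?_
  exact intervalIntegral.continuous_parametric_intervalIntegral_of_continuous'
    (continuous_uncurry_radial (continuous_logGrad hΦ h0)) _ _

/-- The unintegrated characteristic is the mean of the radial derivative of `log ‖Φ‖`. -/
theorem integral_sphDeriv_sq_eq_radialMean (hΦ : Differentiable ℂ Φ) (h0 : ∀ z, Φ z ≠ 0) {t : ℝ}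
    (ht : 0 < t) :
    (1 / t) * ((1 / Real.pi) * ∫ z in closedBall (0 : ℂ) t, sphDeriv Φ z ^ 2) =
      radialMean Φ t := by
  have hγ := continuous_logGrad hΦ h0
  have h := congrArg Complex.re (integral_logGrad_circle_eq hΦ h0 ht.le)
  rw [ofReal_re] at h
  have hint : IntervalIntegrable
      (fun θ : ℝ => logGrad Φ (circleMap 0 t θ) * circleMap 0 t θ) MeasureTheory.volume 0
        (2 * Real.pi) :=
    ((hγ.comp (continuous_circleMap 0 t)).mul (continuous_circleMap 0 t)).intervalIntegrable _ _
  have h2 := (Complex.reCLM.intervalIntegral_comp_comm hint)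
  simp only [reCLM_apply] at h2
  rw [← h2] at h
  have h3 : ∀ θ : ℝ, (logGrad Φ (circleMap 0 t θ) * circleMap 0 t θ).re =
      t * (logGrad Φ (circleMap 0 t θ) * exp (θ * I)).re := by
    intro θ
    rw [← re_ofReal_mul]
    congr 1
    rw [circleMap_zero_eq]
    ring
  simp_rw [h3] at h
  rw [intervalIntegral.integral_const_mul] at h
  rw [radialMean]
  have hpi := Real.pi_pos
  generalize ∫ θ in (0 : ℝ)..2 * Real.pi, (logGrad Φ (circleMap 0 t θ) * exp (θ * I)).re = A at h ⊢
  generalize ∫ z in closedBall (0 : ℂ) t, sphDeriv Φ z ^ 2 = B at h ⊢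
  field_simp
  linarith

theorem integral_sphDeriv_sq_eq_integral_radialMean (hΦ : Differentiable ℂ Φ) (h0 : ∀ z, Φ z ≠ 0)
    {r : ℝ} (hr : 0 ≤ r) :
    ∫ t in (0 : ℝ)..r, (1 / t) * ((1 / Real.pi) * ∫ z in closedBall (0 : ℂ) t, sphDeriv Φ z ^ 2) =
      ∫ t in (0 : ℝ)..r, radialMean Φ t := by
  refine intervalIntegral.integral_congr_ae (MeasureTheory.ae_of_all _ fun s hs => ?_)
  rw [uIoc_of_le hr] at hs
  exact integral_sphDeriv_sq_eq_radialMean hΦ h0 hs.1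

/-- Jensen's formula. -/
theorem integral_radialMean (hΦ : Differentiable ℂ Φ) (h0 : ∀ z, Φ z ≠ 0) (r : ℝ) :
    ∫ t in (0 : ℝ)..r, radialMean Φ t =
      Real.circleAverage (fun z => Real.log ‖Φ z‖) 0 r - Real.log ‖Φ 0‖ := by
  have hcont := continuous_uncurry_radial (continuous_logGrad hΦ h0)
  have hlog : Continuous fun z => Real.log ‖Φ z‖ :=
    hΦ.continuous.norm.log fun z => norm_ne_zero_iff.2 (h0 z)
  unfold radialMean
  rw [intervalIntegral.integral_const_mul, MeasureTheory.intervalIntegral_intervalIntegral_swap]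
  · have h1 : ∀ θ : ℝ, ∫ t in (0 : ℝ)..r, (logGrad Φ (circleMap 0 t θ) * exp (θ * I)).re =
        Real.log ‖Φ (circleMap 0 r θ)‖ - Real.log ‖Φ 0‖ := by
      intro θ
      rw [intervalIntegral.integral_eq_sub_of_hasDerivAt
        (f := fun s : ℝ => Real.log ‖Φ (circleMap 0 s θ)‖)
        (fun s _ => hasDerivAt_log_norm_comp hΦ (h0 _) (hasDerivAt_circleMap_radius s θ))
        ((hcont.comp (by fun_prop : Continuous fun s : ℝ => (s, θ))).intervalIntegrable _ _)]
      simp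
    simp_rw [h1]
    have hint : IntervalIntegrable (fun θ : ℝ => Real.log ‖Φ (circleMap 0 r θ)‖)
        MeasureTheory.volume 0 (2 * Real.pi) :=
      (hlog.comp (continuous_circleMap 0 r)).intervalIntegrable _ _
    rw [intervalIntegral.integral_sub hint intervalIntegrable_const,
      intervalIntegral.integral_const, Real.circleAverage_def]
    have := Real.pi_pos
    simp only [smul_eq_mul, sub_zero]
    field_simp
  · refine (hcont.continuousOn.integrableOn_compact
      ((isCompact_uIcc (a := (0 : ℝ)) (b := r)).prod
        (isCompact_uIcc (a := (0 : ℝ)) (b := 2 * Real.pi)))).mono_set ?_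
    exact prod_mono uIoc_subset_uIcc uIoc_subset_uIcc

end

/-! ### Homogeneous representations as curves in Euclidean space -/

section

/-- Lagrange's identity. -/
theorem sum_Ioi_norm_sub_sq {m : ℕ} (a b : Fin m → ℂ) :
    ∑ i, ∑ j ∈ Finset.Ioi i, ‖a i * b j - b i * a j‖ ^ 2 =
      (∑ i, ‖a i‖ ^ 2) * (∑ i, ‖b i‖ ^ 2) - ‖∑ i, a i * conj (b i)‖ ^ 2 := by
  have h1 := Finset.sum_sum_Ioi_add_eq_sum_sum_off_diag
    (fun i j : Fin m => ‖a i * b j - b i * a j‖ ^ 2)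
  have h2 : ∀ i : Fin m, ∑ j ∈ ({i}ᶜ : Finset (Fin m)), ‖a j * b i - b j * a i‖ ^ 2 =
      ∑ j, ‖a j * b i - b j * a i‖ ^ 2 := by
    intro i
    rw [← Finset.sum_compl_add_sum {i}, Finset.sum_singleton]
    simp [mul_comm]
  have h3 : ∀ i j : Fin m, ‖a j * b i - b j * a i‖ ^ 2 + ‖a i * b j - b i * a j‖ ^ 2 =
      2 * ‖a i * b j - b i * a j‖ ^ 2 := by
    intro i j
    rw [← norm_neg (a j * b i - b j * a i)]
    have : -(a j * b i - b j * a i) = a i * b j - b i * a j := by ring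
    rw [this]; ring
  simp_rw [h2, h3, ← Finset.mul_sum] at h1
  have h4 : ∀ x : ℂ, ((‖x‖ ^ 2 : ℝ) : ℂ) = x * conj x := fun x => by
    rw [mul_conj']; push_cast; rfl
  have h5 : ((∑ i, ∑ j, ‖a j * b i - b j * a i‖ ^ 2 : ℝ) : ℂ) =
      ((2 * ((∑ i, ‖a i‖ ^ 2) * (∑ i, ‖b i‖ ^ 2) - ‖∑ i, a i * conj (b i)‖ ^ 2) : ℝ) : ℂ) := by
    rw [ofReal_mul, ofReal_sub, ofReal_mul, ofReal_sum, ofReal_sum, ofReal_sum, h4]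
    simp_rw [ofReal_sum, h4]
    rw [map_sum, ofReal_ofNat, two_mul]
    nth_rewrite 2 [mul_comm (∑ i, a i * conj (a i))]
    rw [Finset.sum_mul_sum, Finset.sum_mul_sum, Finset.sum_mul_sum]
    have h6 : ∑ i, ∑ j, a i * conj (b i) * conj (a j * conj (b j)) =
        ∑ i, ∑ j, a j * conj (b j) * conj (a i * conj (b i)) := Finset.sum_comm
    have h7 : ∀ X Y Z W : ℂ, Z = W → X - Z + (Y - Z) = X + Y - (Z + W) := by
      intro X Y Z W h; rw [h]; ring
    rw [h7 _ _ _ _ h6]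
    rw [← Finset.sum_add_distrib, ← Finset.sum_add_distrib, ← Finset.sum_sub_distrib]
    refine Finset.sum_congr rfl fun i _ => ?_
    rw [← Finset.sum_add_distrib, ← Finset.sum_add_distrib, ← Finset.sum_sub_distrib]
    refine Finset.sum_congr rfl fun j _ => ?_
    simp only [map_sub, map_mul, conj_conj]
    ring
  have h8 := ofReal_injective h5
  linarith

/-- The homogeneous representation as a curve in Euclidean space. -/
noncomputable def vecRep {n : ℕ} (F : Fin (n + 1) → ℂ → ℂ) (z : ℂ) :
    EuclideanSpace ℂ (Fin (n + 1)) :=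
  WithLp.toLp 2 fun j => F j z

section Bridge

variable {n : ℕ} {F : Fin (n + 1) → ℂ → ℂ}

theorem hasDerivAt_vecRep (hF : ∀ j, Differentiable ℂ (F j)) (z : ℂ) :
    HasDerivAt (vecRep F) (WithLp.toLp 2 fun j => deriv (F j) z) z := by
  have h : HasDerivAt (fun z j => F j z) (fun j => deriv (F j) z) z :=
    hasDerivAt_pi.2 fun j => (hF j z).hasDerivAt
  exact ((EuclideanSpace.equiv (Fin (n + 1)) ℂ).symm.toContinuousLinearMap).hasFDerivAt.comp_hasDerivAt
    z h

theorem differentiable_vecRep (hF : ∀ j, Differentiable ℂ (F j)) : Differentiable ℂ (vecRep F) :=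
  fun z => (hasDerivAt_vecRep hF z).differentiableAt

theorem vecRep_ne_zero {f : ℂ → PSpace n} (h : IsHomogeneousRepresentation f F) (z : ℂ) :
    vecRep F z ≠ 0 := by
  obtain ⟨h0, -⟩ := h.2 z
  intro hz
  apply h0
  funext j
  have := congrArg (fun v : EuclideanSpace ℂ (Fin (n + 1)) => v j) hz
  simpa [vecRep] using this

theorem fsDeriv_eq_sphDeriv {f : ℂ → PSpace n} (h : IsHomogeneousRepresentation f F) (z : ℂ) :
    fsDeriv F z = sphDeriv (vecRep F) z := by
  have h0 := vecRep_ne_zero h z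
  have hn : ‖vecRep F z‖ ^ 2 = ∑ j, ‖F j z‖ ^ 2 := by
    rw [EuclideanSpace.norm_sq_eq]; rfl
  have hd := (hasDerivAt_vecRep h.1 z).deriv
  have hn' : ‖deriv (vecRep F) z‖ ^ 2 = ∑ j, ‖deriv (F j) z‖ ^ 2 := by
    rw [hd, EuclideanSpace.norm_sq_eq]
  have hi : inner ℂ (vecRep F z) (deriv (vecRep F) z) = ∑ j, deriv (F j) z * conj (F j z) := by
    rw [hd]
    simp [PiLp.inner_apply, vecRep]
  have hpos : 0 ≤ fsDeriv F z := by unfold fsDeriv; positivity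
  refine (pow_left_inj₀ hpos (sphDeriv_nonneg _ _) two_ne_zero).1 ?_
  rw [sphDeriv_sq h0, hn', hi, fsDeriv, div_pow, Real.sq_sqrt (by positivity),
    show ‖vecRep F z‖ ^ 4 = (‖vecRep F z‖ ^ 2) ^ 2 by ring, hn, ← sum_Ioi_norm_sub_sq]

theorem characteristic_eq {f : ℂ → PSpace n} (h : IsHomogeneousRepresentation f F) {r : ℝ}
    (hr : 0 ≤ r) : characteristic F r = ∫ t in (0 : ℝ)..r, radialMean (vecRep F) t := by
  rw [← integral_sphDeriv_sq_eq_integral_radialMean (differentiable_vecRep h.1) (vecRep_ne_zero h) hr, characteristic]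
  simp_rw [fsDeriv_eq_sphDeriv h]

theorem eventually_fsDeriv_le {σ K K' : ℝ} (h : FSGrowth F σ K) (hK : K < K') :
    ∃ r₀, 1 ≤ r₀ ∧ ∀ z, r₀ ≤ ‖z‖ → fsDeriv F z ≤ K' * ‖z‖ ^ σ := by
  have h1 := eventually_lt_of_limsup_lt (lt_of_le_of_lt h (EReal.coe_lt_coe_iff.2 hK))
  rw [← cobounded_eq_cocompact, ← comap_norm_atTop, eventually_comap, eventually_atTop] at h1
  obtain ⟨a, ha⟩ := h1
  refine ⟨max a 1, le_max_right _ _, fun z hz => ?_⟩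
  have h2 := EReal.coe_lt_coe_iff.1 (ha ‖z‖ ((le_max_left _ _).trans hz) z rfl)
  have hz1 : 0 < ‖z‖ := lt_of_lt_of_le one_pos ((le_max_right _ _).trans hz)
  have hp : 0 < ‖z‖ ^ σ := Real.rpow_pos_of_pos hz1 σ
  rw [Real.rpow_neg hz1.le, inv_mul_lt_iff₀ hp] at h2
  linarith

theorem nonneg_of_FSGrowth {σ K : ℝ} (h : FSGrowth F σ K) : 0 ≤ K := by
  by_contra! hK
  obtain ⟨r₀, hr₀, hb⟩ := eventually_fsDeriv_le h (show K < K / 2 by linarith)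
  have h1 := hb (r₀ : ℂ) (by simp [abs_of_pos (show 0 < r₀ by linarith)])
  have h2 : 0 ≤ fsDeriv F r₀ := by unfold fsDeriv; positivity
  have h3 : 0 < ‖(r₀ : ℂ)‖ ^ σ := Real.rpow_pos_of_pos (by simp; linarith) σ
  nlinarith

theorem upperGrowth_le {ρ B : ℝ}
    (h : ∀ B' : ℝ, B < B' → ∀ᶠ r in atTop, characteristic F r ≤ B' * r ^ ρ) :
    upperGrowth F ρ ≤ (B : EReal) := by
  refine le_of_forall_gt_imp_ge_of_dense fun y hy => ?_
  obtain ⟨B', hB, hB'⟩ := EReal.lt_iff_exists_real_btwn.1 hy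
  refine le_trans (limsup_le_of_le (by isBoundedDefault) ?_) hB'.le
  filter_upwards [h B' (EReal.coe_lt_coe_iff.1 hB), eventually_gt_atTop 0] with r hr hr0
  rw [EReal.coe_le_coe_iff, div_le_iff₀ (Real.rpow_pos_of_pos hr0 ρ)]
  exact hr

end Bridge

/-- The bound for the characteristic obtained by inserting the pointwise bound for the Fubini–Study
derivative in the area integral. -/
theorem exists_integral_radialMean_le {E : Type*} [NormedAddCommGroup E] [InnerProductSpace ℂ E]
    [CompleteSpace E] {Φ : ℂ → E} (hΦ : Differentiable ℂ Φ) (h0 : ∀ z, Φ z ≠ 0) {σ K r₀ : ℝ}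
    (hσ : 0 ≤ σ) (hK : 0 ≤ K) (hb : ∀ z, r₀ ≤ ‖z‖ → sphDeriv Φ z ≤ K * ‖z‖ ^ σ) :
    ∃ C, 0 ≤ C ∧ ∀ r, 1 ≤ r → ∫ t in (0 : ℝ)..r, radialMean Φ t ≤ C * r ^ (2 * σ + 2) := by
  have hS := continuous_sphDeriv hΦ h0
  obtain ⟨M, hM⟩ := ((isCompact_closedBall (0 : ℂ) r₀).image hS).bddAbove
  have hM' : ∀ z, sphDeriv Φ z ≤ max M 0 + K * ‖z‖ ^ σ := by
    intro z
    rcases le_total r₀ ‖z‖ with h | h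
    · exact (hb z h).trans (by linarith [le_max_right M 0])
    · have h1 : sphDeriv Φ z ≤ M := hM ⟨z, by simpa using h, rfl⟩
      have : 0 ≤ K * ‖z‖ ^ σ := by positivity
      linarith [le_max_left M 0]
  set M' := max M 0
  have hM0 : 0 ≤ M' := le_max_right _ _
  refine ⟨(M' + K) ^ 2, by positivity, fun r hr => ?_⟩
  have hr0 : 0 < r := by linarith
  have hrσ : 1 ≤ r ^ σ := Real.one_le_rpow hr hσ
  have hbound : ∀ t ∈ Icc 0 r, radialMean Φ t ≤ r * ((M' + K) * r ^ σ) ^ 2 := by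
    have hIoc : ∀ t ∈ Ioc 0 r, radialMean Φ t ≤ r * ((M' + K) * r ^ σ) ^ 2 := by
      intro t ht
      rw [← integral_sphDeriv_sq_eq_radialMean hΦ h0 ht.1]
      have h1 : ∫ z in closedBall (0 : ℂ) t, sphDeriv Φ z ^ 2 ≤
          ∫ _ in closedBall (0 : ℂ) t, ((M' + K) * r ^ σ) ^ 2 := by
        refine MeasureTheory.setIntegral_mono_on
          ((hS.pow 2).continuousOn.integrableOn_compact (isCompact_closedBall _ _))
          (continuous_const.continuousOn.integrableOn_compact (isCompact_closedBall _ _))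
          isClosed_closedBall.measurableSet fun z hz => ?_
        have hz' : ‖z‖ ≤ r := by
          rw [mem_closedBall, dist_zero_right] at hz; exact hz.trans ht.2
        refine pow_le_pow_left₀ (sphDeriv_nonneg _ _) ((hM' z).trans ?_) 2
        have : ‖z‖ ^ σ ≤ r ^ σ := Real.rpow_le_rpow (norm_nonneg _) hz' hσ
        nlinarith
      rw [MeasureTheory.setIntegral_const, MeasureTheory.measureReal_def, Complex.volume_closedBall,
        smul_eq_mul] at h1
      have h2 : (ENNReal.ofReal t ^ 2 * (NNReal.pi : ENNReal)).toReal = t ^ 2 * Real.pi := by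
        rw [ENNReal.toReal_mul, ENNReal.toReal_pow, ENNReal.toReal_ofReal ht.1.le]
        simp
      rw [h2] at h1
      have hpi := Real.pi_pos
      have ht0 := ht.1
      calc 1 / t * (1 / Real.pi * ∫ z in closedBall (0 : ℂ) t, sphDeriv Φ z ^ 2)
          ≤ 1 / t * (1 / Real.pi * (t ^ 2 * Real.pi * ((M' + K) * r ^ σ) ^ 2)) := by gcongr
        _ = t * ((M' + K) * r ^ σ) ^ 2 := by field_simp
        _ ≤ r * ((M' + K) * r ^ σ) ^ 2 := by gcongr; exact ht.2
    intro t ht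
    rcases ht.1.eq_or_lt with rfl | h
    · refine le_of_tendsto ((continuous_radialMean hΦ h0).tendsto 0 |>.mono_left
        (nhdsWithin_le_nhds (s := Ioi 0))) ?_
      filter_upwards [Ioc_mem_nhdsGT hr0] with t ht
      exact hIoc t ht
    · exact hIoc t ⟨h, ht.2⟩
  have h1 := intervalIntegral.integral_mono_on (a := 0) (b := r) hr0.le
    ((continuous_radialMean hΦ h0).intervalIntegrable (μ := MeasureTheory.volume) _ _)
    intervalIntegrable_const hbound
  rw [intervalIntegral.integral_const, smul_eq_mul, sub_zero] at h1
  refine h1.trans (le_of_eq ?_)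
  rw [Real.rpow_add hr0, mul_comm 2 σ, Real.rpow_mul hr0.le]
  norm_num
  ring

end

/-! ### Exponents of finite order are polynomials -/

section

/-- Liouville's theorem for functions of polynomial growth. -/
theorem exists_polynomial_of_norm_le {h : ℂ → ℂ} (hd : Differentiable ℂ h) {C N : ℝ} (hN : 0 ≤ N)
    (hb : ∀ z, 1 ≤ ‖z‖ → ‖h z‖ ≤ C * ‖z‖ ^ N) :
    ∃ p : Polynomial ℂ, (∀ z, h z = p.eval z) ∧ (p.natDegree : ℝ) ≤ N := by
  have hzero : ∀ m : ℕ, N < m → iteratedDeriv m h 0 = 0 := by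
    intro m hm
    have hlim : Tendsto (fun r : ℝ => m.factorial * C * r ^ (-(m - N))) atTop (𝓝 0) := by
      simpa using (tendsto_rpow_neg_atTop (sub_pos.2 hm)).const_mul (m.factorial * C)
    have hle : ‖iteratedDeriv m h 0‖ ≤ 0 := by
      refine ge_of_tendsto hlim ?_
      filter_upwards [eventually_ge_atTop 1] with r hr
      have hr0 : 0 < r := by linarith
      have h1 := Complex.norm_iteratedDeriv_le_of_forall_mem_sphere_norm_le (c := 0) (n := m)
        (C := C * r ^ N) hr0 hd.diffContOnCl (fun z hz => by
          rw [mem_sphere, dist_zero_right] at hz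
          have := hb z (by linarith)
          rwa [hz] at this)
      refine h1.trans (le_of_eq ?_)
      rw [neg_sub, Real.rpow_sub hr0, Real.rpow_natCast]
      ring
    exact norm_le_zero_iff.1 hle
  refine ⟨∑ m ∈ Finset.range (⌊N⌋₊ + 1), Polynomial.monomial m
    ((m.factorial : ℂ)⁻¹ * iteratedDeriv m h 0), fun z => ?_, ?_⟩
  · rw [← taylorSeries_eq_of_entire' (c := 0) (z := z) hd, tsum_eq_sum (s := Finset.range (⌊N⌋₊ + 1))]
    · simp [Polynomial.eval_finsetSum]
    · intro m hm
      rw [hzero m ((Nat.lt_floor_add_one N).trans_le (by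
        exact_mod_cast not_lt.1 (fun h => hm (Finset.mem_range.2 h))))]
      simp
  · have h1 : (∑ m ∈ Finset.range (⌊N⌋₊ + 1), Polynomial.monomial m
        ((m.factorial : ℂ)⁻¹ * iteratedDeriv m h 0)).natDegree ≤ ⌊N⌋₊ := by
      refine Polynomial.natDegree_sum_le_of_forall_le _ _ fun m hm => ?_
      exact (Polynomial.natDegree_monomial_le _).trans (Nat.lt_succ_iff.1 (Finset.mem_range.1 hm))
    exact (Nat.cast_le.2 h1).trans (Nat.floor_le hN)

/-- The real part of a holomorphic function is bounded on a disc by a multiple of the mean of its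
positive part over a larger circle. -/
theorem re_le_three_mul_circleAverage {h : ℂ → ℂ} (hd : Differentiable ℂ h) {r : ℝ} (hr : 0 < r)
    {w : ℂ} (hw : ‖w‖ ≤ r / 2) :
    (h w).re ≤ 3 * Real.circleAverage (fun z => max (h z).re 0) 0 r := by
  have hwb : w ∈ ball (0 : ℂ) r := by simp; linarith
  have hP := (hd.diffContOnCl (s := ball (0 : ℂ) r)).circleAverage_re_herglotzRieszKernel_smul' hwb
  set k : ℂ → ℝ := fun z => ((z - 0 + (w - 0)) / ((z - 0) - (w - 0))).re with hk
  have hkc : ContinuousOn k (sphere 0 |r|) := by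
    refine continuous_re.comp_continuousOn (ContinuousOn.div (by fun_prop) (by fun_prop) ?_)
    intro z hz
    rw [mem_sphere, dist_zero_right, abs_of_pos hr] at hz
    rw [sub_zero, sub_zero, sub_ne_zero]
    rintro rfl
    linarith
  have hI : CircleIntegrable (fun z => k z • h z) 0 r :=
    (ContinuousOn.smul (hkc.mono (by rw [abs_of_pos hr])) hd.continuous.continuousOn).circleIntegrable
      hr.le
  have hre := Complex.reCLM.circleAverage_comp_comm hI
  rw [hP] at hre
  simp only [reCLM_apply] at hre
  rw [← hre, ← smul_eq_mul (3 : ℝ), ← Real.circleAverage_fun_smul]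
  have hs : sphere (0 : ℂ) r = sphere 0 |r| := by rw [abs_of_pos hr]
  refine Real.circleAverage_mono ?_ ?_ fun z hz => ?_
  · refine ContinuousOn.circleIntegrable hr.le ?_
    exact continuous_re.comp_continuousOn
      (ContinuousOn.smul (hkc.mono hs.le) hd.continuous.continuousOn)
  · refine ContinuousOn.circleIntegrable hr.le (Continuous.continuousOn ?_)
    exact ((continuous_re.comp hd.continuous).max continuous_const).const_smul (3 : ℝ)
  · have hk3 : k z ≤ 3 := by
      refine (re_herglotzRieszKernel_le (hs ▸ hz) hwb).trans ?_
      rw [sub_zero, div_le_iff₀ (by linarith)]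
      linarith
    have hk0 : 0 ≤ k z := by
      have h1 := congrFun (poissonKernel_eq_re_herglotzRieszKernel (c := 0) (w := w)) z
      simp only [Function.comp_apply, herglotzRieszKernel] at h1
      rw [hk]
      simp only
      rw [← h1, poissonKernel]
      rw [← hs, mem_sphere, dist_zero_right] at hz
      rw [sub_zero, sub_zero, hz]
      have : ‖w‖ ^ 2 ≤ r ^ 2 := by gcongr; linarith
      exact div_nonneg (by linarith) (by positivity)
    simp only [Function.comp_apply, smul_eq_mul, reCLM_apply]
    change ((k z) • h z).re ≤ _
    rw [real_smul, re_ofReal_mul]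
    calc k z * (h z).re ≤ k z * max (h z).re 0 := by gcongr; exact le_max_left _ _
      _ ≤ 3 * max (h z).re 0 := by gcongr

/-- A bound for the means of the positive part of `Re h` bounds `|h|`, by the Poisson formula and the
Borel–Carathéodory theorem. -/
theorem exists_norm_le_of_circleAverage_le {h : ℂ → ℂ} (hd : Differentiable ℂ h) {C N : ℝ}
    (hN : 0 ≤ N) (hC : 0 ≤ C)
    (hb : ∀ r, 1 ≤ r → Real.circleAverage (fun z => max (h z).re 0) 0 r ≤ C * r ^ N) :
    ∃ C', ∀ z, 1 ≤ ‖z‖ → ‖h z‖ ≤ C' * ‖z‖ ^ N := by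
  refine ⟨2 * (3 * (C * 4 ^ N) + 1) + 3 * ‖h 0‖, fun z hz => ?_⟩
  set r := ‖z‖ with hr
  have hr0 : 0 < r := by linarith
  have hrN : 1 ≤ r ^ N := Real.one_le_rpow hz hN
  set M := 3 * (C * (4 * r) ^ N) + 1 with hM
  have hMpos : 0 < M := by positivity
  have h1 := borelCaratheodory (R := 2 * r) (z := z) hMpos hd.differentiableOn (fun w hw => by
    have h2 := re_le_three_mul_circleAverage hd (r := 4 * r) (by linarith) (w := w) (by
      rw [mem_ball, dist_zero_right] at hw; linarith)
    have h3 := hb (4 * r) (by linarith)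
    change (h w).re ≤ M
    linarith) (by linarith) (by rw [mem_ball, dist_zero_right]; linarith)
  rw [← hr] at h1
  have e1 : 2 * M * r / (2 * r - r) = 2 * M := by
    rw [show 2 * r - r = r by ring]; field_simp
  have e2 : ‖h 0‖ * (2 * r + r) / (2 * r - r) = 3 * ‖h 0‖ := by
    rw [show 2 * r - r = r by ring]; field_simp; ring
  rw [e1, e2] at h1
  refine h1.trans ?_
  have e3 : (4 * r) ^ N = 4 ^ N * r ^ N := Real.mul_rpow (by norm_num) hr0.le
  rw [hM, e3]
  have : ‖h 0‖ * 1 ≤ ‖h 0‖ * r ^ N := by gcongr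
  nlinarith

/-- If two linear coordinates of a curve of finite order are `1` and `exp h`, then `h` is a
polynomial whose degree is at most the order. -/
theorem exists_polynomial_of_order {E : Type*} [NormedAddCommGroup E] [InnerProductSpace ℂ E]
    [CompleteSpace E] {Φ : ℂ → E} (hΦ : Differentiable ℂ Φ) {C N : ℝ}
    (hN : 0 ≤ N) (hT : ∀ r, 1 ≤ r → ∫ t in (0 : ℝ)..r, radialMean Φ t ≤ C * r ^ N)
    {a a' : E} (ha : ‖a‖ ≤ 1) (ha' : ‖a'‖ ≤ 1) {h : ℂ → ℂ} (hd : Differentiable ℂ h)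
    (hh : ∀ z, inner ℂ a (Φ z) = exp (h z)) (h1 : ∀ z, ‖inner ℂ a' (Φ z)‖ = 1) :
    ∃ p : Polynomial ℂ, (∀ z, h z = p.eval z) ∧ (p.natDegree : ℝ) ≤ N := by
  have hle : ∀ {b : E} (z), ‖b‖ ≤ 1 → ‖inner ℂ b (Φ z)‖ ≤ ‖Φ z‖ := by
    intro b z hb
    refine (norm_inner_le_norm _ _).trans ?_
    nlinarith [norm_nonneg (Φ z)]
  have h0 : ∀ z, Φ z ≠ 0 := by
    intro z hz
    have := h1 z
    rw [hz, inner_zero_right, norm_zero] at this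
    norm_num at this
  have hmax : ∀ z, max (h z).re 0 ≤ Real.log ‖Φ z‖ := by
    intro z
    refine max_le ?_ (Real.log_nonneg (by rw [← h1 z]; exact hle z ha'))
    rw [Real.le_log_iff_exp_le (norm_pos_iff.2 (h0 z)), ← norm_exp, ← hh]
    exact hle z ha
  have hlog : Continuous fun z => Real.log ‖Φ z‖ :=
    hΦ.continuous.norm.log fun z => norm_ne_zero_iff.2 (h0 z)
  obtain ⟨C', hC'⟩ := exists_norm_le_of_circleAverage_le hd hN
    (C := max C 0 + |Real.log ‖Φ 0‖|) (by positivity) (fun r hr => by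
      have h2 : Real.circleAverage (fun z => max (h z).re 0) 0 r ≤
          Real.circleAverage (fun z => Real.log ‖Φ z‖) 0 r :=
        Real.circleAverage_mono
          (((continuous_re.comp hd.continuous).max continuous_const).continuousOn.circleIntegrable
            (by linarith))
          (hlog.continuousOn.circleIntegrable (by linarith)) fun z _ => hmax z
      have h3 := integral_radialMean hΦ h0 r
      have h4 := hT r hr
      have h5 : 1 ≤ r ^ N := Real.one_le_rpow hr hN
      have h6 : C * r ^ N ≤ max C 0 * r ^ N := by gcongr; exact le_max_left _ _
      have h7 : Real.log ‖Φ 0‖ ≤ |Real.log ‖Φ 0‖| * r ^ N :=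
        (le_abs_self _).trans (le_mul_of_one_le_right (abs_nonneg _) h5)
      linarith)
  exact exists_polynomial_of_norm_le hd hN hC'

/-- The modulus of a polynomial is asymptotically constant on large circles. -/
theorem eventually_norm_eval_le (p : Polynomial ℂ) {ε : ℝ} (hε : 0 < ε) :
    ∀ᶠ r in atTop, ∀ z w : ℂ, ‖z‖ = r → ‖w‖ = r → ‖p.eval z‖ ≤ (1 + ε) * ‖p.eval w‖ := by
  set q : ℂ → ℂ := fun z => p.leadingCoeff * z ^ p.natDegree with hq
  set η := ε / (2 + ε) with hη
  have hηpos : 0 < η := by positivity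
  have h1 := (Polynomial.isEquivalent_cobounded_leading_monomial (P := p)).isLittleO.def hηpos
  rw [← comap_norm_atTop, eventually_comap] at h1
  filter_upwards [h1] with r hr z w hz hw
  have hz1 := hr z hz
  have hw1 := hr w hw
  simp only [Pi.sub_apply] at hz1 hw1
  have hqe : ‖p.leadingCoeff * z ^ p.natDegree‖ = ‖p.leadingCoeff * w ^ p.natDegree‖ := by
    simp [hz, hw]
  set Q := ‖p.leadingCoeff * w ^ p.natDegree‖ with hQ
  rw [hqe] at hz1
  have h2 : ‖p.eval z‖ ≤ (1 + η) * Q := by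
    have := norm_sub_norm_le (p.eval z) (p.leadingCoeff * z ^ p.natDegree)
    rw [hqe] at this
    linarith
  have h3 : (1 - η) * Q ≤ ‖p.eval w‖ := by
    have := norm_sub_norm_le (p.leadingCoeff * w ^ p.natDegree) (p.eval w)
    rw [norm_sub_rev] at this
    linarith
  refine h2.trans (le_trans (le_of_eq ?_) (mul_le_mul_of_nonneg_left h3 (by positivity)))
  have : 2 + ε ≠ 0 := by positivity
  rw [hη]
  field_simp
  ring

end

/-! ### From the logarithmic gradient to the characteristic -/

section

/-- If at each point of a circle a continuous function `γ` is close to one of finitely many functions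
whose differences have almost constant modulus on the circle, then `γ` is not far from one and the
same of these functions on the whole circle. -/
theorem exists_forall_norm_sub_le_of_circle {m : ℕ} {γ : ℂ → ℂ} (hγ : Continuous γ)
    {p : Fin m → ℂ → ℂ} (hp : ∀ k, Continuous (p k)) {r A ε : ℝ} (hr : 0 ≤ r) (hε0 : 0 ≤ ε)
    (hε1 : ε ≤ 1) (hA : 0 ≤ A) (hcov : ∀ z, ‖z‖ = r → ∃ k, ‖γ z - p k z‖ ≤ A)
    (hconst : ∀ k l, ∀ z w : ℂ, ‖z‖ = r → ‖w‖ = r →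
      ‖p k z - p l z‖ ≤ (1 + ε) * ‖p k w - p l w‖) :
    ∃ k S, (∀ z, ‖z‖ = r → ‖γ z - p k z‖ ≤ S) ∧ S ≤ A + (m - 1) * (2 * A + 4 * ε * (S + A)) := by
  have hz₀ : ‖(r : ℂ)‖ = r := by simp [abs_of_nonneg hr]
  obtain ⟨k₀, hk₀⟩ := hcov r hz₀
  have hm : (1 : ℝ) ≤ m := by exact_mod_cast (Nat.succ_le_of_lt (lt_of_le_of_lt (Nat.zero_le _) k₀.2))
  set g : ℂ → ℝ := fun z => ‖γ z - p k₀ z‖ with hg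
  have hgc : Continuous g := (hγ.sub (hp k₀)).norm
  have hsph : ∀ z, z ∈ sphere (0 : ℂ) r ↔ ‖z‖ = r := fun z => by simp
  obtain ⟨w, hw, hmax⟩ := (isCompact_sphere (0 : ℂ) r).exists_isMaxOn ⟨(r : ℂ), (hsph _).2 hz₀⟩
    hgc.continuousOn
  set S := g w with hS
  have hS0 : 0 ≤ S := norm_nonneg _
  refine ⟨k₀, S, fun z hz => hmax ((hsph z).2 hz), ?_⟩
  -- the distance from `γ` to `p k₀` takes all values between `u` and `S`; where it exceeds `A`, it is
  -- close to one of the `m - 1` almost constant numbers `|p k - p k₀|`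
  have hmain : ∀ u, A < u → u < S → S - u ≤ (m - 1) * (2 * A + 4 * ε * (S + A)) := by
    intro u hAu huS
    have himg : IsPreconnected (g '' sphere 0 r) :=
      (isPreconnected_sphere (by simp) (0 : ℂ) r).image _ hgc.continuousOn
    have hsub : Icc (g r) (g w) ⊆ g '' sphere 0 r :=
      himg.ordConnected.out (mem_image_of_mem _ ((hsph _).2 hz₀)) (mem_image_of_mem _ hw)
    have hlen := sub_le_sum_of_Icc_subset (u := u) (v := S) (Finset.univ.erase k₀)
      (fun k => ‖p k r - p k₀ r‖ - (A + 2 * ε * (S + A)))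
      (fun k => ‖p k r - p k₀ r‖ + (A + 2 * ε * (S + A)))
      (fun k _ => by
        have : 0 ≤ A + 2 * ε * (S + A) := by positivity
        linarith) (fun v hv => by
        obtain ⟨z, hz, rfl⟩ := hsub ⟨hk₀.trans (hAu.le.trans hv.1), hv.2⟩
        have hz' := (hsph z).1 hz
        obtain ⟨k, hk⟩ := hcov z hz'
        have hkk : k ≠ k₀ := by
          rintro rfl
          exact absurd (hAu.trans_le hv.1) (not_lt.2 hk)
        have hDz : |g z - ‖p k z - p k₀ z‖| ≤ A := by
          refine (abs_norm_sub_norm_le _ _).trans (le_trans (le_of_eq ?_) hk)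
          congr 1
          ring
        have hzS : g z ≤ S := hv.2
        have hz1 := hconst k k₀ z r hz' hz₀
        have hz2 := hconst k k₀ r z hz₀ hz'
        rw [abs_le] at hDz
        set D := ‖p k r - p k₀ r‖
        set D' := ‖p k z - p k₀ z‖
        have hD'S : D' ≤ S + A := by linarith
        have hDS : D ≤ 2 * (S + A) := by nlinarith [norm_nonneg (p k z - p k₀ z)]
        have h3 : ε * D ≤ ε * (2 * (S + A)) := by gcongr
        have h4 : ε * D' ≤ ε * (S + A) := by gcongr
        have h5 : 0 ≤ ε * (S + A) := by positivity
        simp only [mem_iUnion]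
        exact ⟨k, Finset.mem_erase.2 ⟨hkk, Finset.mem_univ _⟩, by
          constructor <;> linarith [hDz.1, hDz.2]⟩)
    refine hlen.trans (le_of_eq ?_)
    rw [Finset.sum_congr rfl (fun k _ => (by ring :
      ‖p k r - p k₀ r‖ + (A + 2 * ε * (S + A)) - (‖p k r - p k₀ r‖ - (A + 2 * ε * (S + A))) =
        2 * A + 4 * ε * (S + A))), Finset.sum_const, Finset.card_erase_of_mem (Finset.mem_univ _),
      Finset.card_univ, Fintype.card_fin, nsmul_eq_mul, Nat.cast_sub (by exact_mod_cast hm)]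
    simp
  have hX : 0 ≤ ((m : ℝ) - 1) * (2 * A + 4 * ε * (S + A)) :=
    mul_nonneg (by linarith) (by positivity)
  by_contra! hcon
  set X := ((m : ℝ) - 1) * (2 * A + 4 * ε * (S + A))
  have := hmain ((A + (S - X)) / 2) (by linarith) (by linarith)
  linarith

variable {E : Type*} [NormedAddCommGroup E] [InnerProductSpace ℂ E] [CompleteSpace E] {Φ : ℂ → E}

/-- By Cauchy's theorem the radial mean does not change when an entire function is subtracted from
the logarithmic gradient. -/
theorem radialMean_le_of_norm_sub_le (hΦ : Differentiable ℂ Φ) (h0 : ∀ z, Φ z ≠ 0) {p : ℂ → ℂ}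
    (hp : Differentiable ℂ p) {r S : ℝ} (hr : 0 < r) (hS : ∀ z, ‖z‖ = r → ‖logGrad Φ z - p z‖ ≤ S) :
    radialMean Φ r ≤ S := by
  have hγ := continuous_logGrad hΦ h0
  have hc := continuous_circleMap 0 r
  have hzero : ∫ θ in (0 : ℝ)..2 * Real.pi, p (circleMap 0 r θ) * exp (θ * I) = 0 := by
    have h1 := (hp.diffContOnCl (s := ball (0 : ℂ) r)).circleIntegral_eq_zero hr.le
    rw [circleIntegral] at h1
    have h2 : ∀ θ : ℝ, deriv (circleMap 0 r) θ • p (circleMap 0 r θ) =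
        (r * I) * (p (circleMap 0 r θ) * exp (θ * I)) := by
      intro θ
      rw [deriv_circleMap, circleMap_zero_eq, smul_eq_mul]
      ring
    simp_rw [h2] at h1
    rw [intervalIntegral.integral_const_mul, mul_eq_zero] at h1
    exact h1.resolve_left (mul_ne_zero (by exact_mod_cast hr.ne') I_ne_zero)
  have hpe : Continuous fun θ : ℝ => p (circleMap 0 r θ) * exp (θ * I) :=
    (hp.continuous.comp hc).mul (by fun_prop)
  have hγe : Continuous fun θ : ℝ => logGrad Φ (circleMap 0 r θ) * exp (θ * I) :=
    (hγ.comp hc).mul (by fun_prop)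
  have hzero' : ∫ θ in (0 : ℝ)..2 * Real.pi, (p (circleMap 0 r θ) * exp (θ * I)).re = 0 := by
    have h3 := Complex.reCLM.intervalIntegral_comp_comm
      (hpe.intervalIntegrable (μ := MeasureTheory.volume) 0 (2 * Real.pi))
    simp only [reCLM_apply] at h3
    rw [h3, hzero, zero_re]
  have hle : ∫ θ in (0 : ℝ)..2 * Real.pi, ((logGrad Φ (circleMap 0 r θ) * exp (θ * I)).re -
      (p (circleMap 0 r θ) * exp (θ * I)).re) ≤ ∫ _ in (0 : ℝ)..2 * Real.pi, S := by
    refine intervalIntegral.integral_mono_on (by positivity)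
      (((continuous_re.comp hγe).sub (continuous_re.comp hpe)).intervalIntegrable _ _)
      intervalIntegrable_const fun θ _ => ?_
    rw [← sub_re, ← sub_mul]
    refine (re_le_norm _).trans ?_
    rw [norm_mul, norm_exp_ofReal_mul_I, mul_one]
    exact hS _ (by simp [abs_of_pos hr])
  have hγi : IntervalIntegrable (fun θ : ℝ => (logGrad Φ (circleMap 0 r θ) * exp (θ * I)).re)
      MeasureTheory.volume 0 (2 * Real.pi) := (continuous_re.comp hγe).intervalIntegrable _ _
  have hpi : IntervalIntegrable (fun θ : ℝ => (p (circleMap 0 r θ) * exp (θ * I)).re)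
      MeasureTheory.volume 0 (2 * Real.pi) := (continuous_re.comp hpe).intervalIntegrable _ _
  rw [intervalIntegral.integral_sub hγi hpi, hzero', intervalIntegral.integral_const,
    sub_zero, sub_zero, smul_eq_mul] at hle
  rw [radialMean, inv_mul_le_iff₀ (by positivity)]
  exact hle

theorem eventually_integral_le_of_eventually_le {u : ℝ → ℝ} (hu : Continuous u) {c σ B r₀ : ℝ}
    (hσ : 0 ≤ σ) (hr₀ : 0 < r₀) (hc : 0 ≤ c) (hle : ∀ t, r₀ ≤ t → u t ≤ c * t ^ σ)
    (hB : c / (σ + 1) < B) :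
    ∀ᶠ r in atTop, ∫ t in (0 : ℝ)..r, u t ≤ B * r ^ (σ + 1) := by
  have hlim : Tendsto (fun r : ℝ => (B - c / (σ + 1)) * r ^ (σ + 1)) atTop atTop :=
    (tendsto_rpow_atTop (by linarith)).const_mul_atTop (sub_pos.2 hB)
  filter_upwards [hlim.eventually_ge_atTop (∫ t in (0 : ℝ)..r₀, u t), eventually_ge_atTop r₀]
    with r h1 h2
  rw [← intervalIntegral.integral_add_adjacent_intervals (hu.intervalIntegrable 0 r₀)
    (hu.intervalIntegrable r₀ r)]
  have hpow : IntervalIntegrable (fun t : ℝ => c * t ^ σ) MeasureTheory.volume r₀ r :=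
    (intervalIntegral.intervalIntegrable_rpow' (by linarith)).const_mul c
  have h3 : ∫ t in r₀..r, u t ≤ ∫ t in r₀..r, c * t ^ σ :=
    intervalIntegral.integral_mono_on h2 (hu.intervalIntegrable _ _) hpow fun t ht => hle t ht.1
  rw [intervalIntegral.integral_const_mul, integral_rpow (Or.inl (by linarith))] at h3
  have h4 : c * ((r ^ (σ + 1) - r₀ ^ (σ + 1)) / (σ + 1)) ≤ c / (σ + 1) * r ^ (σ + 1) := by
    have : 0 ≤ r₀ ^ (σ + 1) := by positivity
    rw [mul_div_assoc', div_mul_eq_mul_div]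
    gcongr
    linarith
  linarith

/-- If far from the origin the logarithmic gradient of a curve is close to one of `m` polynomials,
then the characteristic satisfies the corresponding growth bound. On a large circle the logarithmic
gradient is close to a single polynomial, up to a factor `2 * m - 1`, and that polynomial does not
contribute to the radial mean. -/
theorem eventually_characteristic_le_of_logGrad (hΦ : Differentiable ℂ Φ) (h0 : ∀ z, Φ z ≠ 0) {m : ℕ}
    (hm : 0 < m) (p : Fin m → Polynomial ℂ) {c σ r₀ B : ℝ} (hσ : 0 ≤ σ) (hc : 0 ≤ c)
    (hcov : ∀ z, r₀ ≤ ‖z‖ → ∃ k, ‖logGrad Φ z - (p k).eval z‖ ≤ c * ‖z‖ ^ σ)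
    (hB : c * (2 * m - 1) / (σ + 1) < B) :
    ∀ᶠ r in atTop, ∫ t in (0 : ℝ)..r, radialMean Φ t ≤ B * r ^ (σ + 1) := by
  have hm' : (1 : ℝ) ≤ m := by exact_mod_cast hm
  -- room `η` between the constants, and the corresponding tolerance `ε`
  obtain ⟨η, hη, hηB⟩ : ∃ η : ℝ, 0 < η ∧ c * (2 * m - 1 + η) / (σ + 1) < B := by
    have hcont : ContinuousAt (fun η : ℝ => c * (2 * m - 1 + η) / (σ + 1)) 0 := by fun_prop
    have h1 := hcont.tendsto.eventually_lt_const (u := B) (by simpa using hB)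
    obtain ⟨η, h2, h3⟩ := ((h1.filter_mono (nhdsWithin_le_nhds (s := Ioi 0))).and
      self_mem_nhdsWithin).exists
    exact ⟨η, h3, h2⟩
  set ε := η / (2 * m + η) / (4 * m) with hε
  have hεpos : 0 < ε := by positivity
  have hεe : 4 * m * ε = η / (2 * m + η) := by rw [hε]; field_simp
  have hlt1 : η / (2 * m + η) < 1 := by
    rw [div_lt_one (by positivity)]; linarith
  have hε1 : ε ≤ 1 := by nlinarith
  have hev : ∀ᶠ r in atTop, ∀ k l, ∀ z w : ℂ, ‖z‖ = r → ‖w‖ = r →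
      ‖(p k).eval z - (p l).eval z‖ ≤ (1 + ε) * ‖(p k).eval w - (p l).eval w‖ := by
    rw [eventually_all]; intro k
    rw [eventually_all]; intro l
    filter_upwards [eventually_norm_eval_le (p k - p l) hεpos] with r hr z w hz hw
    simpa using hr z w hz hw
  obtain ⟨r₁, hr₁⟩ := eventually_atTop.1 hev
  refine eventually_integral_le_of_eventually_le (continuous_radialMean hΦ h0) hσ
    (r₀ := max (max r₀ r₁) 1) (by positivity) (c := c * (2 * m - 1 + η))
    (mul_nonneg hc (by linarith)) (fun r hr => ?_) hηB
  have hr0 : r₀ ≤ r := (le_max_left _ _).trans ((le_max_left _ _).trans hr)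
  have hr1 : r₁ ≤ r := (le_max_right _ _).trans ((le_max_left _ _).trans hr)
  have hrpos : 0 < r := lt_of_lt_of_le one_pos ((le_max_right _ _).trans hr)
  have hA : 0 ≤ c * r ^ σ := by positivity
  obtain ⟨k, S, hS, hSle⟩ := exists_forall_norm_sub_le_of_circle (continuous_logGrad hΦ h0)
    (p := fun k z => (p k).eval z) (fun k => (p k).continuous) hrpos.le hεpos.le hε1 hA
    (fun z hz => by
      obtain ⟨k, hk⟩ := hcov z (by rw [hz]; exact hr0)
      rw [hz] at hk
      exact ⟨k, hk⟩) (hr₁ r hr1)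
  refine (radialMean_le_of_norm_sub_le hΦ h0 (p k).differentiable hrpos hS).trans ?_
  set A := c * r ^ σ
  have hS0 : 0 ≤ S := (norm_nonneg _).trans (hS r (by simp [abs_of_pos hrpos]))
  have h1 : S * (1 - 4 * m * ε) ≤ A * (2 * m - 1 + 4 * m * ε) := by
    have : 0 ≤ ε * (S + A) := by positivity
    nlinarith
  have h2 : 1 - 4 * m * ε = 2 * m / (2 * m + η) := by
    rw [hεe]; field_simp; ring
  have h3 : 2 * m - 1 + 4 * m * ε = (2 * m - 1 + η) * (2 * m / (2 * m + η)) := by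
    rw [hεe]; field_simp; ring
  rw [h2, h3, ← mul_assoc] at h1
  have h4 := le_of_mul_le_mul_right h1 (by positivity)
  linarith

end

/-! ### Coordinate hyperplanes -/

section

/-- A gradient bound for `log |φ|` at a point well inside a disc, from the value at the centre. -/
theorem norm_logDeriv_le_of_center {φ : ℂ → ℂ} {c z : ℂ} {R : ℝ} (hR : 0 < R)
    (hd : DifferentiableOn ℂ φ (ball c R)) (h0 : ∀ w ∈ ball c R, φ w ≠ 0)
    (h1 : ∀ w ∈ ball c R, ‖φ w‖ < 1) (hz : dist z c ≤ R / 5) :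
    ‖deriv φ z / φ z‖ ≤ 15 / 4 * -Real.log ‖φ c‖ / R := by
  have hzb : z ∈ ball c R := by rw [mem_ball]; linarith
  have hsub : ball z (4 / 5 * R) ⊆ ball c R := ball_subset_ball' (by linarith)
  have hH := (neg_log_norm_harnack hd h0 h1 hzb).1
  have hneg : ∀ w ∈ ball c R, 0 ≤ -Real.log ‖φ w‖ := fun w hw => by
    linarith [Real.log_neg (norm_pos_iff.2 (h0 w hw)) (h1 w hw)]
  have hLz := hneg z hzb
  have hLc := hneg c (mem_ball_self hR)
  have h2 : -Real.log ‖φ z‖ * (4 / 5 * R) ≤ -Real.log ‖φ c‖ * (6 / 5 * R) := by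
    calc _ ≤ -Real.log ‖φ z‖ * (R - dist z c) := by gcongr; linarith
      _ ≤ _ := hH
      _ ≤ _ := by gcongr; linarith
  refine (norm_logDeriv_le (by positivity) (hd.mono hsub) (fun w hw => h0 w (hsub hw))
    (fun w hw => h1 w (hsub hw))).trans ?_
  rw [div_le_div_iff₀ (by positivity) hR]
  nlinarith

theorem deriv_div_div {f g : ℂ → ℂ} {z : ℂ} (hf : DifferentiableAt ℂ f z)
    (hg : DifferentiableAt ℂ g z) (hf0 : f z ≠ 0) (hg0 : g z ≠ 0) :
    deriv (fun w => f w / g w) z / (f z / g z) = deriv f z / f z - deriv g z / g z := by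
  rw [deriv_fun_div hf hg hg0]
  field_simp

/-- On a circle the ratio of two functions, the first without zeros, is bounded away from zero where
it is defined. -/
theorem exists_neg_log_norm_div_le {f g : ℂ → ℂ} (hf : Continuous f) (hg : Continuous g)
    (hf0 : ∀ z, f z ≠ 0) (ρ : ℝ) : ∃ M, ∀ w, ‖w‖ = ρ → -Real.log ‖f w / g w‖ ≤ M := by
  obtain ⟨A, hA⟩ := ((isCompact_sphere (0 : ℂ) ρ).image (f := fun w => ‖g w‖ / ‖f w‖)
    (hg.norm.div hf.norm fun z => norm_ne_zero_iff.2 (hf0 z))).bddAbove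
  refine ⟨A, fun w hw => ?_⟩
  have h1 : ‖g w‖ / ‖f w‖ ≤ A := hA ⟨w, by simpa using hw, rfl⟩
  rw [← Real.log_inv, norm_div, inv_div]
  refine (Real.log_le_self (by positivity)).trans h1

section Coordinates

variable {n : ℕ} {F : Fin (n + 1) → ℂ → ℂ}

theorem inner_single_vecRep (k : Fin (n + 1)) (z : ℂ) :
    inner ℂ (EuclideanSpace.single k (1 : ℂ)) (vecRep F z) = F k z := by
  simp [EuclideanSpace.inner_single_left, vecRep]

theorem norm_vecRep_le {k : Fin (n + 1)} {z : ℂ} (h : ∀ j, ‖F j z‖ ≤ ‖F k z‖) :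
    ‖vecRep F z‖ ≤ Real.sqrt (n + 1) * ‖F k z‖ := by
  refine le_of_sq_le_sq ?_ (by positivity)
  rw [mul_pow, Real.sq_sqrt (by positivity), EuclideanSpace.norm_sq_eq]
  calc ∑ j, ‖vecRep F z j‖ ^ 2 ≤ ∑ _j : Fin (n + 1), ‖F k z‖ ^ 2 :=
        Finset.sum_le_sum fun j _ => pow_le_pow_left₀ (norm_nonneg _) (h j) 2
    _ = (n + 1) * ‖F k z‖ ^ 2 := by simp

/-- The logarithmic derivative of a dominant coordinate is close to the logarithmic gradient. -/
theorem norm_logDeriv_sub_logGrad_le_of_dominant (hF : ∀ j, Differentiable ℂ (F j))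
    {k : Fin (n + 1)} {z : ℂ} (h : ∀ j, ‖F j z‖ ≤ ‖F k z‖) (h0 : F k z ≠ 0) :
    ‖deriv (F k) z / F k z - logGrad (vecRep F) z‖ ≤
      Real.sqrt (n + 1) * sphDeriv (vecRep F) z := by
  have h1 := norm_logDeriv_inner_sub_logGrad_le (Φ := vecRep F) (z := z)
    (a := EuclideanSpace.single k (1 : ℂ)) (by simp) (differentiable_vecRep hF z)
    (by rwa [inner_single_vecRep])
  simp_rw [inner_single_vecRep] at h1
  refine h1.trans ?_
  have hpos : 0 < ‖F k z‖ := norm_pos_iff.2 h0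
  rw [div_le_iff₀ hpos]
  have h2 := norm_vecRep_le h
  have h3 := sphDeriv_nonneg (vecRep F) z
  calc sphDeriv (vecRep F) z * ‖vecRep F z‖ ≤ sphDeriv (vecRep F) z *
        (Real.sqrt (n + 1) * ‖F k z‖) := by gcongr
    _ = _ := by ring

/-- If all coordinates but one have no zeros, then far from the origin the logarithmic gradient is
close to the logarithmic derivative of one of these coordinates.

Where the exceptional coordinate dominates, `-log` of the quotients of the other coordinates by it are
positive harmonic functions. On a maximal disc without ties one of them vanishes at a boundary point,
with a slope controlled by the Fubini–Study derivative, so that Hopf's lemma bounds it inside. -/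
theorem exists_logGrad_close_coordinate (hn : 1 ≤ n) (hF : ∀ j, Differentiable ℂ (F j))
    (h0 : ∀ (j : Fin n) z, F j.succ z ≠ 0) {σ K r₀ : ℝ} (hσ : 0 ≤ σ) (hK : 0 < K) (hr₀ : 1 ≤ r₀)
    (hb : ∀ z, r₀ ≤ ‖z‖ → sphDeriv (vecRep F) z ≤ K * ‖z‖ ^ σ) :
    ∃ r₁, ∀ z, r₁ ≤ ‖z‖ → ∃ k : Fin n,
      ‖logGrad (vecRep F) z - deriv (F k.succ) z / F k.succ z‖ ≤
        16 * Real.sqrt (n + 1) * 2 ^ σ * K * ‖z‖ ^ σ := by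
  set s := Real.sqrt (n + 1) with hs
  have hs0 : 0 < s := by positivity
  have h2σ : (1 : ℝ) ≤ 2 ^ σ := Real.one_le_rpow (by norm_num) hσ
  -- the set where the first coordinate does not dominate
  set S : Set ℂ := ⋃ k : Fin n, {z | ‖F 0 z‖ ≤ ‖F k.succ z‖} with hSdef
  have hScl : IsClosed S :=
    isClosed_iUnion_of_finite fun k => isClosed_le (hF 0).continuous.norm (hF k.succ).continuous.norm
  have hnotS : ∀ z, z ∉ S → ∀ k : Fin n, ‖F k.succ z‖ < ‖F 0 z‖ := by
    intro z hz k
    by_contra! h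
    exact hz (mem_iUnion.2 ⟨k, h⟩)
  let k₀ : Fin n := ⟨0, hn⟩
  have hF0 : ∀ z, z ∉ S → F 0 z ≠ 0 := fun z hz =>
    norm_pos_iff.1 ((norm_nonneg _).trans_lt (hnotS z hz k₀))
  set φ : Fin n → ℂ → ℂ := fun k z => F k.succ z / F 0 z with hφ
  have hφd : ∀ k z, F 0 z ≠ 0 → DifferentiableAt ℂ (φ k) z := fun k z hz =>
    (hF k.succ z).div (hF 0 z) hz
  have hφ1 : ∀ k z, z ∉ S → φ k z ≠ 0 ∧ ‖φ k z‖ < 1 := by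
    intro k z hz
    refine ⟨div_ne_zero (h0 k z) (hF0 z hz), ?_⟩
    rw [hφ]
    simp only [norm_div]
    rw [div_lt_one (norm_pos_iff.2 (hF0 z hz))]
    exact hnotS z hz k
  obtain ⟨ρ, hρ, hsec⟩ := norm_logDeriv_le_of_sector (r₀ := r₀) (by linarith)
  obtain ⟨M, hM⟩ := exists_neg_log_norm_div_le (hF k₀.succ).continuous (hF 0).continuous (h0 k₀) ρ
  obtain ⟨r₁, hr₁⟩ := hsec M (s * K) (by positivity)
  refine ⟨max (7 * r₀) r₁, fun z hz => ?_⟩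
  have hz7 : 7 * r₀ ≤ ‖z‖ := (le_max_left _ _).trans hz
  have hz1 : r₁ ≤ ‖z‖ := (le_max_right _ _).trans hz
  have hzpos : 0 < ‖z‖ := by linarith
  have hzσ : 1 ≤ ‖z‖ ^ σ := Real.one_le_rpow (by linarith) hσ
  have hbz := hb z (by linarith)
  have hKz : 0 ≤ K * ‖z‖ ^ σ := by positivity
  have hX : s * (K * ‖z‖ ^ σ) ≤ s * (2 ^ σ * (K * ‖z‖ ^ σ)) := by
    exact mul_le_mul_of_nonneg_left (le_mul_of_one_le_left hKz h2σ) hs0.le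
  have hsbz : s * sphDeriv (vecRep F) z ≤ s * (K * ‖z‖ ^ σ) := by gcongr
  have hX0 : 0 ≤ s * (2 ^ σ * (K * ‖z‖ ^ σ)) := by positivity
  by_cases hzS : z ∈ S
  · -- a dominant coordinate without zeros
    obtain ⟨k, -, hk⟩ := Finset.exists_max_image Finset.univ (fun k : Fin n => ‖F k.succ z‖)
      ⟨k₀, Finset.mem_univ _⟩
    obtain ⟨l, hl⟩ := mem_iUnion.1 hzS
    have hdom : ∀ j, ‖F j z‖ ≤ ‖F k.succ z‖ := by
      intro j
      refine Fin.cases ?_ (fun i => hk i (Finset.mem_univ _)) j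
      exact le_trans hl (hk l (Finset.mem_univ _))
    refine ⟨k, ?_⟩
    rw [norm_sub_rev]
    have := norm_logDeriv_sub_logGrad_le_of_dominant hF hdom (h0 k z)
    rw [← hs] at this
    linarith
  have hdomz : ∀ j, ‖F j z‖ ≤ ‖F 0 z‖ := fun j => by
    refine Fin.cases le_rfl (fun i => (hnotS z hzS i).le) j
  have hγ0 := norm_logDeriv_sub_logGrad_le_of_dominant hF hdomz (hF0 z hzS)
  -- it remains to compare with the logarithmic derivative of the first coordinate
  suffices hsuff : ∃ k, ‖deriv (φ k) z / φ k z‖ ≤ 15 * (s * (2 ^ σ * (K * ‖z‖ ^ σ))) by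
    obtain ⟨k, hk⟩ := hsuff
    refine ⟨k, ?_⟩
    rw [hφ] at hk
    simp only at hk
    rw [deriv_div_div (hF k.succ z) (hF 0 z) (h0 k z) (hF0 z hzS)] at hk
    have h3 : ‖logGrad (vecRep F) z - deriv (F k.succ) z / F k.succ z‖ ≤
        ‖deriv (F 0) z / F 0 z - logGrad (vecRep F) z‖ +
          ‖deriv (F k.succ) z / F k.succ z - deriv (F 0) z / F 0 z‖ := by
      rw [norm_sub_rev, add_comm ‖deriv (F 0) z / F 0 z - logGrad (vecRep F) z‖]
      simpa using norm_add_le (deriv (F k.succ) z / F k.succ z - deriv (F 0) z / F 0 z)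
        (deriv (F 0) z / F 0 z - logGrad (vecRep F) z)
    rw [← hs] at hγ0
    linarith
  rcases exists_touching_ball_or_sector hScl (by linarith) hzS hz7 with
    ⟨c, R, w, hR, hdisj, hwS, hwc, hw1, hw2, hzc, -, -, -⟩ | hsect
  · have hball : ∀ y ∈ ball c R, y ∉ S := fun y hy => disjoint_left.1 hdisj hy
    -- at the touching point two coordinates tie
    have hdomw : ∀ k : Fin n, ‖F k.succ w‖ ≤ ‖F 0 w‖ := by
      intro k
      have hcl : w ∈ closure (ball c R) := by
        rw [closure_ball c hR.ne']; exact hwc.le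
      exact le_on_closure (fun y hy => (hnotS y (hball y hy) k).le)
        (hF k.succ).continuous.norm.continuousOn (hF 0).continuous.norm.continuousOn hcl
    obtain ⟨k, hk⟩ := mem_iUnion.1 hwS
    have htie : ‖F k.succ w‖ = ‖F 0 w‖ := le_antisymm (hdomw k) hk
    have hF0w : F 0 w ≠ 0 := by
      rw [← norm_pos_iff, ← htie]; exact norm_pos_iff.2 (h0 k w)
    have hdom1 : ∀ j, ‖F j w‖ ≤ ‖F 0 w‖ := fun j => Fin.cases le_rfl (fun i => hdomw i) j
    have hdom2 : ∀ j, ‖F j w‖ ≤ ‖F k.succ w‖ := fun j => htie ▸ hdom1 j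
    have hg1 := norm_logDeriv_sub_logGrad_le_of_dominant hF hdom1 hF0w
    have hg2 := norm_logDeriv_sub_logGrad_le_of_dominant hF hdom2 (h0 k w)
    have hφw : ‖φ k w‖ = 1 := by
      rw [hφ]
      simp only [norm_div]
      rw [htie, div_self (norm_ne_zero_iff.2 hF0w)]
    have hslope : ‖deriv (φ k) w‖ ≤ 2 * (s * sphDeriv (vecRep F) w) := by
      have h3 : ‖deriv (φ k) w‖ = ‖deriv (φ k) w / φ k w‖ := by rw [norm_div, hφw, div_one]
      rw [h3, hφ]
      simp only
      rw [deriv_div_div (hF k.succ w) (hF 0 w) (h0 k w) hF0w]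
      have h4 := norm_sub_le (deriv (F k.succ) w / F k.succ w - logGrad (vecRep F) w)
        (deriv (F 0) w / F 0 w - logGrad (vecRep F) w)
      rw [sub_sub_sub_cancel_right] at h4
      linarith
    have hfsw : sphDeriv (vecRep F) w ≤ 2 ^ σ * (K * ‖z‖ ^ σ) := by
      calc sphDeriv (vecRep F) w ≤ K * ‖w‖ ^ σ := hb w hw1
        _ ≤ K * (2 * ‖z‖) ^ σ := by gcongr
        _ = 2 ^ σ * (K * ‖z‖ ^ σ) := by
            rw [Real.mul_rpow (by norm_num) hzpos.le]; ring
    have hdon : DifferentiableOn ℂ (φ k) (ball c R) := fun y hy =>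
      (hφd k y (hF0 y (hball y hy))).differentiableWithinAt
    have hHopf := neg_log_norm_center_le hR hdon (fun y hy => (hφ1 k y (hball y hy)).1)
      (fun y hy => (hφ1 k y (hball y hy)).2) hwc (hφd k w hF0w) hφw
    have hgrad := norm_logDeriv_le_of_center hR hdon (fun y hy => (hφ1 k y (hball y hy)).1)
      (fun y hy => (hφ1 k y (hball y hy)).2) hzc
    refine ⟨k, hgrad.trans ?_⟩
    rw [div_le_iff₀ hR]
    have h5 : ‖deriv (φ k) w‖ ≤ 2 * (s * (2 ^ σ * (K * ‖z‖ ^ σ))) := hslope.trans (by gcongr)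
    nlinarith
  · refine ⟨k₀, (hr₁ z (φ k₀) hz1 (fun θ hθ => ?_) hM).trans ?_⟩
    · have hball : ∀ y ∈ ball (exp (θ * I) * z) (‖z‖ - r₀), y ∉ S := fun y hy =>
        disjoint_left.1 (hsect θ hθ) hy
      exact ⟨fun y hy => (hφd k₀ y (hF0 y (hball y hy))).differentiableWithinAt,
        fun y hy => hφ1 k₀ y (hball y hy)⟩
    · have : s * K * 1 ≤ s * K * ‖z‖ ^ σ := by gcongr
      linarith

theorem exists_forall_le_of_eventually_le {u : ℝ → ℝ} (hu : Continuous u) {C N : ℝ} (hN : 0 ≤ N)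
    (h : ∀ᶠ r in atTop, u r ≤ C * r ^ N) : ∃ C', ∀ r, 1 ≤ r → u r ≤ C' * r ^ N := by
  obtain ⟨a, ha⟩ := eventually_atTop.1 h
  obtain ⟨M, hM⟩ := ((isCompact_Icc (a := (1 : ℝ)) (b := a)).image hu).bddAbove
  refine ⟨max C (max M 0), fun r hr => ?_⟩
  have hrN : 1 ≤ r ^ N := Real.one_le_rpow hr hN
  rcases le_total a r with h1 | h1
  · refine (ha r h1).trans ?_
    gcongr
    exact le_max_left _ _
  · have h2 : u r ≤ M := hM ⟨r, ⟨hr, h1⟩, rfl⟩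
    have h3 : M ≤ max C (max M 0) := (le_max_left _ _).trans (le_max_right _ _)
    have h4 : 0 ≤ max C (max M 0) := (le_max_right _ _).trans (le_max_right _ _)
    exact h2.trans (h3.trans (le_mul_of_one_le_right h4 hrN))

/-- Growth of a curve omitting coordinate hyperplanes, with one of the zero-free coordinates
normalised to `1`. The other zero-free coordinates are exponentials of polynomials of degree at
most `σ + 1`. -/
theorem eventually_characteristic_le_of_coordinates (hF : ∀ j, Differentiable ℂ (F j))
    {h : Fin n → ℂ → ℂ} (hh : ∀ k, Differentiable ℂ (h k))
    (hFh : ∀ (k : Fin n) z, F k.succ z = exp (h k z)) {k₁ : Fin n} (hk₁ : ∀ z, h k₁ z = 0)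
    {σ K r₀ : ℝ} (hσ : 0 ≤ σ) (hK : 0 < K) (hr₀ : 1 ≤ r₀)
    (hb : ∀ z, r₀ ≤ ‖z‖ → sphDeriv (vecRep F) z ≤ K * ‖z‖ ^ σ) :
    (∀ B, 16 * Real.sqrt (n + 1) * 2 ^ σ * K * (2 * n - 1) / (σ + 1) < B →
      ∀ᶠ r in atTop, ∫ t in (0 : ℝ)..r, radialMean (vecRep F) t ≤ B * r ^ (σ + 1)) ∧
    ∀ k, ∃ p : Polynomial ℂ, (∀ z, h k z = p.eval z) ∧ (p.natDegree : ℝ) ≤ σ + 1 := by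
  have hn : 0 < n := Fin.pos k₁
  have hΦ := differentiable_vecRep hF
  have h0 : ∀ (j : Fin n) z, F j.succ z ≠ 0 := fun j z => by rw [hFh]; exact exp_ne_zero _
  have hΦ0 : ∀ z, vecRep F z ≠ 0 := by
    intro z hz
    apply h0 k₁ z
    rw [← inner_single_vecRep (F := F), hz, inner_zero_right]
  have hpoly : ∀ {C N : ℝ}, 0 ≤ N →
      (∀ r, 1 ≤ r → ∫ t in (0 : ℝ)..r, radialMean (vecRep F) t ≤ C * r ^ N) →
      ∀ k, ∃ p : Polynomial ℂ, (∀ z, h k z = p.eval z) ∧ (p.natDegree : ℝ) ≤ N := by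
    intro C N hN hT k
    exact exists_polynomial_of_order hΦ hN hT (a := EuclideanSpace.single k.succ 1)
      (a' := EuclideanSpace.single k₁.succ 1) (by simp) (by simp) (hh k)
      (fun z => by rw [inner_single_vecRep, hFh])
      (fun z => by rw [inner_single_vecRep, hFh, hk₁]; simp)
  obtain ⟨C, -, hC⟩ := exists_integral_radialMean_le hΦ hΦ0 hσ hK.le hb
  choose p hp _ using hpoly (by positivity) hC
  obtain ⟨r₁, hr₁⟩ := exists_logGrad_close_coordinate hn hF h0 hσ hK hr₀ hb
  have hmain : ∀ B, 16 * Real.sqrt (n + 1) * 2 ^ σ * K * (2 * n - 1) / (σ + 1) < B →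
      ∀ᶠ r in atTop, ∫ t in (0 : ℝ)..r, radialMean (vecRep F) t ≤ B * r ^ (σ + 1) := by
    intro B hB
    refine eventually_characteristic_le_of_logGrad (r₀ := r₁) hΦ hΦ0 hn (fun k => (p k).derivative) hσ
      (by positivity) (fun z hz => ?_) hB
    obtain ⟨k, hk⟩ := hr₁ z hz
    refine ⟨k, ?_⟩
    convert hk using 3
    have e : F k.succ = fun z => exp ((p k).eval z) := by
      funext z; rw [hFh, hp]
    have hd : HasDerivAt (F k.succ) (exp ((p k).eval z) * (p k).derivative.eval z) z := by
      rw [e]; exact ((p k).hasDerivAt z).cexp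
    rw [hd.deriv, hFh, hp, mul_div_cancel_left₀ _ (exp_ne_zero _)]
  refine ⟨hmain, ?_⟩
  obtain ⟨C', hC'⟩ := exists_forall_le_of_eventually_le (N := σ + 1)
    (intervalIntegral.continuous_primitive (fun a b =>
      (continuous_radialMean hΦ hΦ0).intervalIntegrable a b) 0) (by positivity)
    (hmain _ (lt_add_one _))
  exact hpoly (by positivity) hC'

end Coordinates

end

/-! ### Changes of coordinates and linearisation of the exponents -/

section

section Comparison

variable {E E' : Type*} [NormedAddCommGroup E] [InnerProductSpace ℂ E] [NormedAddCommGroup E']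
  [InnerProductSpace ℂ E'] {Φ : ℂ → E}

/-- The multiple of `Φ` nearest to `Φ'` is the one with coefficient `logGrad Φ`. -/
theorem norm_deriv_sub_logGrad_smul_le {z : ℂ} (h : Φ z ≠ 0) (c : ℂ) :
    ‖deriv Φ z - logGrad Φ z • Φ z‖ ≤ ‖deriv Φ z - c • Φ z‖ := by
  have e : deriv Φ z - c • Φ z = (deriv Φ z - logGrad Φ z • Φ z) + (logGrad Φ z - c) • Φ z := by
    rw [sub_smul]; abel
  have hpyth := norm_add_sq_eq_norm_sq_add_norm_sq_of_inner_eq_zero (𝕜 := ℂ)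
    (deriv Φ z - logGrad Φ z • Φ z) ((logGrad Φ z - c) • Φ z) (by
      rw [inner_smul_right, ← inner_conj_symm, inner_deriv_sub_logGrad_smul h, map_zero, mul_zero])
  rw [e]
  refine le_of_sq_le_sq ?_ (norm_nonneg _)
  rw [sq, sq, hpyth]
  nlinarith [norm_nonneg ((logGrad Φ z - c) • Φ z)]

/-- A linear change of coordinates distorts the Fubini–Study derivative by a bounded factor. -/
theorem sphDeriv_comp_le {Ψ : ℂ → E'} (M : E →L[ℂ] E') (M' : E' →L[ℂ] E) {z : ℂ}
    (hΦ : DifferentiableAt ℂ Φ z) (h0 : Φ z ≠ 0) (hM : ∀ z, Ψ z = M (Φ z))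
    (hM' : ∀ z, Φ z = M' (Ψ z)) : sphDeriv Ψ z ≤ ‖M‖ * ‖M'‖ * sphDeriv Φ z := by
  have hΨ0 : Ψ z ≠ 0 := by
    intro h
    apply h0
    rw [hM', h, map_zero]
  have hder : deriv Ψ z = M (deriv Φ z) := by
    have : HasDerivAt (fun w => M (Φ w)) (M (deriv Φ z)) z :=
      M.hasFDerivAt.comp_hasDerivAt z hΦ.hasDerivAt
    rw [show Ψ = fun w => M (Φ w) from funext hM]
    exact this.deriv
  have h1 := norm_deriv_sub_logGrad_smul_le hΨ0 (logGrad Φ z)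
  have e : deriv Ψ z - logGrad Φ z • Ψ z = M (deriv Φ z - logGrad Φ z • Φ z) := by
    rw [hder, hM z, map_sub, map_smul]
  rw [e] at h1
  have h2 := M.le_opNorm (deriv Φ z - logGrad Φ z • Φ z)
  rw [norm_deriv_sub_logGrad_smul h0] at h2
  have h3 : ‖Φ z‖ ≤ ‖M'‖ * ‖Ψ z‖ := by
    conv_lhs => rw [hM' z]
    exact M'.le_opNorm _
  have h4 := sphDeriv_nonneg Φ z
  rw [sphDeriv, div_le_iff₀ (norm_pos_iff.2 hΨ0)]
  calc ‖deriv Ψ z - logGrad Ψ z • Ψ z‖ ≤ ‖M‖ * (sphDeriv Φ z * ‖Φ z‖) := h1.trans h2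
    _ ≤ ‖M‖ * (sphDeriv Φ z * (‖M'‖ * ‖Ψ z‖)) := by gcongr
    _ = _ := by ring

/-- The squared cosine of the Fubini–Study distance to a fixed point is Lipschitz along the
curve. -/
theorem abs_sq_inner_div_sub_le [CompleteSpace E] (hΦ : Differentiable ℂ Φ) (h0 : ∀ z, Φ z ≠ 0)
    {a : E} (ha : ‖a‖ = 1) {s : Set ℂ} (hs : Convex ℝ s) {κ : ℝ} (hκ : ∀ z ∈ s, sphDeriv Φ z ≤ κ)
    {z w : ℂ} (hz : z ∈ s) (hw : w ∈ s) :
    |‖inner ℂ a (Φ w)‖ ^ 2 / ‖Φ w‖ ^ 2 - ‖inner ℂ a (Φ z)‖ ^ 2 / ‖Φ z‖ ^ 2| ≤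
      2 * κ * ‖w - z‖ := by
  set c : ℝ → ℂ := fun t => z + t * (w - z) with hc
  have hcd : ∀ t, HasDerivAt (fun t : ℝ => z + (t : ℂ) * (w - z)) (w - z) t := fun t => by
    simpa using ((Complex.ofRealCLM.hasDerivAt (x := t)).mul_const (w - z)).const_add z
  have hcs : ∀ t ∈ Icc (0 : ℝ) 1, c t ∈ s := by
    intro t ht
    have := hs.add_smul_sub_mem hz hw ht
    simpa [hc, real_smul] using this
  set b : ℂ → ℂ := fun w => inner ℂ a (Φ w) with hb
  have hbd : ∀ w, HasDerivAt b (inner ℂ a (deriv Φ w)) w := fun w =>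
    (innerSL ℂ a).hasFDerivAt.comp_hasDerivAt w (hΦ w).hasDerivAt
  set u : ℝ → ℝ := fun t => ‖b (c t)‖ ^ 2 * Real.exp (-(2 * Real.log ‖Φ (c t)‖)) with hu
  have hexp : ∀ w, Real.exp (-(2 * Real.log ‖Φ w‖)) = (‖Φ w‖ ^ 2)⁻¹ := by
    intro w
    have hp : 0 < ‖Φ w‖ := norm_pos_iff.2 (h0 w)
    rw [Real.exp_neg, two_mul, Real.exp_add, Real.exp_log hp, sq]
  have hud : ∀ t, HasDerivAt u (2 * (conj (b (c t)) *
      (inner ℂ a (deriv Φ (c t) - logGrad Φ (c t) • Φ (c t))) * (w - z)).re * (‖Φ (c t)‖ ^ 2)⁻¹) t := by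
    intro t
    have h1 : HasDerivAt (fun t => b (c t)) ((w - z) * inner ℂ a (deriv Φ (c t))) t := by
      have := (hbd (c t)).scomp t (hcd t)
      simpa [Function.comp_def] using this
    have h2 := ((hasDerivAt_log_norm_comp hΦ (h0 (c t)) (hcd t)).const_mul 2).fun_neg.exp
    refine (h1.norm_sq.fun_mul h2).congr_deriv ?_
    rw [hexp, inner_sub_right, inner_smul_right]
    have h3 : inner ℝ (b (c t)) ((w - z) * inner ℂ a (deriv Φ (c t))) =
        (conj (b (c t)) * ((w - z) * inner ℂ a (deriv Φ (c t)))).re := by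
      rw [Complex.inner]
      congr 1
      ring
    have h4 : ‖b (c t)‖ ^ 2 * (logGrad Φ (c t) * (w - z)).re =
        (conj (b (c t)) * (logGrad Φ (c t) * b (c t)) * (w - z)).re := by
      have : conj (b (c t)) * (logGrad Φ (c t) * b (c t)) * (w - z) =
          ((‖b (c t)‖ ^ 2 : ℝ) : ℂ) * (logGrad Φ (c t) * (w - z)) := by
        push_cast
        rw [← conj_mul']
        ring
      rw [this, re_ofReal_mul]
    rw [h3]
    have h5 : (conj (b (c t)) * (inner ℂ a (deriv Φ (c t)) - logGrad Φ (c t) * b (c t)) *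
        (w - z)).re = (conj (b (c t)) * ((w - z) * inner ℂ a (deriv Φ (c t)))).re -
        ‖b (c t)‖ ^ 2 * (logGrad Φ (c t) * (w - z)).re := by
      rw [h4, ← sub_re]
      congr 1
      ring
    change _ = 2 * (conj (b (c t)) * (inner ℂ a (deriv Φ (c t)) - logGrad Φ (c t) * b (c t)) *
        (w - z)).re * (‖Φ (c t)‖ ^ 2)⁻¹
    rw [h5]
    ring
  have hbound : ∀ t ∈ Ico (0 : ℝ) 1, ‖2 * (conj (b (c t)) *
      (inner ℂ a (deriv Φ (c t) - logGrad Φ (c t) • Φ (c t))) * (w - z)).re *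
        (‖Φ (c t)‖ ^ 2)⁻¹‖ ≤ 2 * κ * ‖w - z‖ := by
    intro t ht
    have hp : 0 < ‖Φ (c t)‖ := norm_pos_iff.2 (h0 _)
    have h1 : ‖b (c t)‖ ≤ ‖Φ (c t)‖ := by
      have := norm_inner_le_norm (𝕜 := ℂ) a (Φ (c t))
      rwa [ha, one_mul] at this
    have h2 : ‖inner ℂ a (deriv Φ (c t) - logGrad Φ (c t) • Φ (c t))‖ ≤ κ * ‖Φ (c t)‖ := by
      have := norm_inner_le_norm (𝕜 := ℂ) a (deriv Φ (c t) - logGrad Φ (c t) • Φ (c t))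
      rw [ha, one_mul, norm_deriv_sub_logGrad_smul (h0 _)] at this
      refine this.trans ?_
      gcongr
      exact hκ _ (hcs t ⟨ht.1, ht.2.le⟩)
    have hκ0 : 0 ≤ κ := (sphDeriv_nonneg Φ z).trans (hκ z hz)
    rw [norm_mul, norm_mul, Real.norm_eq_abs, Real.norm_eq_abs, Real.norm_eq_abs, abs_of_pos
      (show (0 : ℝ) < 2 by norm_num), abs_of_pos (show 0 < (‖Φ (c t)‖ ^ 2)⁻¹ by positivity)]
    have h3 := abs_re_le_norm (conj (b (c t)) *
      (inner ℂ a (deriv Φ (c t) - logGrad Φ (c t) • Φ (c t))) * (w - z))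
    rw [norm_mul, norm_mul, RCLike.norm_conj] at h3
    rw [← div_eq_mul_inv, div_le_iff₀ (by positivity)]
    calc _ ≤ 2 * (‖b (c t)‖ * ‖inner ℂ a (deriv Φ (c t) - logGrad Φ (c t) • Φ (c t))‖ *
          ‖w - z‖) := by gcongr
      _ ≤ 2 * (‖Φ (c t)‖ * (κ * ‖Φ (c t)‖) * ‖w - z‖) := by gcongr
      _ = _ := by ring
  have := norm_image_sub_le_of_norm_deriv_le_segment_01' (f := u)
    (fun t _ => (hud t).hasDerivWithinAt) hbound
  have hc0 : c 0 = z := by simp [hc]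
  have hc1 : c 1 = w := by simp [hc]
  rw [hu] at this
  simp only [hexp, hc0, hc1, ← div_eq_mul_inv] at this
  exact this

end Comparison

/-- A basis adapted to linearly independent forms `l k`: a unit vector in their common kernel,
together with the dual vectors `P k` orthogonal to it. -/
theorem exists_adapted_basis {n : ℕ} {V : Type*} [NormedAddCommGroup V] [InnerProductSpace ℂ V]
    [FiniteDimensional ℂ V] (hV : Module.finrank ℂ V = n + 1) (l : Fin n → Module.Dual ℂ V)
    (hl : LinearIndependent ℂ l) :
    ∃ (e : V) (P : Fin n → V), ‖e‖ = 1 ∧ (∀ k, inner ℂ e (P k) = 0) ∧ (∀ k, l k e = 0) ∧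
      (∀ j k, l j (P k) = if j = k then 1 else 0) ∧
      ∀ v, v = inner ℂ e v • e + ∑ k, l k v • P k := by
  set L : V →ₗ[ℂ] (Fin n → ℂ) := LinearMap.pi l with hL
  have hsurj : LinearMap.range L = ⊤ := by
    by_contra hne
    obtain ⟨f, hf0, hf⟩ := Submodule.exists_le_ker_of_lt_top _ (lt_top_iff_ne_top.2 hne)
    apply hf0
    have hfx : ∀ x, f x = ∑ k, x k * f (Pi.single k 1) := by
      intro x
      rw [LinearMap.pi_apply_eq_sum_univ f x]
      refine Finset.sum_congr rfl fun k _ => ?_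
      rw [smul_eq_mul]
      congr 2
      funext j
      simp [Pi.single_apply, eq_comm]
    have hsum : ∑ k, f (Pi.single k 1) • l k = 0 := by
      ext v
      have := hf (LinearMap.mem_range_self L v)
      rw [LinearMap.mem_ker, hfx] at this
      simpa [hL, mul_comm] using this
    have := Fintype.linearIndependent_iff.1 hl _ hsum
    refine LinearMap.ext fun x => ?_
    rw [hfx]
    simp [this]
  have hker : Module.finrank ℂ (LinearMap.ker L) = 1 := by
    have := LinearMap.finrank_range_add_finrank_ker L
    rw [hsurj, finrank_top, Module.finrank_fin_fun, hV] at this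
    omega
  obtain ⟨⟨e', he'⟩, hne, -⟩ := finrank_eq_one_iff'.1 hker
  have he0 : e' ≠ 0 := fun h => hne (Subtype.ext h)
  have hn0 : (‖e'‖ : ℂ) ≠ 0 := by exact_mod_cast norm_ne_zero_iff.2 he0
  set e : V := (‖e'‖ : ℂ)⁻¹ • e' with he
  have hen : ‖e‖ = 1 := by
    rw [he, norm_smul, norm_inv, Complex.norm_real, norm_norm]
    exact inv_mul_cancel₀ (norm_ne_zero_iff.2 he0)
  have hek : e ∈ LinearMap.ker L := Submodule.smul_mem _ _ he'
  have hspan : ∀ w ∈ LinearMap.ker L, ∃ c : ℂ, c • e = w := by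
    have hne' : (⟨e, hek⟩ : LinearMap.ker L) ≠ 0 := by
      intro h
      have : e = 0 := congrArg Subtype.val h
      rw [this, norm_zero] at hen
      norm_num at hen
    intro w hw
    obtain ⟨c, hc⟩ := (finrank_eq_one_iff_of_nonzero' _ hne').1 hker ⟨w, hw⟩
    exact ⟨c, congrArg Subtype.val hc⟩
  have hee : inner ℂ e e = (1 : ℂ) := by
    rw [inner_self_eq_ofReal_norm_sq, hen]; simp
  have hle : ∀ k, l k e = 0 := fun k => congrFun (LinearMap.mem_ker.1 hek) k
  have hex : ∀ k, ∃ v, L v = Pi.single k 1 := fun k => by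
    have : Pi.single k (1 : ℂ) ∈ LinearMap.range L := hsurj ▸ Submodule.mem_top
    exact this
  choose v hv using hex
  have hlv : ∀ j k, l j (v k - inner ℂ e (v k) • e) = if j = k then 1 else 0 := by
    intro j k
    rw [map_sub, map_smul, hle, smul_zero, sub_zero]
    have := congrFun (hv k) j
    simpa [hL, Pi.single_apply] using this
  have hperp : ∀ k, inner ℂ e (v k - inner ℂ e (v k) • e) = 0 := by
    intro k
    rw [inner_sub_right, inner_smul_right, hee, mul_one, sub_self]
  refine ⟨e, fun k => v k - inner ℂ e (v k) • e, hen, hperp, hle, hlv, fun x => ?_⟩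
  set u := x - (inner ℂ e x • e + ∑ k, l k x • (v k - inner ℂ e (v k) • e)) with hu
  have huk : u ∈ LinearMap.ker L := by
    rw [LinearMap.mem_ker]
    funext j
    change l j u = 0
    rw [hu, map_sub, map_add, map_smul, hle, smul_zero, zero_add, map_sum]
    simp_rw [map_smul, hlv]
    simp
  have hue : inner ℂ e u = 0 := by
    rw [hu, inner_sub_right, inner_add_right, inner_smul_right, hee, inner_sum]
    simp_rw [inner_smul_right, hperp]
    simp
  obtain ⟨c, hc⟩ := hspan u huk
  rw [← hc, inner_smul_right, hee, mul_one] at hue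
  rw [hue, zero_smul] at hc
  exact sub_eq_zero.1 hc.symm

section Linearisation

/-- Second order Taylor estimate for a power, multiplied by `‖z‖ ^ 2` to avoid subtraction in the
exponent. -/
theorem norm_add_pow_sub_linear_le (z x : ℂ) (hx : ‖x‖ ≤ ‖z‖) (m : ℕ) :
    ‖(z + x) ^ m - z ^ m - m * z ^ (m - 1) * x‖ * ‖z‖ ^ 2 ≤ 3 ^ m * ‖z‖ ^ m * ‖x‖ ^ 2 := by
  induction m with
  | zero => simp
  | succ m ih =>
    have hrec : (z + x) ^ (m + 1) - z ^ (m + 1) - ((m + 1 : ℕ) : ℂ) * z ^ (m + 1 - 1) * x =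
        (z + x) * ((z + x) ^ m - z ^ m - m * z ^ (m - 1) * x) + m * z ^ (m - 1) * x ^ 2 := by
      rcases m with _ | m
      · simp
      · simp only [Nat.add_sub_cancel]
        push_cast
        ring
    have hzm : (m : ℝ) * ‖z‖ ^ (m - 1) * ‖z‖ = m * ‖z‖ ^ m := by
      rcases m with _ | m
      · simp
      · rw [Nat.add_sub_cancel, pow_succ]; ring
    have hm3 : (m : ℝ) ≤ 3 ^ m := by
      exact_mod_cast (Nat.lt_pow_self (by norm_num : 1 < 3)).le
    rw [hrec]
    have h1 : ‖z + x‖ ≤ 2 * ‖z‖ := (norm_add_le _ _).trans (by linarith)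
    have h2 := norm_add_le ((z + x) * ((z + x) ^ m - z ^ m - m * z ^ (m - 1) * x))
      (m * z ^ (m - 1) * x ^ 2)
    rw [norm_mul, norm_mul (_ * _), norm_mul (m : ℂ), Complex.norm_natCast, norm_pow, norm_pow] at h2
    set D := ‖(z + x) ^ m - z ^ m - m * z ^ (m - 1) * x‖ with hD
    have hD0 : 0 ≤ D := norm_nonneg _
    have hz0 := norm_nonneg z
    calc _ ≤ (‖z + x‖ * D + m * ‖z‖ ^ (m - 1) * ‖x‖ ^ 2) * ‖z‖ ^ 2 := by gcongr
      _ ≤ (2 * ‖z‖ * D + m * ‖z‖ ^ (m - 1) * ‖x‖ ^ 2) * ‖z‖ ^ 2 := by gcongr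
      _ = 2 * ‖z‖ * (D * ‖z‖ ^ 2) + (m * ‖z‖ ^ (m - 1) * ‖z‖) * ‖x‖ ^ 2 * ‖z‖ := by ring
      _ ≤ 2 * ‖z‖ * (3 ^ m * ‖z‖ ^ m * ‖x‖ ^ 2) + (3 ^ m * ‖z‖ ^ m) * ‖x‖ ^ 2 * ‖z‖ := by
          rw [hzm]
          gcongr
      _ = _ := by ring

/-- A polynomial of degree at most `σ + 1` is almost linear on discs of radius comparable to
`|z| ^ (-σ)`. -/
theorem eventually_polynomial_linear {σ : ℝ} (hσ : 0 ≤ σ) (p : Polynomial ℂ)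
    (hp : (p.natDegree : ℝ) ≤ σ + 1) (Θ : ℝ) {ε : ℝ} (hε : 0 < ε) :
    ∃ r₁, ∀ z : ℂ, r₁ ≤ ‖z‖ → ∀ w : ℂ, ‖w - z‖ ≤ Θ * ‖z‖ ^ (-σ) →
      ‖p.eval w - p.eval z - p.derivative.eval z * (w - z)‖ ≤ ε := by
  set B := ∑ m ∈ Finset.range (p.natDegree + 1), ‖p.coeff m‖ * 3 ^ m with hB
  have hB0 : 0 ≤ B := by positivity
  refine ⟨max (max 1 Θ) (B * Θ ^ 2 / ε), fun z hz w hw => ?_⟩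
  have hr1 : 1 ≤ ‖z‖ := (le_max_left _ _).trans ((le_max_left _ _).trans hz)
  have hrΘ : Θ ≤ ‖z‖ := (le_max_right _ _).trans ((le_max_left _ _).trans hz)
  have hrB : B * Θ ^ 2 / ε ≤ ‖z‖ := (le_max_right _ _).trans hz
  have hr0 : 0 < ‖z‖ := by linarith
  set r := ‖z‖ with hr
  have hrσ : r ^ (-σ) ≤ 1 := Real.rpow_le_one_of_one_le_of_nonpos hr1 (by linarith)
  have hrσ0 : 0 < r ^ (-σ) := by positivity
  have hΘ0 : 0 ≤ Θ := by
    by_contra! h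
    have := (norm_nonneg (w - z)).trans hw
    nlinarith
  set x := w - z with hx
  have hwz : w = z + x := by rw [hx]; ring
  have hxr : ‖x‖ ≤ ‖z‖ := hw.trans (by nlinarith)
  have hexp : p.eval w - p.eval z - p.derivative.eval z * x = ∑ m ∈ Finset.range (p.natDegree + 1),
      p.coeff m * ((z + x) ^ m - z ^ m - m * z ^ (m - 1) * x) := by
    rw [hwz, Polynomial.eval_eq_sum_range, Polynomial.eval_eq_sum_range, Polynomial.derivative_eval,
      Polynomial.sum_over_range _ (fun m => by simp), Finset.sum_mul, ← Finset.sum_sub_distrib,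
      ← Finset.sum_sub_distrib]
    refine Finset.sum_congr rfl fun m _ => ?_
    ring
  have h1 : ‖p.eval w - p.eval z - p.derivative.eval z * x‖ * r ^ 2 ≤
      B * r ^ p.natDegree * ‖x‖ ^ 2 := by
    rw [hexp]
    calc _ ≤ (∑ m ∈ Finset.range (p.natDegree + 1),
          ‖p.coeff m‖ * ‖(z + x) ^ m - z ^ m - m * z ^ (m - 1) * x‖) * r ^ 2 := by
          gcongr
          refine (norm_sum_le _ _).trans (Finset.sum_le_sum fun m _ => ?_)
          rw [norm_mul]
      _ ≤ ∑ m ∈ Finset.range (p.natDegree + 1), ‖p.coeff m‖ * 3 ^ m * (r ^ p.natDegree * ‖x‖ ^ 2) := by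
          rw [Finset.sum_mul]
          refine Finset.sum_le_sum fun m hm => ?_
          have h2 := norm_add_pow_sub_linear_le z x hxr m
          have h3 : r ^ m ≤ r ^ p.natDegree :=
            pow_le_pow_right₀ hr1 (Nat.lt_succ_iff.1 (Finset.mem_range.1 hm))
          calc _ = ‖p.coeff m‖ * (‖(z + x) ^ m - z ^ m - m * z ^ (m - 1) * x‖ * r ^ 2) := by ring
            _ ≤ ‖p.coeff m‖ * (3 ^ m * r ^ m * ‖x‖ ^ 2) := by gcongr
            _ ≤ ‖p.coeff m‖ * (3 ^ m * r ^ p.natDegree * ‖x‖ ^ 2) := by gcongr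
            _ = _ := by ring
      _ = _ := by rw [← Finset.sum_mul]; ring
  have h2 : r ^ p.natDegree * ‖x‖ ^ 2 ≤ r * Θ ^ 2 := by
    have h3 : r ^ p.natDegree ≤ r ^ (σ + 1) := by
      rw [← Real.rpow_natCast]
      exact Real.rpow_le_rpow_of_exponent_le hr1 hp
    calc r ^ p.natDegree * ‖x‖ ^ 2 ≤ r ^ (σ + 1) * (Θ * r ^ (-σ)) ^ 2 := by gcongr
      _ = r * Θ ^ 2 * (r ^ σ * r ^ (-σ)) * r ^ (-σ) := by
          rw [Real.rpow_add_one hr0.ne']; ring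
      _ = r * Θ ^ 2 * r ^ (-σ) := by
          rw [← Real.rpow_add hr0, add_neg_cancel, Real.rpow_zero, mul_one]
      _ ≤ r * Θ ^ 2 * 1 := by gcongr
      _ = _ := by ring
  have h4 : ‖p.eval w - p.eval z - p.derivative.eval z * x‖ * r ^ 2 ≤ ε * r ^ 2 := by
    calc _ ≤ B * (r ^ p.natDegree * ‖x‖ ^ 2) := by rw [← mul_assoc]; exact h1
      _ ≤ B * (r * Θ ^ 2) := by gcongr
      _ = B * Θ ^ 2 / ε * ε * r := by field_simp
      _ ≤ r * ε * r := by gcongr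
      _ = ε * r ^ 2 := by ring
  exact le_of_mul_le_mul_right h4 (by positivity)

/-- On discs of radius comparable to `|z| ^ (-σ)`, a sum of exponentials of polynomials of degree at
most `σ + 1` is well approximated by an exponential sum. -/
theorem exists_norm_expSum_sub_le {n : ℕ} {E : Type*} [NormedAddCommGroup E] [NormedSpace ℂ E]
    {σ : ℝ} (hσ : 0 ≤ σ) (p : Fin n → Polynomial ℂ) (hp : ∀ k, ((p k).natDegree : ℝ) ≤ σ + 1)
    (P : Fin n → E) {A : ℝ} (hA : 0 ≤ A) (hP : ∀ (g : Fin n → ℂ) k, ‖g k‖ ≤ A * ‖∑ j, g j • P j‖)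
    (Θ : ℝ) :
    ∃ r₁, ∀ z : ℂ, r₁ ≤ ‖z‖ → ∀ w : ℂ, ‖w - z‖ ≤ Θ * ‖z‖ ^ (-σ) →
      ‖(∑ k, exp ((p k).derivative.eval z * w) •
          (exp ((p k).eval z - (p k).derivative.eval z * z) • P k)) -
        ∑ k, exp ((p k).eval w) • P k‖ ≤ ‖∑ k, exp ((p k).eval w) • P k‖ / 2 := by
  set Q := ∑ k, ‖P k‖ with hQ
  have hQ0 : 0 ≤ Q := by positivity
  set ε := 1 / (4 * (A * Q) + 1) with hε
  have hAQ : 0 ≤ A * Q := by positivity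
  have hεpos : 0 < ε := by positivity
  have hε1 : ε ≤ 1 := by rw [hε, div_le_one (by positivity)]; linarith
  have hεAQ : 2 * ε * (A * Q) ≤ 1 / 2 := by
    rw [hε, mul_one_div, div_mul_eq_mul_div, div_le_iff₀ (by positivity)]; linarith
  choose r₁ hr₁ using fun k => eventually_polynomial_linear hσ (p k) (hp k) Θ hεpos
  refine ⟨∑ k, |r₁ k|, fun z hz w hw => ?_⟩
  set H := ∑ k, exp ((p k).eval w) • P k with hH
  have hterm : ∀ k, ‖exp ((p k).derivative.eval z * w) •
      (exp ((p k).eval z - (p k).derivative.eval z * z) • P k) - exp ((p k).eval w) • P k‖ ≤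
        2 * ε * (A * ‖H‖) * ‖P k‖ := by
    intro k
    have h1 := hr₁ k z (((le_abs_self _).trans (Finset.single_le_sum (f := fun k => |r₁ k|)
      (fun _ _ => abs_nonneg _) (Finset.mem_univ k))).trans hz) w hw
    set d := -((p k).eval w - (p k).eval z - (p k).derivative.eval z * (w - z)) with hd
    have h2 : exp ((p k).derivative.eval z * w) •
        (exp ((p k).eval z - (p k).derivative.eval z * z) • P k) - exp ((p k).eval w) • P k =
          (exp ((p k).eval w) * (exp d - 1)) • P k := by
      rw [smul_smul, ← exp_add, ← sub_smul, mul_sub, mul_one, ← exp_add]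
      congr 3
      rw [hd]
      ring
    rw [h2, norm_smul, norm_mul]
    rw [← norm_neg, ← hd] at h1
    have h3 := Complex.norm_exp_sub_one_le (x := d) (h1.trans hε1)
    have h4 := hP (fun k => exp ((p k).eval w)) k
    calc _ ≤ A * ‖H‖ * (2 * ε) * ‖P k‖ := by
          gcongr
          exact h3.trans (by gcongr)
      _ = _ := by ring
  rw [hH, ← Finset.sum_sub_distrib]
  calc _ ≤ ∑ k, 2 * ε * (A * ‖H‖) * ‖P k‖ := norm_sum_le_of_le _ fun k _ => hterm k
    _ = 2 * ε * (A * Q) * ‖H‖ := by rw [← Finset.mul_sum]; ring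
    _ ≤ 1 / 2 * ‖H‖ := by gcongr
    _ = _ := by ring

end Linearisation

end

/-! ### The logarithmic gradient at the scale of the Fubini–Study derivative -/

section

section Splitting

variable {E : Type*} [NormedAddCommGroup E] [InnerProductSpace ℂ E] {Φ H : ℂ → E} {e : E}

/-- The decomposition of `Φ` into a multiple of the unit vector `e` and a part `H` orthogonal
to it. -/
theorem norm_sq_eq_of_split (he : ‖e‖ = 1) (heH : ∀ z, inner ℂ e (H z) = 0)
    (hΦe : ∀ z, Φ z = inner ℂ e (Φ z) • e + H z) (z : ℂ) :
    ‖Φ z‖ ^ 2 = ‖inner ℂ e (Φ z)‖ ^ 2 + ‖H z‖ ^ 2 := by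
  have h := norm_add_sq_eq_norm_sq_add_norm_sq_of_inner_eq_zero (𝕜 := ℂ) (inner ℂ e (Φ z) • e) (H z)
    (by rw [inner_smul_left, heH, mul_zero])
  rw [← hΦe z, norm_smul, he, mul_one] at h
  rw [sq, sq, sq]; exact h

theorem inner_eq_of_split (hΦe : ∀ z, Φ z = inner ℂ e (Φ z) • e + H z) {a : E}
    (hae : inner ℂ a e = 0) (z : ℂ) : inner ℂ a (Φ z) = inner ℂ a (H z) := by
  conv_lhs => rw [hΦe z]
  rw [inner_add_right, inner_smul_right, hae, mul_zero, zero_add]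

theorem exists_unit_inner_eq_norm (heH : ∀ z, inner ℂ e (H z) = 0) {z : ℂ} (h : H z ≠ 0) :
    ∃ a : E, ‖a‖ = 1 ∧ inner ℂ a e = 0 ∧ ‖inner ℂ a (H z)‖ = ‖H z‖ := by
  have hn : ‖H z‖ ≠ 0 := norm_ne_zero_iff.2 h
  refine ⟨((‖H z‖ : ℂ)⁻¹) • H z, ?_, ?_, ?_⟩
  · rw [norm_smul, norm_inv, Complex.norm_real, norm_norm, inv_mul_cancel₀ hn]
  · rw [inner_smul_left, inner_eq_zero_symm.1 (heH z), mul_zero]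
  · rw [inner_smul_left, inner_self_eq_ofReal_norm_sq, norm_mul, RCLike.norm_conj, norm_inv,
      norm_pow, Complex.norm_real, norm_norm]
    field_simp

theorem norm_logDeriv_inner_sub_logGrad_le_mul {z : ℂ} {a : E} {m κ : ℝ} (ha : ‖a‖ = 1)
    (hd : DifferentiableAt ℂ Φ z) (h : inner ℂ a (Φ z) ≠ 0) (hm : ‖Φ z‖ ≤ m * ‖inner ℂ a (Φ z)‖)
    (hκ : sphDeriv Φ z ≤ κ) :
    ‖deriv (fun w => inner ℂ a (Φ w)) z / inner ℂ a (Φ z) - logGrad Φ z‖ ≤ m * κ := by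
  refine (norm_logDeriv_inner_sub_logGrad_le ha hd h).trans ?_
  have hpos := norm_pos_iff.2 h
  have h0 := sphDeriv_nonneg Φ z
  rw [div_le_iff₀ hpos]
  calc sphDeriv Φ z * ‖Φ z‖ ≤ κ * (m * ‖inner ℂ a (Φ z)‖) := by gcongr; exact h0.trans hκ
    _ = _ := by ring

theorem differentiable_inner_left (hΦ : Differentiable ℂ Φ) (a : E) :
    Differentiable ℂ fun w => inner ℂ a (Φ w) := fun z =>
  ((innerSL ℂ a).differentiableAt.comp z (hΦ z))

/-- Where the component along `e` does not dominate, the logarithmic gradient is close to the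
frequency of one of the terms of an exponential sum approximating `H`. -/
theorem exists_logGrad_close_of_le [CompleteSpace E] {n : ℕ} (hn : 0 < n)
    (hΦ : Differentiable ℂ Φ) (h0 : ∀ z, Φ z ≠ 0)
    (he : ‖e‖ = 1) (heH : ∀ z, inner ℂ e (H z) = 0)
    (hΦe : ∀ z, Φ z = inner ℂ e (Φ z) • e + H z) {z : ℂ} {κ : ℝ} (hκ : 0 < κ)
    (hb : ∀ w ∈ ball z (1 / (20 * κ)), sphDeriv Φ w ≤ κ) {s : Fin n → ℂ} {v : Fin n → E}
    (hlin : ∀ w ∈ ball z (1 / (20 * κ)), ‖(∑ k, exp (s k * w) • v k) - H w‖ ≤ ‖H w‖ / 2)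
    (hle : ‖inner ℂ e (Φ z)‖ ≤ 2 * ‖H z‖) :
    ∃ k, ‖logGrad Φ z - s k‖ ≤ 16000000 * n ^ 5 * κ := by
  have hR : 0 < 1 / (20 * κ) := by positivity
  have hsplit := norm_sq_eq_of_split he heH hΦe
  have hzb : z ∈ ball z (1 / (20 * κ)) := mem_ball_self hR
  have hH0 : H z ≠ 0 := by
    intro h
    apply h0 z
    rw [h, norm_zero, mul_zero] at hle
    rw [hΦe z, h, norm_le_zero_iff.1 hle]; simp
  have hHpos := norm_pos_iff.2 hH0
  obtain ⟨a, ha, hae, haH⟩ := exists_unit_inner_eq_norm heH hH0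
  have hin := inner_eq_of_split hΦe hae
  have h5 : ‖Φ z‖ ^ 2 ≤ 5 * ‖inner ℂ a (Φ z)‖ ^ 2 := by
    rw [hin, haH, hsplit z]
    have := pow_le_pow_left₀ (norm_nonneg _) hle 2
    linarith
  -- the squared cosine of the angle with `a` is at least `1 / 5` at `z`, and changes by at most
  -- `2 * κ / (20 * κ) = 1 / 10`
  have h10 : ∀ w ∈ ball z (1 / (20 * κ)), ‖Φ w‖ ^ 2 ≤ 10 * ‖inner ℂ a (Φ w)‖ ^ 2 := by
    intro w hw
    have h1 := abs_sq_inner_div_sub_le hΦ h0 ha (convex_ball z _) hb hzb hw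
    have h2 : 2 * κ * ‖w - z‖ ≤ 1 / 10 := by
      rw [mem_ball, dist_eq_norm, lt_div_iff₀ (by positivity)] at hw
      linarith
    have hΦz : 0 < ‖Φ z‖ ^ 2 := pow_pos (norm_pos_iff.2 (h0 z)) 2
    have hΦw : 0 < ‖Φ w‖ ^ 2 := pow_pos (norm_pos_iff.2 (h0 w)) 2
    have h3 : 1 / 5 ≤ ‖inner ℂ a (Φ z)‖ ^ 2 / ‖Φ z‖ ^ 2 := by
      rw [le_div_iff₀ hΦz]; linarith
    have h4 : 1 / 10 ≤ ‖inner ℂ a (Φ w)‖ ^ 2 / ‖Φ w‖ ^ 2 := by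
      linarith [neg_abs_le (‖inner ℂ a (Φ w)‖ ^ 2 / ‖Φ w‖ ^ 2 - ‖inner ℂ a (Φ z)‖ ^ 2 / ‖Φ z‖ ^ 2)]
    rw [le_div_iff₀ hΦw] at h4
    linarith
  have hne : ∀ w ∈ ball z (1 / (20 * κ)), inner ℂ a (Φ w) ≠ 0 := by
    intro w hw h
    have := h10 w hw
    rw [h, norm_zero] at this
    have := pow_pos (norm_pos_iff.2 (h0 w)) 2
    linarith
  have hdb := differentiable_inner_left hΦ a
  obtain ⟨k, hk⟩ := exists_norm_logDeriv_sub_le (s := s) (v := v) (p := 3) (N := 1) hn hR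
    hdb.differentiableOn hne
    (fun w hw => by
      have h1 := hlin w hw
      have h2 := norm_le_norm_add_norm_sub' (∑ k, exp (s k * w) • v k) (H w)
      have h3 : ‖H w‖ ≤ 4 * ‖inner ℂ a (Φ w)‖ := by
        refine le_of_sq_le_sq ?_ (by positivity)
        have := hsplit w
        have := h10 w hw
        nlinarith [sq_nonneg ‖inner ℂ e (Φ w)‖, sq_nonneg ‖inner ℂ a (Φ w)‖]
      linarith [norm_nonneg (inner ℂ a (Φ w))])
    ⟨z, by rw [dist_self]; positivity, by
      have h1 := hlin z hzb
      have h2 := norm_le_norm_add_norm_sub' (H z) (∑ k, exp (s k * z) • v k)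
      rw [norm_sub_rev] at h2
      simp only [hin, haH]
      linarith⟩
  refine ⟨k, ?_⟩
  have hγ := norm_logDeriv_inner_sub_logGrad_le_mul (m := 3) ha (hΦ z) (hne z hzb)
    (le_of_sq_le_sq (by nlinarith [sq_nonneg ‖inner ℂ a (Φ z)‖]) (by positivity)) (hb z hzb)
  have htri := norm_sub_le_norm_sub_add_norm_sub (logGrad Φ z)
    (deriv (fun w => inner ℂ a (Φ w)) z / inner ℂ a (Φ z)) (s k)
  rw [norm_sub_rev (logGrad Φ z) (_ / _)] at htri
  have hn5 : (1 : ℝ) ≤ (n : ℝ) ^ 5 := one_le_pow₀ (by exact_mod_cast hn)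
  have e1 : (131072 : ℝ) * n ^ 5 * ((1 : ℕ) + (3 : ℕ) + 2) / (1 / (20 * κ)) =
      15728640 * (n ^ 5 * κ) := by
    rw [div_div_eq_mul_div, div_one]; push_cast; ring
  rw [e1] at hk
  have h1 : κ ≤ n ^ 5 * κ := le_mul_of_one_le_left hκ.le hn5
  linarith

/-- At a point where a disc on which `⟪e, Φ⟫` dominates `H` touches the set where it does not, the
two are of equal size, so the slope is controlled; therefore `H` is not too small inside. -/
theorem exists_norm_inner_le_pow_mul (hΦ : Differentiable ℂ Φ) (h0 : ∀ z, Φ z ≠ 0)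
    (he : ‖e‖ = 1) (heH : ∀ z, inner ℂ e (H z) = 0)
    (hΦe : ∀ z, Φ z = inner ℂ e (Φ z) • e + H z) {c w : ℂ} {R κ : ℝ} (hR : 0 < R)
    (hdom : ∀ y ∈ ball c R, ‖H y‖ < ‖inner ℂ e (Φ y)‖) (hwc : dist w c = R)
    (hw : ‖inner ℂ e (Φ w)‖ ≤ ‖H w‖) (hHc : Continuous H) (hκ : sphDeriv Φ w ≤ κ) {N : ℕ}
    (hN : 3 * κ * R < N) :
    ‖inner ℂ e (Φ w)‖ = ‖H w‖ ∧
      ∃ ζ, dist ζ c ≤ R / 4 ∧ ‖inner ℂ e (Φ ζ)‖ ≤ 4 ^ N * ‖H ζ‖ := by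
  have hsplit := norm_sq_eq_of_split he heH hΦe
  have hfd := differentiable_inner_left hΦ e
  have hdomc : ∀ y ∈ closedBall c R, ‖H y‖ ≤ ‖inner ℂ e (Φ y)‖ := by
    intro y hy
    rw [← closure_ball c hR.ne'] at hy
    exact le_on_closure (fun y hy => (hdom y hy).le) hHc.norm.continuousOn
      hfd.continuous.norm.continuousOn hy
  have htie : ‖inner ℂ e (Φ w)‖ = ‖H w‖ := le_antisymm hw (hdomc w hwc.le)
  refine ⟨htie, ?_⟩
  have hf0 : ∀ y ∈ closedBall c R, inner ℂ e (Φ y) ≠ 0 := by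
    intro y hy h
    have h1 := hdomc y hy
    rw [h, norm_zero, norm_le_zero_iff] at h1
    apply h0 y
    rw [hΦe y, h, h1]; simp
  have hH0 : H w ≠ 0 := by
    rw [← norm_pos_iff, ← htie]
    exact norm_pos_iff.2 (hf0 w hwc.le)
  obtain ⟨a, ha, hae, haH⟩ := exists_unit_inner_eq_norm heH hH0
  have hin := inner_eq_of_split hΦe hae
  have had := differentiable_inner_left hΦ a
  have haw : inner ℂ a (Φ w) ≠ 0 := by
    rw [← norm_pos_iff, hin, haH]; exact norm_pos_iff.2 hH0
  have haleH : ∀ y, ‖inner ℂ a (Φ y)‖ ≤ ‖H y‖ := fun y => by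
    rw [hin]; simpa [ha] using norm_inner_le_norm (𝕜 := ℂ) a (H y)
  set φ : ℂ → ℂ := fun y => inner ℂ a (Φ y) / inner ℂ e (Φ y) with hφ
  have hφd : ∀ y ∈ closedBall c R, DifferentiableAt ℂ φ y := fun y hy =>
    (had y).div (hfd y) (hf0 y hy)
  have hφw : ‖φ w‖ = 1 := by
    simp only [hφ, norm_div]
    rw [htie, hin, haH, div_self (norm_ne_zero_iff.2 hH0)]
  have hsize : ‖Φ w‖ ^ 2 = 2 * ‖H w‖ ^ 2 := by rw [hsplit, htie]; ring
  have hΦH : ‖Φ w‖ ≤ 3 / 2 * ‖H w‖ := by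
    refine le_of_sq_le_sq ?_ (by positivity)
    nlinarith [sq_nonneg ‖H w‖]
  have hslope : ‖deriv φ w‖ ≤ 3 * κ := by
    have h1 := norm_logDeriv_inner_sub_logGrad_le_mul (m := 3 / 2) ha (hΦ w) haw
      (by rw [hin, haH]; exact hΦH) hκ
    have h2 := norm_logDeriv_inner_sub_logGrad_le_mul (m := 3 / 2) he (hΦ w) (hf0 w hwc.le)
      (by rw [htie]; exact hΦH) hκ
    have h3 : ‖deriv φ w‖ = ‖deriv φ w / φ w‖ := by rw [norm_div, hφw, div_one]
    rw [h3, hφ, deriv_div_div (had w) (hfd w) haw (hf0 w hwc.le)]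
    have h4 := norm_sub_le (deriv (fun y => inner ℂ a (Φ y)) w / inner ℂ a (Φ w) - logGrad Φ w)
      (deriv (fun y => inner ℂ e (Φ y)) w / inner ℂ e (Φ w) - logGrad Φ w)
    rw [sub_sub_sub_cancel_right] at h4
    linarith
  obtain ⟨ζ, hζ, hζN⟩ := exists_lt_norm_of_boundary_deriv_lt (φ := φ) (N := N) hR
    (DifferentiableOn.diffContOnCl fun y hy => (hφd y (by
      rwa [closure_ball c hR.ne'] at hy)).differentiableWithinAt)
    (fun y hy => by
      simp only [hφ, norm_div]
      exact div_le_one_of_le₀ ((haleH y).trans (hdomc y hy.le)) (norm_nonneg _))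
    hwc (hφd w hwc.le) hφw (by nlinarith)
  refine ⟨ζ, hζ, ?_⟩
  have hζb : ζ ∈ closedBall c R := by rw [mem_closedBall]; linarith
  simp only [hφ, norm_div] at hζN
  rw [lt_div_iff₀ (norm_pos_iff.2 (hf0 ζ hζb)), one_div, inv_pow,
    inv_mul_lt_iff₀ (by positivity)] at hζN
  exact hζN.le.trans (by gcongr; exact haleH ζ)

/-- Small discs: the disc centred at `z` on which `⟪e, Φ⟫` dominates is not too small, and the
exponential sum can be compared with `⟪e, Φ⟫` there. -/
theorem exists_logDeriv_close_of_centered {n : ℕ} (hn : 0 < n) (hΦ : Differentiable ℂ Φ)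
    {z : ℂ} {R κ : ℝ} (hR : 0 < R) (hκ : 0 < κ) (hκR : 3 / 20 ≤ κ * R)
    (hdom : ∀ y ∈ ball z R, ‖H y‖ < ‖inner ℂ e (Φ y)‖)
    {s : Fin n → ℂ} {v : Fin n → E}
    (hlin : ∀ w ∈ ball z R, ‖(∑ k, exp (s k * w) • v k) - H w‖ ≤ ‖H w‖ / 2)
    {N : ℕ} (hN : (N : ℝ) ≤ 3 * κ * R + 1)
    (hζ : ∃ ζ, dist ζ z ≤ R / 4 ∧ ‖inner ℂ e (Φ ζ)‖ ≤ 4 ^ N * ‖H ζ‖) :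
    ∃ k, ‖deriv (fun w => inner ℂ e (Φ w)) z / inner ℂ e (Φ z) - s k‖ ≤
      7000000 * n ^ 5 * κ := by
  obtain ⟨ζ, hζz, hζN⟩ := hζ
  obtain ⟨k, hk⟩ := exists_norm_logDeriv_sub_le (s := s) (v := v) (p := 1) (N := 2 * N + 1) hn hR
    (differentiable_inner_left hΦ e).differentiableOn
    (fun y hy => norm_pos_iff.1 ((norm_nonneg _).trans_lt (hdom y hy)))
    (fun w hw => by
      have h1 := hlin w hw
      have h2 := norm_le_norm_add_norm_sub' (∑ k, exp (s k * w) • v k) (H w)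
      have h3 := hdom w hw
      linarith [norm_nonneg (H w)])
    ⟨ζ, hζz, by
      have h1 := hlin ζ (by rw [mem_ball]; linarith)
      have h2 := norm_le_norm_add_norm_sub' (H ζ) (∑ k, exp (s k * ζ) • v k)
      rw [norm_sub_rev] at h2
      have e1 : (2 : ℝ) ^ (2 * N + 1) = 4 ^ N * 2 := by
        rw [pow_succ, pow_mul]; norm_num
      rw [e1, mul_assoc]
      refine hζN.trans ?_
      gcongr
      linarith⟩
  refine ⟨k, hk.trans ?_⟩
  rw [div_le_iff₀ hR]
  have hn5 : (1 : ℝ) ≤ (n : ℝ) ^ 5 := one_le_pow₀ (by exact_mod_cast hn)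
  push_cast
  have h1 : (2 * (N : ℝ) + 1 + 1 + 2) ≤ 46 * (κ * R) := by nlinarith
  calc 131072 * (n : ℝ) ^ 5 * (2 * N + 1 + 1 + 2) ≤ 131072 * (n : ℝ) ^ 5 * (46 * (κ * R)) := by gcongr
    _ ≤ _ := by nlinarith [mul_pos hκ hR, mul_nonneg (by positivity : 0 ≤ (n : ℝ) ^ 5) (mul_pos hκ hR).le]

end Splitting

end

/-! ### The uniform bound for the logarithmic gradient -/

section

section Large

variable {n : ℕ}

theorem deriv_exp_div (p : Polynomial ℂ) {f : ℂ → ℂ} {A : ℝ} (hA : 0 < A) {z : ℂ}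
    (hf : DifferentiableAt ℂ f z) (hf0 : f z ≠ 0) :
    deriv (fun w => exp (p.eval w) / (A * f w)) z / (exp (p.eval z) / (A * f z)) =
      p.derivative.eval z - deriv f z / f z := by
  have hA0 : (A : ℂ) ≠ 0 := by exact_mod_cast hA.ne'
  have hd := (p.hasDerivAt z).cexp
  rw [deriv_div_div (f := fun w => exp (p.eval w)) (g := fun w => A * f w) hd.differentiableAt
    (hf.const_mul _) (exp_ne_zero _) (mul_ne_zero hA0 hf0), hd.deriv,
    mul_div_cancel_left₀ _ (exp_ne_zero _), deriv_const_mul _ hf, mul_div_mul_left _ _ hA0]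

/-- Large discs: Harnack's inequality for the zero-free functions `exp (p k) / f` applies, because
the comparison constants `A` and `D`, which depend on the hyperplanes, are negligible with respect to
the radius. -/
theorem exists_logDeriv_close_of_large {f : ℂ → ℂ} (hf : Differentiable ℂ f)
    (p : Fin n → Polynomial ℂ) {h : ℂ → ℝ} {A D : ℝ} (hA : 0 < A) (hD : 0 < D)
    (hAh : ∀ w k, ‖exp ((p k).eval w)‖ ≤ A * h w)
    (hDh : ∀ w, ∃ k, h w ≤ D * ‖exp ((p k).eval w)‖)
    {z c : ℂ} {R κ : ℝ} (hR : 0 < R) (hzc : dist z c ≤ R / 5)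
    (hlarge : 1 + |Real.log (D * A)| ≤ κ * R)
    (hdom : ∀ y ∈ ball c R, h y < ‖f y‖) {N : ℕ} (hN : (N : ℝ) ≤ 3 * κ * R + 1)
    (hζ : ∃ ζ, dist ζ c ≤ R / 4 ∧ ‖f ζ‖ ≤ 4 ^ N * h ζ) :
    ∃ k, ‖deriv f z / f z - (p k).derivative.eval z‖ ≤ 42 * κ := by
  obtain ⟨ζ, hζc, hζN⟩ := hζ
  have hζb : ζ ∈ ball c R := by rw [mem_ball]; linarith
  have hzb : z ∈ ball c R := by rw [mem_ball]; linarith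
  obtain ⟨k, hk⟩ := hDh ζ
  have hA0 : (A : ℂ) ≠ 0 := by exact_mod_cast hA.ne'
  have hexp : ∀ w, 0 < ‖exp ((p k).eval w)‖ := fun w => norm_pos_iff.2 (exp_ne_zero _)
  have hf0 : ∀ y ∈ ball c R, f y ≠ 0 := by
    intro y hy
    have h1 := hdom y hy
    have h2 := (hexp y).trans_le (hAh y k)
    have h3 : 0 < h y := pos_of_mul_pos_right h2 hA.le
    exact norm_pos_iff.1 (h3.trans h1)
  set φ : ℂ → ℂ := fun w => exp ((p k).eval w) / (A * f w) with hφ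
  have hφn : ∀ w, ‖φ w‖ = ‖exp ((p k).eval w)‖ / (A * ‖f w‖) := fun w => by
    simp only [hφ, norm_div, norm_mul, Complex.norm_real, Real.norm_eq_abs, abs_of_pos hA]
  have hφd : DifferentiableOn ℂ φ (ball c R) := fun y hy =>
    (((p k).differentiable y).cexp.div ((hf y).const_mul _)
      (mul_ne_zero hA0 (hf0 y hy))).differentiableWithinAt
  have hφ0 : ∀ y ∈ ball c R, φ y ≠ 0 := fun y hy =>
    div_ne_zero (exp_ne_zero _) (mul_ne_zero hA0 (hf0 y hy))
  have hφ1 : ∀ y ∈ ball c R, ‖φ y‖ < 1 := by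
    intro y hy
    rw [hφn, div_lt_one (mul_pos hA (norm_pos_iff.2 (hf0 y hy)))]
    exact (hAh y k).trans_lt (mul_lt_mul_of_pos_left (hdom y hy) hA)
  have hDA : 0 < D * A := mul_pos hD hA
  have hLζ : -Real.log ‖φ ζ‖ ≤ N * (7 / 5) + |Real.log (D * A)| := by
    have h1 : ‖φ ζ‖⁻¹ ≤ 4 ^ N * (D * A) := by
      rw [hφn, inv_div, div_le_iff₀ (hexp ζ)]
      calc A * ‖f ζ‖ ≤ A * (4 ^ N * (D * ‖exp ((p k).eval ζ)‖)) := by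
            gcongr; exact hζN.trans (by gcongr)
        _ = _ := by ring
    have h2 := Real.log_le_log (inv_pos.2 (norm_pos_iff.2 (hφ0 ζ hζb))) h1
    rw [Real.log_inv, Real.log_mul (by positivity) hDA.ne', Real.log_pow] at h2
    have h4 : Real.log 4 ≤ 7 / 5 := by
      have := Real.log_two_lt_d9
      rw [show (4 : ℝ) = 2 ^ 2 by norm_num, Real.log_pow]
      push_cast; linarith
    have h5 : (N : ℝ) * Real.log 4 ≤ N * (7 / 5) := by gcongr
    linarith [le_abs_self (Real.log (D * A))]
  have hneg : ∀ w ∈ ball c R, 0 ≤ -Real.log ‖φ w‖ := fun w hw => by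
    linarith [Real.log_neg (norm_pos_iff.2 (hφ0 w hw)) (hφ1 w hw)]
  have hH := (neg_log_norm_harnack hφd hφ0 hφ1 hζb).2
  have hLc : -Real.log ‖φ c‖ ≤ 5 / 3 * -Real.log ‖φ ζ‖ := by
    have h1 := hneg ζ hζb
    have h2 := hneg c (mem_ball_self hR)
    have h3 : -Real.log ‖φ c‖ * (3 / 4 * R) ≤ -Real.log ‖φ ζ‖ * (5 / 4 * R) := by
      calc _ ≤ -Real.log ‖φ c‖ * (R - dist ζ c) := by gcongr; linarith
        _ ≤ _ := hH
        _ ≤ _ := by gcongr; linarith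
    nlinarith
  refine ⟨k, ?_⟩
  have hgrad := norm_logDeriv_le_of_center hR hφd hφ0 hφ1 hzc
  rw [hφ, deriv_exp_div (p k) hA (hf z) (hf0 z hzb), norm_sub_rev] at hgrad
  refine hgrad.trans ?_
  rw [div_le_iff₀ hR]
  nlinarith [abs_nonneg (Real.log (D * A))]

end Large

section Uniform

variable {E : Type*} [NormedAddCommGroup E] [InnerProductSpace ℂ E] {Φ H : ℂ → E} {e : E}

/-- The discs on which `⟪e, Φ⟫` dominates cannot be smaller than the reciprocal of the spherical
derivative. -/
theorem le_mul_radius_of_centered [CompleteSpace E] (hΦ : Differentiable ℂ Φ) (h0 : ∀ z, Φ z ≠ 0)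
    (he : ‖e‖ = 1) (heH : ∀ z, inner ℂ e (H z) = 0)
    (hΦe : ∀ z, Φ z = inner ℂ e (Φ z) • e + H z) {z w : ℂ} {R κ : ℝ}
    (hb : ∀ y ∈ closedBall z R, sphDeriv Φ y ≤ κ) (hwz : dist w z = R)
    (hw : ‖inner ℂ e (Φ w)‖ = ‖H w‖) (hz : 2 * ‖H z‖ ≤ ‖inner ℂ e (Φ z)‖) :
    3 / 20 ≤ κ * R := by
  have hsplit := norm_sq_eq_of_split he heH hΦe
  have hR : 0 ≤ R := hwz ▸ dist_nonneg
  have h1 := abs_sq_inner_div_sub_le hΦ h0 he (convex_closedBall z R) hb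
    (mem_closedBall_self hR) (show w ∈ closedBall z R from hwz.le)
  rw [← dist_eq_norm, hwz] at h1
  have hΦz : 0 < ‖Φ z‖ ^ 2 := pow_pos (norm_pos_iff.2 (h0 z)) 2
  have hΦw : 0 < ‖Φ w‖ ^ 2 := pow_pos (norm_pos_iff.2 (h0 w)) 2
  have h2 : 4 / 5 ≤ ‖inner ℂ e (Φ z)‖ ^ 2 / ‖Φ z‖ ^ 2 := by
    rw [le_div_iff₀ hΦz, hsplit]
    nlinarith [pow_le_pow_left₀ (by positivity) hz 2]
  have h3 : ‖inner ℂ e (Φ w)‖ ^ 2 / ‖Φ w‖ ^ 2 = 1 / 2 := by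
    rw [div_eq_iff hΦw.ne', hsplit, hw]; ring
  rw [h3] at h1
  have := neg_abs_le (1 / 2 - ‖inner ℂ e (Φ z)‖ ^ 2 / ‖Φ z‖ ^ 2)
  linarith

set_option maxHeartbeats 1000000 in
/-- The logarithmic gradient of a curve omitting hyperplanes is, far from the origin, close to one
of the derivatives of the exponents, with a constant that depends neither on the curve nor on the
hyperplanes: `P` and `A` do not enter.

The discs on which `⟪e, Φ⟫` dominates `H` are either large compared with the constants depending on
the hyperplanes, and Harnack's inequality is applied to the zero-free coordinates, or so small that
`H` is approximated by an exponential sum. In the second case the frequencies are found without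
reference to the coefficients `P`. -/
theorem exists_logGrad_close_uniform [CompleteSpace E] {n : ℕ} (hn : 0 < n)
    (hΦ : Differentiable ℂ Φ) (h0 : ∀ z, Φ z ≠ 0) (he : ‖e‖ = 1) {P : Fin n → E}
    (heP : ∀ k, inner ℂ e (P k) = 0) {A : ℝ} (hA : 0 < A)
    (hP : ∀ (g : Fin n → ℂ) k, ‖g k‖ ≤ A * ‖∑ j, g j • P j‖) {σ K r₀ : ℝ} (hσ : 0 ≤ σ)
    (hK : 0 < K) (hr₀ : 1 ≤ r₀) (p : Fin n → Polynomial ℂ)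
    (hp : ∀ k, ((p k).natDegree : ℝ) ≤ σ + 1)
    (hΦe : ∀ z, Φ z = inner ℂ e (Φ z) • e + ∑ k, exp ((p k).eval z) • P k)
    (hb : ∀ z, r₀ ≤ ‖z‖ → sphDeriv Φ z ≤ K * ‖z‖ ^ σ) :
    ∃ r₁, ∀ z, r₁ ≤ ‖z‖ → ∃ k,
      ‖logGrad Φ z - (p k).derivative.eval z‖ ≤ 16000000 * n ^ 5 * 2 ^ σ * K * ‖z‖ ^ σ := by
  set H : ℂ → E := fun z => ∑ k, exp ((p k).eval z) • P k with hH
  have heH : ∀ z, inner ℂ e (H z) = 0 := fun z => by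
    simp [hH, heP]
  have hHc : Continuous H := by
    refine continuous_finsetSum _ fun k _ => ?_
    exact ((p k).continuous.cexp).smul continuous_const
  set f : ℂ → ℂ := fun z => inner ℂ e (Φ z) with hfdef
  have hfd : Differentiable ℂ f := differentiable_inner_left hΦ e
  have hsplit := norm_sq_eq_of_split he heH hΦe
  have hn5 : (1 : ℝ) ≤ (n : ℝ) ^ 5 := one_le_pow₀ (by exact_mod_cast hn)
  have h2σ : (1 : ℝ) ≤ 2 ^ σ := Real.one_le_rpow (by norm_num) hσ
  have : Nonempty (Fin n) := ⟨⟨0, hn⟩⟩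
  let k₀ : Fin n := ⟨0, hn⟩
  -- comparison of `H` with the largest exponential
  set D : ℝ := (∑ k, ‖P k‖) + 1 with hDdef
  have hD : 0 < D := by positivity
  have hAh : ∀ w k, ‖exp ((p k).eval w)‖ ≤ A * ‖H w‖ := fun w k =>
    hP (fun j => exp ((p j).eval w)) k
  have hDh : ∀ w, ∃ k, ‖H w‖ ≤ D * ‖exp ((p k).eval w)‖ := by
    intro w
    obtain ⟨k, -, hk⟩ := Finset.exists_max_image Finset.univ
      (fun k : Fin n => ‖exp ((p k).eval w)‖) ⟨k₀, Finset.mem_univ _⟩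
    refine ⟨k, ?_⟩
    calc ‖H w‖ ≤ ∑ j, ‖exp ((p j).eval w)‖ * ‖P j‖ := by
          refine (norm_sum_le _ _).trans (Finset.sum_le_sum fun j _ => (norm_smul _ _).le)
      _ ≤ ∑ j, ‖exp ((p k).eval w)‖ * ‖P j‖ :=
          Finset.sum_le_sum fun j _ => by gcongr; exact hk j (Finset.mem_univ _)
      _ = (∑ j, ‖P j‖) * ‖exp ((p k).eval w)‖ := by rw [← Finset.mul_sum, mul_comm]
      _ ≤ D * ‖exp ((p k).eval w)‖ := by gcongr; rw [hDdef]; linarith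
  have hHpos : ∀ w, 0 < ‖H w‖ := fun w =>
    pos_of_mul_pos_right ((norm_pos_iff.2 (exp_ne_zero _)).trans_le (hAh w k₀)) hA.le
  set Θ : ℝ := 1 + |Real.log (D * A)| with hΘdef
  have hΘ1 : 1 ≤ Θ := by rw [hΘdef]; linarith [abs_nonneg (Real.log (D * A))]
  set S : Set ℂ := {z | ‖f z‖ ≤ ‖H z‖} with hSdef
  have hS : IsClosed S := isClosed_le hfd.continuous.norm hHc.norm
  have hnotS : ∀ z, z ∉ S → ‖H z‖ < ‖f z‖ := fun z hz => not_le.1 hz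
  have hf0 : ∀ z, z ∉ S → f z ≠ 0 := fun z hz =>
    norm_pos_iff.1 ((norm_nonneg _).trans_lt (hnotS z hz))
  obtain ⟨rl, hrl⟩ := exists_norm_expSum_sub_le hσ p hp P hA.le hP (Θ / K)
  obtain ⟨ρ, -, hsec⟩ := norm_logDeriv_le_of_sector (r₀ := r₀) (by linarith)
  obtain ⟨M, hM⟩ := exists_neg_log_norm_div_le (f := fun w => exp ((p k₀).eval w))
    (g := fun w => A * f w) (p k₀).continuous.cexp (hfd.continuous.const_mul (A : ℂ))
    (fun z => exp_ne_zero _) ρ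
  obtain ⟨rs, hrs⟩ := hsec M K hK
  refine ⟨max (max (7 * r₀) (7 / 6 * Θ / K + 1)) (max rl rs), fun z hz => ?_⟩
  have hz7 : 7 * r₀ ≤ ‖z‖ := (le_max_left _ _).trans ((le_max_left _ _).trans hz)
  have hzΘ : 7 / 6 * Θ / K + 1 ≤ ‖z‖ := (le_max_right _ _).trans ((le_max_left _ _).trans hz)
  have hzl : rl ≤ ‖z‖ := (le_max_left _ _).trans ((le_max_right _ _).trans hz)
  have hzs : rs ≤ ‖z‖ := (le_max_right _ _).trans ((le_max_right _ _).trans hz)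
  have hzpos : 0 < ‖z‖ := by linarith
  have hzσ : 1 ≤ ‖z‖ ^ σ := Real.one_le_rpow (by linarith) hσ
  have hA0 : (A : ℂ) ≠ 0 := by exact_mod_cast hA.ne'
  -- the bound for the spherical derivative in the annulus `r₀ ≤ |w| ≤ 2 |z|`
  set κ : ℝ := K * (2 * ‖z‖) ^ σ with hκdef
  have hκe : κ = 2 ^ σ * K * ‖z‖ ^ σ := by
    rw [hκdef, Real.mul_rpow (by norm_num) hzpos.le]; ring
  have hKκ' : K * ‖z‖ ^ σ ≤ κ := by rw [hκe, mul_assoc]; exact le_mul_of_one_le_left (by positivity) h2σ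
  have hKκ : K ≤ κ := (le_mul_of_one_le_right hK.le hzσ).trans hKκ'
  have hκ : 0 < κ := hK.trans_le hKκ
  have hbκ : ∀ w, r₀ ≤ ‖w‖ → ‖w‖ ≤ 2 * ‖z‖ → sphDeriv Φ w ≤ κ := fun w h1 h2 =>
    (hb w h1).trans (by rw [hκdef]; gcongr)
  have hgoal : 16000000 * (n : ℝ) ^ 5 * 2 ^ σ * K * ‖z‖ ^ σ = 16000000 * n ^ 5 * κ := by
    rw [hκe]; ring
  simp only [hgoal]
  have hκn : κ ≤ n ^ 5 * κ := le_mul_of_one_le_left hκ.le hn5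
  have hbz := hbκ z (by linarith) (by linarith)
  have hΘκ : Θ / κ ≤ Θ / K * ‖z‖ ^ (-σ) := by
    rw [Real.rpow_neg hzpos.le, ← div_eq_mul_inv, div_div]
    gcongr
  have hΘr : Θ < κ * (6 / 7 * ‖z‖) := by
    have h1 : 7 / 6 * Θ / K < ‖z‖ := by linarith
    rw [div_lt_iff₀ hK] at h1
    nlinarith
  by_cases hle : ‖f z‖ ≤ 2 * ‖H z‖
  · have hsm : ∀ w ∈ ball z (1 / (20 * κ)), ‖w - z‖ ≤ 1 / (20 * κ) := fun w hw => by
      rw [← dist_eq_norm]; exact (mem_ball.1 hw).le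
    have h20 : 1 / (20 * κ) ≤ Θ / κ := by
      rw [div_le_div_iff₀ (by positivity) hκ]; nlinarith
    have h20z : 1 / (20 * κ) ≤ ‖z‖ / 2 := by
      rw [div_le_div_iff₀ (by positivity) (by norm_num)]; nlinarith
    refine exists_logGrad_close_of_le hn hΦ h0 he heH hΦe hκ (fun w hw => ?_)
      (fun w hw => hrl z hzl w ((hsm w hw).trans (h20.trans hΘκ))) hle
    have h1 := hsm w hw
    have h2 := norm_le_norm_add_norm_sub' z w
    have h3 := norm_le_norm_add_norm_sub' w z
    rw [norm_sub_rev] at h2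
    exact hbκ w (by linarith) (by linarith)
  push Not at hle
  have hzS : z ∉ S := fun h => by
    have h1 : ‖f z‖ ≤ ‖H z‖ := h
    linarith [hHpos z]
  -- it remains to study the logarithmic derivative of `f`
  suffices hsuff : ∃ k, ‖deriv f z / f z - (p k).derivative.eval z‖ ≤ 7000000 * n ^ 5 * κ by
    obtain ⟨k, hk⟩ := hsuff
    refine ⟨k, ?_⟩
    have h1 := norm_logDeriv_inner_sub_logGrad_le_mul (m := 2) he (hΦ z) (hf0 z hzS)
      (le_of_sq_le_sq (by
        rw [hsplit z]
        nlinarith [pow_le_pow_left₀ (norm_nonneg (H z)) (hnotS z hzS).le 2,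
          sq_nonneg ‖f z‖]) (by positivity)) hbz
    have h2 := norm_sub_le_norm_sub_add_norm_sub (logGrad Φ z) (deriv f z / f z)
      ((p k).derivative.eval z)
    rw [norm_sub_rev (logGrad Φ z) (_ / _)] at h2
    linarith
  rcases exists_touching_ball_or_sector hS (by linarith) hzS hz7 with
    ⟨c, R, w, hR, hdisj, hwS, hwc, hw1, hw2, hzc, hcz, hRz, hcR⟩ | hsect
  · have hdom : ∀ y ∈ ball c R, ‖H y‖ < ‖f y‖ := fun y hy =>
      hnotS y (disjoint_left.1 hdisj hy)
    obtain ⟨N, hN1, hN2⟩ : ∃ N : ℕ, 3 * κ * R < N ∧ (N : ℝ) ≤ 3 * κ * R + 1 := by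
      refine ⟨⌊3 * κ * R⌋₊ + 1, by exact_mod_cast Nat.lt_floor_add_one _, ?_⟩
      push_cast
      linarith [Nat.floor_le (show 0 ≤ 3 * κ * R by positivity)]
    obtain ⟨htie, hζ⟩ := exists_norm_inner_le_pow_mul hΦ h0 he heH hΦe hR hdom hwc hwS hHc
      (hbκ w hw1 hw2) hN1
    by_cases hlarge : Θ ≤ κ * R
    · obtain ⟨k, hk⟩ := exists_logDeriv_close_of_large hfd p hA hD hAh hDh hR hzc hlarge hdom
        hN2 hζ
      exact ⟨k, by linarith⟩
    · push Not at hlarge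
      have hRsmall : R < 6 / 7 * ‖z‖ := lt_of_mul_lt_mul_left (hlarge.trans hΘr) hκ.le
      obtain rfl : c = z := hcR.resolve_right (not_le.2 hRsmall)
      have hRΘ : R ≤ Θ / κ := by rw [le_div_iff₀ hκ]; linarith
      have hκR : 3 / 20 ≤ κ * R := by
        by_cases hR2 : R ≤ ‖c‖ / 2
        · refine le_mul_radius_of_centered hΦ h0 he heH hΦe (fun y hy => ?_) hwc htie hle.le
          rw [mem_closedBall, dist_eq_norm] at hy
          have h2 := norm_le_norm_add_norm_sub' c y
          have h3 := norm_le_norm_add_norm_sub' y c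
          rw [norm_sub_rev] at h2
          exact hbκ y (by linarith) (by linarith)
        · push Not at hR2
          have h1 := mul_lt_mul_of_pos_left hR2 hκ
          linarith
      exact exists_logDeriv_close_of_centered hn hΦ hR hκ hκR hdom
        (fun y hy => hrl c hzl y (by
          rw [← dist_eq_norm]
          exact (mem_ball.1 hy).le.trans (hRΘ.trans hΘκ))) hN2 hζ
  · refine ⟨k₀, ?_⟩
    have h1 := hrs z (fun w => exp ((p k₀).eval w) / (A * f w)) hzs (fun θ hθ => ?_) hM
    · rw [deriv_exp_div (p k₀) hA (hfd z) (hf0 z hzS), norm_sub_rev] at h1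
      linarith
    · have hball : ∀ y ∈ ball (exp (θ * I) * z) (‖z‖ - r₀), y ∉ S := fun y hy =>
        disjoint_left.1 (hsect θ hθ) hy
      refine ⟨fun y hy => (((p k₀).differentiable y).cexp.div ((hfd y).const_mul _)
        (mul_ne_zero hA0 (hf0 y (hball y hy)))).differentiableWithinAt, fun y hy =>
        ⟨div_ne_zero (exp_ne_zero _) (mul_ne_zero hA0 (hf0 y (hball y hy))), ?_⟩⟩
      have hy0 := norm_pos_iff.2 (hf0 y (hball y hy))
      rw [norm_div, norm_mul, Complex.norm_real, Real.norm_eq_abs, abs_of_pos hA,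
        div_lt_one (mul_pos hA hy0)]
      exact (hAh y k₀).trans_lt (mul_lt_mul_of_pos_left (hnotS y (hball y hy)) hA)

end Uniform

end

/-! ### Normalisation and growth of the characteristic -/

section

section Normalization

variable {n : ℕ} {f : ℂ → PSpace n} {F : Fin (n + 1) → ℂ → ℂ}

theorem IsHomogeneousRepresentation.mul (h : IsHomogeneousRepresentation f F) {g : ℂ → ℂ}
    (hg : Differentiable ℂ g) (hg0 : ∀ z, g z ≠ 0) :
    IsHomogeneousRepresentation f fun j z => g z * F j z := by
  refine ⟨fun j => hg.mul (h.1 j), fun z => ?_⟩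
  obtain ⟨h0, hf⟩ := h.2 z
  have e : (fun j => g z * F j z) = g z • fun j => F j z := rfl
  refine ⟨by rw [e]; exact smul_ne_zero (hg0 z) h0, ?_⟩
  rw [hf, eq_comm, Projectivization.mk_eq_mk_iff']
  exact ⟨g z, rfl⟩

theorem fsDeriv_mul (h : IsHomogeneousRepresentation f F) {g : ℂ → ℂ} (hg : Differentiable ℂ g)
    (hg0 : ∀ z, g z ≠ 0) : fsDeriv (fun j z => g z * F j z) = fsDeriv F := by
  funext z
  rw [fsDeriv_eq_sphDeriv (h.mul hg hg0), fsDeriv_eq_sphDeriv h,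
    ← sphDeriv_smul (differentiable_vecRep h.1 z) (hg z) (vecRep_ne_zero h z) (hg0 z)]
  rfl

theorem Omits.apply_ne_zero (h : IsHomogeneousRepresentation f F)
    {l : Module.Dual ℂ (Fin (n + 1) → ℂ)} (hl : Omits f l) (z : ℂ) :
    l (fun j => F j z) ≠ 0 := by
  intro h0
  obtain ⟨hF, hf⟩ := h.2 z
  apply hl z
  rw [hyperplane, mem_ofPred_eq, hf, Projectivization.submodule_mk, Submodule.span_singleton_le_iff_mem]
  exact h0

/-- A homogeneous representation can be normalised so that a form without zeros on the curve takes
the value `1`. -/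
theorem exists_normalized_representation (hF : IsHomogeneousRepresentation f F)
    {ι : Type*} {l : ι → Module.Dual ℂ (Fin (n + 1) → ℂ)} (hl : ∀ i, Omits f (l i)) (i₀ : ι) :
    ∃ G : Fin (n + 1) → ℂ → ℂ, IsHomogeneousRepresentation f G ∧ fsDeriv G = fsDeriv F ∧
      ∃ h : ι → ℂ → ℂ, (∀ i, Differentiable ℂ (h i)) ∧
        (∀ i z, l i (fun j => G j z) = exp (h i z)) ∧ ∀ z, h i₀ z = 0 := by
  have hd : ∀ i, Differentiable ℂ fun z => l i (fun j => F j z) := fun i =>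
    (LinearMap.toContinuousLinearMap (l i)).differentiable.comp
      (differentiable_pi.2 hF.1)
  choose h hh hlh using fun i => exists_entire_log (hd i) (fun z => (hl i).apply_ne_zero hF z)
  have hg : Differentiable ℂ fun z => exp (-h i₀ z) := (hh i₀).neg.cexp
  refine ⟨fun j z => exp (-h i₀ z) * F j z, hF.mul hg fun z => exp_ne_zero _,
    fsDeriv_mul hF hg fun z => exp_ne_zero _, fun i z => h i z - h i₀ z,
    fun i => (hh i).sub (hh i₀), fun i z => ?_, fun z => sub_self _⟩
  have e : (fun j => exp (-h i₀ z) * F j z) = exp (-h i₀ z) • fun j => F j z := rfl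
  rw [e, map_smul, hlh, smul_eq_mul, ← exp_add]
  congr 1; ring

/-- The form in which growth estimates are proved: for the normalised representation, in terms of
radial means, with a pointwise bound outside a disc. -/
theorem upperGrowth_le_of_integral_radialMean
    {G : Fin (n + 1) → ℂ → ℂ} (hG : IsHomogeneousRepresentation f G)
    (hGF : fsDeriv G = fsDeriv F) {σ K C : ℝ} (hC : 0 < C)
    (hmain : ∀ K' r₀, 0 < K' → 1 ≤ r₀ →
      (∀ z, r₀ ≤ ‖z‖ → sphDeriv (vecRep G) z ≤ K' * ‖z‖ ^ σ) → ∀ B, K' * C < B →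
        ∀ᶠ r in atTop, ∫ t in (0 : ℝ)..r, radialMean (vecRep G) t ≤ B * r ^ (σ + 1))
    (hK : FSGrowth F σ K) : upperGrowth F (σ + 1) ≤ ((K * C : ℝ) : EReal) := by
  have hK0 := nonneg_of_FSGrowth hK
  refine upperGrowth_le fun B hB => ?_
  obtain ⟨K', hK1, hK2⟩ := exists_between ((lt_div_iff₀ hC).2 hB)
  obtain ⟨r₀, hr₀, hb⟩ := eventually_fsDeriv_le hK hK1
  have hev := hmain K' r₀ (hK0.trans_lt hK1) hr₀ (fun z hz => by
    rw [← fsDeriv_eq_sphDeriv hG, hGF]; exact hb z hz) B ((lt_div_iff₀ hC).1 hK2)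
  filter_upwards [hev, eventually_ge_atTop 0] with r hr hr0
  have e : characteristic F r = characteristic G r := by
    simp only [characteristic, hGF]
  rwa [e, characteristic_eq hG hr0]

end Normalization

section GeneralPosition

variable {n : ℕ}

theorem InGeneralPosition.linearIndependent {l : Fin n → Module.Dual ℂ (Fin (n + 1) → ℂ)}
    (hl : InGeneralPosition l) : LinearIndependent ℂ l := by
  have h := hl Finset.univ (by simp)
  exact h.comp (fun i : Fin n => (⟨i, Finset.mem_univ i⟩ : (Finset.univ : Finset (Fin n))))
    (fun i j hij => by simpa using hij)

/-- Growth of a curve on which linearly independent forms have no zeros, one of them being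
normalised to `1`. The constant does not depend on the forms.

A linear change of coordinates, which costs a factor depending on the forms, shows that the exponents
are polynomials of degree at most `σ + 1`; this qualitative information suffices for the bound with a
uniform constant. -/
theorem eventually_characteristic_le_of_forms {F : Fin (n + 1) → ℂ → ℂ}
    (hF : ∀ j, Differentiable ℂ (F j)) {l : Fin n → Module.Dual ℂ (Fin (n + 1) → ℂ)}
    (hl : LinearIndependent ℂ l) {h : Fin n → ℂ → ℂ} (hh : ∀ k, Differentiable ℂ (h k))
    (hlF : ∀ k z, l k (fun j => F j z) = exp (h k z)) {k₁ : Fin n} (hk₁ : ∀ z, h k₁ z = 0)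
    {σ K r₀ : ℝ} (hσ : 0 ≤ σ) (hK : 0 < K) (hr₀ : 1 ≤ r₀)
    (hb : ∀ z, r₀ ≤ ‖z‖ → sphDeriv (vecRep F) z ≤ K * ‖z‖ ^ σ) {B : ℝ}
    (hB : 16000000 * n ^ 5 * 2 ^ σ * K * (2 * n - 1) / (σ + 1) < B) :
    ∀ᶠ r in atTop, ∫ t in (0 : ℝ)..r, radialMean (vecRep F) t ≤ B * r ^ (σ + 1) := by
  have hn : 0 < n := Fin.pos k₁
  have hΦ := differentiable_vecRep hF
  set L := (WithLp.linearEquiv 2 ℂ (Fin (n + 1) → ℂ)) with hL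
  set l' : Fin n → Module.Dual ℂ (EuclideanSpace ℂ (Fin (n + 1))) := fun k => L.dualMap (l k) with hl'
  have hl'i : LinearIndependent ℂ l' := hl.map' L.dualMap.toLinearMap (LinearEquiv.ker _)
  have hl'F : ∀ k z, l' k (vecRep F z) = exp (h k z) := fun k z => hlF k z
  have h0 : ∀ z, vecRep F z ≠ 0 := fun z hz => by
    have := hl'F k₁ z
    rw [hz, map_zero] at this
    exact exp_ne_zero _ this.symm
  obtain ⟨e, P, he, heP, hle, hlP, hsplit⟩ :=
    exists_adapted_basis (V := EuclideanSpace ℂ (Fin (n + 1))) (by simp) l' hl'i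
  -- in the coordinates `⟪e, ·⟫, l 0, …, l (n - 1)` the omitted hyperplanes are coordinate ones
  set G : Fin (n + 1) → ℂ → ℂ := Fin.cons (fun z => inner ℂ e (vecRep F z)) (fun k z => exp (h k z))
    with hGdef
  have hG0 : ∀ z, G 0 z = inner ℂ e (vecRep F z) := fun z => rfl
  have hGs : ∀ (k : Fin n) z, G k.succ z = exp (h k z) := fun k z => rfl
  have hGd : ∀ j, Differentiable ℂ (G j) := fun j => by
    refine Fin.cases ?_ (fun k => ?_) j
    · exact differentiable_inner_left hΦ e
    · exact (hh k).cexp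
  let M : EuclideanSpace ℂ (Fin (n + 1)) →ₗ[ℂ] EuclideanSpace ℂ (Fin (n + 1)) :=
    L.symm.toLinearMap ∘ₗ LinearMap.pi
      (Fin.cons ((innerSL ℂ e : EuclideanSpace ℂ (Fin (n + 1)) →L[ℂ] ℂ) :
        EuclideanSpace ℂ (Fin (n + 1)) →ₗ[ℂ] ℂ) l')
  let M' : EuclideanSpace ℂ (Fin (n + 1)) →ₗ[ℂ] EuclideanSpace ℂ (Fin (n + 1)) :=
    (Fintype.linearCombination ℂ (Fin.cons e P : Fin (n + 1) → EuclideanSpace ℂ (Fin (n + 1)))) ∘ₗ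
      L.toLinearMap
  have hM : ∀ z, vecRep G z = LinearMap.toContinuousLinearMap M (vecRep F z) := fun z => by
    ext j
    refine Fin.cases ?_ (fun k => ?_) j
    · rfl
    · exact (hl'F k z).symm
  have hM' : ∀ z, vecRep F z = LinearMap.toContinuousLinearMap M' (vecRep G z) := fun z => by
    have e1 : LinearMap.toContinuousLinearMap M' (vecRep G z) =
        ∑ j, G j z • (Fin.cons e P : Fin (n + 1) → EuclideanSpace ℂ (Fin (n + 1))) j := rfl
    rw [e1, Fin.sum_univ_succ]
    simp only [Fin.cons_zero, Fin.cons_succ, hG0, hGs]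
    have := hsplit (vecRep F z)
    simp only [hl'F] at this
    exact this
  set m := ‖LinearMap.toContinuousLinearMap M‖ * ‖LinearMap.toContinuousLinearMap M'‖ with hm
  have hm0 : 0 ≤ m := by positivity
  obtain ⟨-, hpoly⟩ := eventually_characteristic_le_of_coordinates (K := (m + 1) * K) (r₀ := r₀)
    hGd hh hGs hk₁ hσ (by positivity) hr₀ (fun z hz => by
      refine (sphDeriv_comp_le _ _ (hΦ z) (h0 z) hM hM').trans ?_
      calc m * sphDeriv (vecRep F) z ≤ (m + 1) * (K * ‖z‖ ^ σ) :=
            mul_le_mul (by linarith) (hb z hz) (sphDeriv_nonneg _ z) (by positivity)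
        _ = (m + 1) * K * ‖z‖ ^ σ := by ring)
  choose p hp hpd using hpoly
  set A := (∑ k, ‖LinearMap.toContinuousLinearMap (l' k)‖) + 1 with hA
  have hApos : 0 < A := by positivity
  have hPA : ∀ (g : Fin n → ℂ) k, ‖g k‖ ≤ A * ‖∑ j, g j • P j‖ := by
    intro g k
    have e1 : g k = LinearMap.toContinuousLinearMap (l' k) (∑ j, g j • P j) := by
      simp [hlP]
    calc ‖g k‖ ≤ ‖LinearMap.toContinuousLinearMap (l' k)‖ * ‖∑ j, g j • P j‖ := by
          conv_lhs => rw [e1]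
          exact ContinuousLinearMap.le_opNorm _ _
      _ ≤ A * ‖∑ j, g j • P j‖ := by
          gcongr
          have := Finset.single_le_sum (f := fun k => ‖LinearMap.toContinuousLinearMap (l' k)‖)
            (fun _ _ => norm_nonneg _) (Finset.mem_univ k)
          rw [hA]
          simp only at this
          linarith
  obtain ⟨r₁, hr₁⟩ := exists_logGrad_close_uniform hn hΦ h0 he heP hApos hPA hσ hK hr₀ p hpd
    (fun z => by
      conv_lhs => rw [hsplit (vecRep F z)]
      simp only [hl'F, hp]) hb
  exact eventually_characteristic_le_of_logGrad hΦ h0 hn (fun k => (p k).derivative) hσ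
    (by positivity) hr₁ hB

end GeneralPosition

section Constants

/-- The comparison of the constant obtained here with the required one. -/
theorem sqrt_mul_le_explicit {n : ℕ} (hn : 1 ≤ n) :
    16 * Real.sqrt (n + 1) * (2 * n - 1) ≤ 6 * (n * ((n : ℝ) + 1) ^ 2) := by
  have hn' : (1 : ℝ) ≤ n := by exact_mod_cast hn
  set s := Real.sqrt (n + 1) with hs
  have hs2 : s ^ 2 = n + 1 := Real.sq_sqrt (by positivity)
  have hs1 : 0 ≤ s := Real.sqrt_nonneg _
  have hs3 : s ≤ (100 * n + 389) / 340 := by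
    -- the tangent to the square root at `(17 / 10) ^ 2`
    rw [le_div_iff₀ (by norm_num)]
    nlinarith [sq_nonneg (s - 17 / 10)]
  have h1 : 16 * s * (2 * n - 1) ≤ 16 * ((100 * n + 389) / 340) * (2 * n - 1) := by
    gcongr
    linarith
  refine h1.trans ?_
  obtain ⟨x, hx⟩ : ∃ x : ℝ, (n : ℝ) = 1 + x := ⟨n - 1, by ring⟩
  have hx0 : 0 ≤ x := by linarith
  rw [hx, ← sub_nonneg]
  have e : 6 * ((1 + x) * (1 + x + 1) ^ 2) -
      16 * ((100 * (1 + x) + 389) / 340) * (2 * (1 + x) - 1) =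
      6 * x ^ 3 + (350 / 17) * (x - 1 / 15) ^ 2 + 4 / 255 * x + 686 / 765 := by
    ring
  rw [e]
  positivity

theorem explicitConstant_pos (n : ℕ) {σ : ℝ} (hσ : 0 ≤ σ) : 0 < explicitConstant n σ := by
  unfold explicitConstant; positivity

/-- The second term of the explicit constant alone dominates the constant obtained for coordinate
hyperplanes. -/
theorem lt_of_mul_explicitConstant_lt {n : ℕ} (hn : 1 ≤ n) {σ K B : ℝ} (hσ : 0 ≤ σ) (hK : 0 < K)
    (hB : K * explicitConstant n σ < B) :
    16 * Real.sqrt (n + 1) * 2 ^ σ * K * (2 * n - 1) / (σ + 1) < B := by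
  refine lt_of_le_of_lt ?_ hB
  have h1 := sqrt_mul_le_explicit hn
  have h2 : (2 : ℝ) ^ σ ≤ 4 ^ σ := Real.rpow_le_rpow (by norm_num) (by norm_num) hσ
  have h3 : 0 ≤ (2 : ℝ) ^ (σ + 1) * (n + 1) := by positivity
  calc 16 * Real.sqrt (n + 1) * 2 ^ σ * K * (2 * n - 1) / (σ + 1)
      = K * (2 ^ σ * (16 * Real.sqrt (n + 1) * (2 * n - 1)) / (σ + 1)) := by ring
    _ ≤ K * (4 ^ σ * (6 * (n * ((n : ℝ) + 1) ^ 2)) / (σ + 1)) := by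
        have h4 : 0 ≤ 16 * Real.sqrt (n + 1) * (2 * (n : ℝ) - 1) := by
          have : (1 : ℝ) ≤ n := by exact_mod_cast hn
          exact mul_nonneg (by positivity) (by linarith)
        gcongr
    _ = K * (6 * 4 ^ σ * (n * (n + 1) ^ 2 / (σ + 1))) := by ring
    _ ≤ K * explicitConstant n σ := by
        unfold explicitConstant
        gcongr
        linarith

end Constants

theorem exists_upperGrowth_le_mul (n : ℕ) (hn : 1 ≤ n) (σ : ℝ) (hσ : 0 ≤ σ) :
    ∃ C : ℝ, 0 < C ∧ ∀ (f : ℂ → PSpace n) (F : Fin (n + 1) → ℂ → ℂ),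
      IsHomogeneousRepresentation f F → ∀ l : Fin n → Module.Dual ℂ (Fin (n + 1) → ℂ),
        InGeneralPosition l → (∀ i, Omits f (l i)) → ∀ K : ℝ, FSGrowth F σ K →
          upperGrowth F (σ + 1) ≤ ((K * C : ℝ) : EReal) := by
  have hn' : (1 : ℝ) ≤ n := by exact_mod_cast hn
  have h2n : 0 < 2 * (n : ℝ) - 1 := by linarith
  refine ⟨16000000 * n ^ 5 * 2 ^ σ * (2 * n - 1) / (σ + 1), by positivity, ?_⟩
  intro f F hF l hl hom K hK
  obtain ⟨G, hG, hGF, h, hh, hlG, hk₁⟩ := exists_normalized_representation hF hom ⟨0, hn⟩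
  refine upperGrowth_le_of_integral_radialMean hG hGF (by positivity) ?_ hK
  intro K' r₀ hK' hr₀ hb B hB
  refine eventually_characteristic_le_of_forms hG.1 hl.linearIndependent hh hlG hk₁ hσ hK' hr₀ hb
    (lt_of_eq_of_lt ?_ hB)
  ring

theorem upperGrowth_le_explicitConstant (n : ℕ) (hn : 1 ≤ n) (σ : ℝ) (hσ : 0 ≤ σ) (f : ℂ → PSpace n)
    (F : Fin (n + 1) → ℂ → ℂ) (hF : IsHomogeneousRepresentation f F)
    (hom : ∀ j : Fin n, Omits f (LinearMap.proj j.succ)) (K : ℝ) (hK : FSGrowth F σ K) :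
    upperGrowth F (σ + 1) ≤ ((K * explicitConstant n σ : ℝ) : EReal) := by
  obtain ⟨G, hG, hGF, h, hh, hlG, hk₁⟩ := exists_normalized_representation hF hom ⟨0, hn⟩
  refine upperGrowth_le_of_integral_radialMean hG hGF (explicitConstant_pos n hσ) ?_ hK
  intro K' r₀ hK' hr₀ hb B hB
  exact (eventually_characteristic_le_of_coordinates hG.1 hh (fun k z => hlG k z) hk₁ hσ hK' hr₀
    hb).1 B (lt_of_mul_explicitConstant_lt hn hσ hK' hB)

theorem upperGrowth_lt_top {n : ℕ} {σ : ℝ} (hσ : 0 ≤ σ) {f : ℂ → PSpace n}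
    {F : Fin (n + 1) → ℂ → ℂ} (hF : IsHomogeneousRepresentation f F) {K : ℝ}
    (hK : FSGrowth F σ K) : upperGrowth F (2 * σ + 2) < ⊤ := by
  obtain ⟨r₀, -, hb⟩ := eventually_fsDeriv_le hK (lt_add_one K)
  have hK0 := nonneg_of_FSGrowth hK
  obtain ⟨C, hC, h⟩ := exists_integral_radialMean_le (K := K + 1) (differentiable_vecRep hF.1)
    (vecRep_ne_zero hF) hσ (by linarith) fun z hz => by
      rw [← fsDeriv_eq_sphDeriv hF]; exact hb z hz
  refine (upperGrowth_le (B := C) fun B' hB' => ?_).trans_lt (EReal.coe_lt_top C)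
  filter_upwards [eventually_ge_atTop 1] with r hr
  rw [characteristic_eq hF (by linarith)]
  refine (h r hr).trans ?_
  gcongr

end

end HolCurve

theorem mainTheorem1 (n : ℕ) (hn : 1 ≤ n) (σ : ℝ) (hσ : 0 ≤ σ) :
    -- a constant depending only on `n` and `σ`, for all hyperplanes in general position
    (∃ C : ℝ, 0 < C ∧
      ∀ (f : ℂ → HolCurve.PSpace n) (F : Fin (n + 1) → ℂ → ℂ),
        HolCurve.IsHomogeneousRepresentation f F →
      ∀ l : Fin n → Module.Dual ℂ (Fin (n + 1) → ℂ),
        HolCurve.InGeneralPosition l → (∀ i, HolCurve.Omits f (l i)) →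
      ∀ K : ℝ, HolCurve.FSGrowth F σ K →
        HolCurve.upperGrowth F (σ + 1) ≤ ((K * C : ℝ) : EReal)) ∧
    -- the explicit constant, in coordinates where the omitted hyperplanes are `w_1 = 0, …, w_n = 0`
    (∀ (f : ℂ → HolCurve.PSpace n) (F : Fin (n + 1) → ℂ → ℂ),
        HolCurve.IsHomogeneousRepresentation f F →
        (∀ j : Fin n, HolCurve.Omits f (LinearMap.proj j.succ)) →
      ∀ K : ℝ, HolCurve.FSGrowth F σ K →
        HolCurve.upperGrowth F (σ + 1) ≤
          ((K * HolCurve.explicitConstant n σ : ℝ) : EReal)) ∧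
    -- the trivial bound, for arbitrary curves
    (∀ (f : ℂ → HolCurve.PSpace n) (F : Fin (n + 1) → ℂ → ℂ),
        HolCurve.IsHomogeneousRepresentation f F →
      ∀ K : ℝ, HolCurve.FSGrowth F σ K →
        HolCurve.upperGrowth F (2 * σ + 2) < ⊤) := by
  exact ⟨HolCurve.exists_upperGrowth_le_mul n hn σ hσ,
    HolCurve.upperGrowth_le_explicitConstant n hn σ hσ,
    fun _ _ hF _ hK => HolCurve.upperGrowth_lt_top hσ hF hK⟩
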